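/- **Notation.** Graded forms on $\mathbb R^3$ are sums $u=\sum_{l=0}^3u^l$ of complex-valued $l$-forms. $\langle\cdot,\cdot\rangle$ is the bilinear (not Hermitian) inner product of graded forms for which the $dx^{\alpha_1}\wedge\dots\wedge dx^{\alpha_l}$, $\alpha_1<\dots<\alpha_l$, are orthonormal, $\ast$ is the Hodge star, and for an $m$-form $v$ and an $l$-form $u$ the vee product is $v\vee u=(-1)^{(3+m-l)(l-m)}\ast(v\wedge\ast u)$ (zero if $m>l$). $d$ is the exterior derivative and $\delta$ its formal adjoint, $\int\langle\delta u,\varphi\rangle\,dx=\int\langle u,d\varphi\rangle\,dx$ for compactly supported $C^1$ forms $\varphi$; both are taken in the weak sense. For $1$-forms $u,v$, $u\odot v=\tfrac12(u\otimes v+v\otimes u)$, and $D^\ast$ is the weak adjoint of the symmetric derivative, so $D^\ast(u\odot v)=-\sum_k\sum_j\partial_{x^j}(u_jv_k+u_kv_j)\,dx^k$. $L^2_{\rm loc}$ and $H^1_{\rm loc}$ of $\mathbb R^3$ refer to bounded sets. Powers and logarithms are principal branches. **Coefficients.** Let $\Omega\subset\mathbb R^3$ be a bounded non-empty open set whose boundary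 is locally the graph of a Lipschitz function, $B=\{|x|<R\}\supset\overline\Omega$, and let $\omega,\mu_0,\varepsilon_0>0$. For $j=1,2$ let $\mu_j,\varepsilon_j,\sigma_j\in C^1(\mathbb R^3)$ be real-valued with $\mu_j\ge\mu_0$, $\varepsilon_j\ge\varepsilon_0$, $\sigma_j\ge0$, and put $\gamma_j=\varepsilon_j+i\sigma_j/\omega$. Assume $\operatorname{supp}(\mu_j-\mu_0)\subset B$, $\operatorname{supp}(\gamma_j-\varepsilon_0)\subset B$, and $\gamma_1=\gamma_2$, $\mu_1=\mu_2$ in $\mathbb R^3\setminus\Omega$. **Operators.** For $(\gamma,\mu)=(\gamma_j,\mu_j)$ write $a=\tfrac12\log\gamma$, $b=\tfrac12\log\mu$, and for graded forms $w,\varphi$ of class $H^1_{\rm loc}(\mathbb R^3)$ define $$P(d+\delta;\gamma,\mu,\omega)^tw=(d+\delta)\sum_{l=0}^3(-1)^{l+1}w^l+db\wedge w^1+db\vee(w^1+w^3)+da\wedge(w^0+w^2)-da\vee w^2+i\omega\gamma^{1/2}\mu^{1/2}w$$ and $$\begin{aligned}\langle Q(\gamma,\mu,\omega)w,\varphi\rangle=&-\int_{\mathbb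 R^3}\omega^2(\gamma\mu-\varepsilon_0\mu_0)\langle w,\varphi\rangle\,dx\\&+\int_{\mathbb R^3}\langle 2i\omega\,d(\gamma^{1/2}\mu^{1/2})\vee(w^1+w^3)+2i\omega\,d(\gamma^{1/2}\mu^{1/2})\wedge(w^0+w^2),\varphi\rangle\,dx\\&+\int_{\mathbb R^3}\langle da,da\rangle\langle w^0+w^2,\varphi^0+\varphi^2\rangle+\langle db,db\rangle\langle w^1+w^3,\varphi^1+\varphi^3\rangle\,dx\\&+\int_{\mathbb R^3}\langle da,d\langle-w^0+w^2,\varphi^0+\varphi^2\rangle\rangle+\langle db,d\langle w^1-w^3,\varphi^1+\varphi^3\rangle\rangle\,dx\\&+\int_{\mathbb R^3}\langle db,D^\ast(w^1\odot\varphi^1)\rangle\,dx+\int_{\mathbb R^3}\langle da,D^\ast(\ast w^2\odot\ast\varphi^2)\rangle\,dx.\end{aligned}$$ **Cauchy data.** $H^d(\Omega;\Lambda^l)$ (resp. $H^\delta(\Omega;\Lambda^l)$) is the space of $L^2$ $l$-forms $v$ in $\Omega$ with $dv\in L^2$ (resp. $\delta v\in L^2$), $H^1_0(\Omega;\Lambda^l)$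 is the closure in $H^1(\Omega;\Lambda^l)$ of the smooth forms with compact support in $\Omega$, and $TH^1(\partial\Omega;\Lambda^l)=H^1(\Omega;\Lambda^l)/H^1_0(\Omega;\Lambda^l)$. The traces $d\,\mathrm{tr}\,v$ of $v\in H^d(\Omega;\Lambda^l)$ and $\delta\,\mathrm{tr}\,v$ of $v\in H^\delta(\Omega;\Lambda^l)$ are the functionals $$\langle d\,\mathrm{tr}\,v,[u]\rangle=\int_\Omega\langle dv,u\rangle\,dx-\int_\Omega\langle v,\delta u\rangle\,dx,\qquad\langle\delta\,\mathrm{tr}\,v,[u]\rangle=(-1)^l\int_\Omega\langle\delta v,u\rangle\,dx-(-1)^l\int_\Omega\langle v,du\rangle\,dx$$ on $TH^1(\partial\Omega;\Lambda^{l+1})$ and $TH^1(\partial\Omega;\Lambda^{l-1})$ respectively. $C_j$ is the set of all pairs $(\delta\,\mathrm{tr}\,u^2,\,d\,\mathrm{tr}\,u^1)$ with $u^1\in H^d(\Omega;\Lambda^1)$, $u^2\in H^\delta(\Omega;\Lambda^2)$ and $$\delta u^2+i\omega\varepsilon_ju^1-du^1+i\omega\mu_ju^2=\sigma_ju^1\quad\text{almost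 everywhere in }\Omega.$$ **Proposition.** Let $w_1$ be a graded form with $w_1^l\in H^1_{\rm loc}(\mathbb R^3;\Lambda^l)$ such that $$\int_{\mathbb R^3}\langle\delta w_1,\delta\varphi\rangle+\langle dw_1,d\varphi\rangle-\omega^2\varepsilon_0\mu_0\langle w_1,\varphi\rangle\,dx+\langle Q(\gamma_1,\mu_1,\omega)w_1,\varphi\rangle=0$$ for all smooth compactly supported graded forms $\varphi$. Assume that $v_1=P(d+\delta;\gamma_1,\mu_1,\omega)^tw_1$ satisfies $v_1^0+v_1^3=0$. Let $v_2$ be a graded form with $v_2^l\in H^1_{\rm loc}(\mathbb R^3;\Lambda^l)$ and $P(d+\delta;\gamma_2,\mu_2,\omega)^tv_2=0$. Then $C_1=C_2$ implies $$\langle(Q(\gamma_2,\mu_2,\omega)-Q(\gamma_1,\mu_1,\omega))w_1,v_2\rangle=0,$$ where the left-hand side is $\langle Q(\gamma_2,\mu_2,\omega)w_1,v_2\rangle-\langle Q(\gamma_1,\mu_1,\omega)w_1,v_2\rangle$. -/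

import Mathlib

open MeasureTheory Topology

noncomputable section

namespace GradedForms

/-- Three-dimensional Euclidean space. -/
abbrev E3 : Type := EuclideanSpace ℝ (Fin 3)
/-- Complex graded forms on `ℝ³` at a point, `⨁ₗ Λˡ`, in the basis
`dx^S = dx^{s₁} ∧ ⋯ ∧ dx^{sₗ}`, where `S = {s₁ < ⋯ < sₗ} ⊆ {0, 1, 2}`: a graded form is the family of
its component functions `u S`.  A graded form field is a function `E3 → Form`. -/
abbrev Form : Type := Finset (Fin 3) → ℂ

/-- The sign with `dx^S ∧ dx^T = shuffleSign S T • dx^(S ∪ T)` for disjoint `S`, `T`. -/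
def shuffleSign (S T : Finset (Fin 3)) : ℂ :=
  (-1) ^ ((S ×ˢ T).filter (fun p => p.2 < p.1)).card

/-- The exterior product. -/
def wedge (u v : Form) : Form :=
  fun A => ∑ S ∈ A.powerset, shuffleSign S (A \ S) * (u S * v (A \ S))

/-- The bilinear (not Hermitian) inner product for which the `dx^S` are orthonormal. -/
def ip (u v : Form) : ℂ := ∑ S, u S * v S

/-- The part of degree `l` of a graded form. -/
def deg (l : ℕ) (u : Form) : Form := fun S => if S.card = l then u S else 0

/-- The Hodge star: `⋆ dx^S = shuffleSign S Sᶜ • dx^(Sᶜ)`. -/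
def hodgeStar (u : Form) : Form := fun A => shuffleSign Aᶜ A * u Aᶜ

/-- The vee product: on an `m`-form `v` and an `l`-form `u` it is
`(-1)^((n + m - l)(l - m)) ⋆ (v ∧ ⋆ u)` with `n = 3`, and it is zero for `m > l`. -/
def vee (v u : Form) : Form :=
  ∑ m ∈ Finset.range 4, ∑ l ∈ Finset.Icc m 3,
    ((-1 : ℂ) ^ ((3 + m - l) * (l - m))) • hodgeStar (wedge (deg m v) (hodgeStar (deg l u)))

/-- The coordinate one-form `dx^j`. -/
def dx (j : Fin 3) : Form := Pi.single {j} 1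

/-- Contraction with the `j`-th coordinate vector, the adjoint of `dx^j ∧ ·`. -/
def cont (j : Fin 3) (u : Form) : Form :=
  fun A => if j ∈ A then 0 else shuffleSign {j} A * u (insert j A)

lemma wedge_dx (j : Fin 3) (u : Form) : wedge (dx j) u =
    fun A => if j ∈ A then shuffleSign {j} (A \ {j}) * u (A \ {j}) else 0 := by
  funext A
  unfold wedge dx
  split_ifs with h
  · rw [Finset.sum_eq_single {j}]
    · simp
    · intro b _ hb; simp [hb]
    · intro hb; simp [h] at hb
  · apply Finset.sum_eq_zero
    intro b hb
    have : b ≠ {j} := by rintro rfl; simp [h] at hb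
    simp [this]

lemma ip_wedge_dx (j : Fin 3) (u v : Form) : ip (wedge (dx j) u) v = ip u (cont j v) := by
  rw [wedge_dx]
  unfold ip cont
  simp only [ite_mul, zero_mul, mul_ite, mul_zero]
  have hR : ∀ F : Finset (Fin 3) → ℂ,
      (∑ A, if j ∈ A then 0 else F A) = ∑ A with j ∉ A, F A := by
    intro F; rw [Finset.sum_filter]; simp only [ite_not]
  rw [hR, ← Finset.sum_filter]
  refine Finset.sum_bij' (fun A _ => A.erase j) (fun A _ => insert j A) ?_ ?_ ?_ ?_ ?_
  · intro A hA; simp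
  · intro A hA; simp
  · intro A hA; simp at hA; simp [hA]
  · intro A hA; simp at hA; simp [hA]
  · intro A hA
    simp at hA
    rw [Finset.sdiff_singleton_eq_erase]; simp [Finset.insert_erase hA]; ring

lemma codiff_symbol (j : Fin 3) (u : Form) :
    ∑ l ∈ Finset.range 4, ((-1 : ℂ) ^ (3 * (l + 1) + 1)) •
      hodgeStar (wedge (dx j) (hodgeStar (deg l u))) = - cont j u := by
  funext A
  simp only [wedge_dx, Finset.sum_apply, Pi.smul_apply, hodgeStar, cont, deg, smul_eq_mul, Pi.neg_apply, shuffleSign]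
  have e1 : ∀ A : Finset (Fin 3), j ∉ A → (Aᶜ \ {j})ᶜ = insert j A := by
    revert j; decide
  have e2 : ∀ A : Finset (Fin 3), j ∉ A →
    ((3 * ((insert j A).card + 1) + 1) +  ((Aᶜ ×ˢ A).filter (fun p => p.2 < p.1)).card
     + ((({j}: Finset (Fin 3)) ×ˢ (Aᶜ \ {j})).filter (fun p => p.2 < p.1)).card +
       (((insert j A) ×ˢ (Aᶜ \ {j})).filter (fun p => p.2 < p.1)).card) % 2 =
     (1 + ((({j}: Finset (Fin 3)) ×ˢ A).filter (fun p => p.2 < p.1)).card) % 2 := by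
    clear A u
    revert j; decide
  by_cases h : j ∈ A
  · simp [h]
  · have hc : (insert j A).card ∈ Finset.range 4 := by
      have := Finset.card_le_univ (insert j A)
      simp at this ⊢; omega
    simp only [Finset.mem_compl, h, not_false_eq_true, if_true, if_false, e1 A h]
    rw [Finset.sum_eq_single (insert j A).card]
    · simp only [if_true]
      have h2 := e2 A h
      have h3 : ∀ a b : ℕ, a % 2 = b % 2 → (-1:ℂ)^a = (-1)^b := by
        intro a b hab
        rw [neg_one_pow_eq_pow_mod_two, hab, ← neg_one_pow_eq_pow_mod_two]
      have h4 := h3 _ _ h2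
      simp only [pow_add _ (_) _] at h4 ⊢
      linear_combination (u (insert j A)) * h4
    · intro b _ hb
      simp [hb.symm]
    · intro h'; exact absurd hc h'

/-- The classical partial derivative `∂_j`. -/
def pderiv {F : Type*} [NormedAddCommGroup F] [NormedSpace ℝ F]
    (j : Fin 3) (u : E3 → F) (x : E3) : F :=
  fderiv ℝ u x (EuclideanSpace.single j 1)

/-- The classical exterior derivative `d u = ∑ du_S ∧ dx^S`. -/
def extD (u : E3 → Form) (x : E3) : Form := ∑ j, wedge (dx j) (pderiv j u x)

/-- The classical formal adjoint derivative, `δ u = (-1)^(n (l + 1) + 1) ⋆ d ⋆ u` on `l`-forms,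
with `n = 3`. -/
def codiff (u : E3 → Form) (x : E3) : Form :=
  ∑ l ∈ Finset.range 4,
    ((-1 : ℂ) ^ (3 * (l + 1) + 1)) • hodgeStar (extD (fun y => hodgeStar (deg l (u y))) x)

/-- A number as a `0`-form. -/
def scalarForm (c : ℂ) : Form := Pi.single ∅ c

/-- Test forms: graded forms of class `C^k` with compact support in `U`. -/
structure IsTest (k : WithTop ℕ∞) (U : Set E3) (w : E3 → Form) : Prop where
  contDiff : ContDiff ℝ k w
  hasCompactSupport : HasCompactSupport w
  tsupport_subset : tsupport w ⊆ U

/-- `v` is the weak exterior derivative of `u` in `U`. -/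
structure IsWeakD (U : Set E3) (u v : E3 → Form) : Prop where
  locInt : LocallyIntegrableOn u U
  locInt' : LocallyIntegrableOn v U
  integral_eq : ∀ w, IsTest 1 U w → ∫ x in U, ip (v x) (w x) = ∫ x in U, ip (u x) (codiff w x)

/-- `v` is the weak formal adjoint derivative of `u` in `U`. -/
structure IsWeakCod (U : Set E3) (u v : E3 → Form) : Prop where
  locInt : LocallyIntegrableOn u U
  locInt' : LocallyIntegrableOn v U
  integral_eq : ∀ w, IsTest 1 U w → ∫ x in U, ip (v x) (w x) = ∫ x in U, ip (u x) (extD w x)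

open Classical in
/-- The weak exterior derivative `d u` in `U` (unique up to null sets for open `U`); zero if there
is none. -/
def weakD (U : Set E3) (u : E3 → Form) : E3 → Form :=
  if h : ∃ v, IsWeakD U u v then h.choose else 0

open Classical in
/-- The weak formal adjoint derivative `δ u` in `U` (unique up to null sets for open `U`); zero if
there is none. -/
def weakCod (U : Set E3) (u : E3 → Form) : E3 → Form :=
  if h : ∃ v, IsWeakCod U u v then h.choose else 0

lemma weakD_spec {U : Set E3} {u : E3 → Form} (h : ∃ v, IsWeakD U u v) :
    IsWeakD U u (weakD U u) := by
  unfold weakD; rw [dif_pos h]; exact h.choose_spec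

lemma weakCod_spec {U : Set E3} {u : E3 → Form} (h : ∃ v, IsWeakCod U u v) :
    IsWeakCod U u (weakCod U u) := by
  unfold weakCod; rw [dif_pos h]; exact h.choose_spec

/-- `dx^j ∧ ·` as a linear map. -/
def wedgeL (j : Fin 3) : Form →L[ℂ] Form := LinearMap.toContinuousLinearMap
  { toFun := wedge (dx j)
    map_add' := by intro a b; rw [wedge_dx, wedge_dx, wedge_dx]; funext A; simp; split_ifs <;> ring
    map_smul' := by intro c b; rw [wedge_dx, wedge_dx]; funext A; simp only [Pi.smul_apply, smul_eq_mul, RingHom.id_apply]; split_ifs <;> ring }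

/-- `cont j` as a linear map. -/
def contL (j : Fin 3) : Form →L[ℂ] Form := LinearMap.toContinuousLinearMap
  { toFun := cont j
    map_add' := by intro a b; funext A; simp [cont]; split_ifs <;> ring
    map_smul' := by intro c b; funext A; simp only [cont, Pi.smul_apply, smul_eq_mul, RingHom.id_apply]; split_ifs <;> ring }

/-- `u ↦ ⋆ uˡ` as a linear map. -/
def starDegL (l : ℕ) : Form →L[ℂ] Form := LinearMap.toContinuousLinearMap
  { toFun := fun u => hodgeStar (deg l u)
    map_add' := by intro a b; funext A; simp [hodgeStar, deg]; split_ifs <;> ring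
    map_smul' := by intro c b; funext A; simp only [hodgeStar, deg, Pi.smul_apply, smul_eq_mul, RingHom.id_apply]; split_ifs <;> ring }

/-- The Hodge star as a linear map. -/
def starL : Form →L[ℂ] Form := LinearMap.toContinuousLinearMap
  { toFun := fun u => hodgeStar u
    map_add' := by intro a b; funext A; simp [hodgeStar]; ring
    map_smul' := by intro c b; funext A; simp [hodgeStar]; ring }

lemma pderiv_clm (L : Form →L[ℂ] Form) {w : E3 → Form} {x : E3} (hw : DifferentiableAt ℝ w x)
    (j : Fin 3) : pderiv j (fun y => L (w y)) x = L (pderiv j w x) := by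
  unfold pderiv
  have := ((L.restrictScalars ℝ).hasFDerivAt.comp x hw.hasFDerivAt).fderiv
  have h2 : (fun y => L (w y)) = (L.restrictScalars ℝ) ∘ w := rfl
  rw [h2, this]; rfl

lemma codiff_eq {w : E3 → Form} {x : E3} (hw : DifferentiableAt ℝ w x) :
    codiff w x = - ∑ j, cont j (pderiv j w x) := by
  unfold codiff extD
  have h1 : ∀ l j, pderiv j (fun y => hodgeStar (deg l (w y))) x
      = hodgeStar (deg l (pderiv j w x)) := fun l j => pderiv_clm (starDegL l) hw j
  have h2 : ∀ f : Fin 3 → Form, hodgeStar (∑ j, f j) = ∑ j, hodgeStar (f j) :=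
    fun f => map_sum starL f _
  simp only [h1, h2, Finset.smul_sum]
  rw [Finset.sum_comm, ← Finset.sum_neg_distrib]
  exact Finset.sum_congr rfl fun j _ => codiff_symbol j _

lemma pderiv_apply {w : E3 → Form} {x : E3} (hw : DifferentiableAt ℝ w x) (j : Fin 3)
    (S : Finset (Fin 3)) : pderiv j w x S = pderiv j (fun y => w y S) x := by
  unfold pderiv; rw [fderiv_apply hw]; rfl

lemma integrable_mul_cpt {U : Set E3} (hU : IsOpen U) {f φ : E3 → ℂ} (hf : LocallyIntegrableOn f U)
    (hφ : Continuous φ) (hc : HasCompactSupport φ) (hs : tsupport φ ⊆ U) :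
    IntegrableOn (fun x => f x * φ x) U := by
  have h1 : IntegrableOn f (tsupport φ) := hf.integrableOn_compact_subset hs hc
  have h2 := h1.mul_continuousOn hφ.continuousOn hc
  refine h2.of_forall_sdiff_eq_zero hU.measurableSet ?_
  intro x hx
  simp [image_eq_zero_of_notMem_tsupport hx.2]

lemma integrable_ip_cpt {U : Set E3} (hU : IsOpen U) {u w : E3 → Form}
    (hu : LocallyIntegrableOn u U)
    (hw : Continuous w) (hc : HasCompactSupport w) (hs : tsupport w ⊆ U) :
    IntegrableOn (fun x => ip (u x) (w x)) U := by
  unfold ip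
  refine integrable_finsetSum _ fun S _ => ?_
  refine integrable_mul_cpt hU (φ := fun x => w x S) ?_ (by fun_prop) ?_ ?_
  · exact (ContinuousLinearMap.proj (R := ℂ) (φ := fun _ : Finset (Fin 3) => ℂ) S).locallyIntegrableOn_comp hu
  · exact hc.comp_left (g := fun v : Form => v S) rfl
  · exact (tsupport_comp_subset (g := fun v : Form => v S) rfl w).trans hs

lemma IsTest.differentiable {U : Set E3} {w : E3 → Form} (h : IsTest 1 U w) : Differentiable ℝ w :=
  h.contDiff.differentiable (by simp)

lemma pderiv_test {F : Type*} [NormedAddCommGroup F] [NormedSpace ℝ F] {w : E3 → F}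
    (hw : ContDiff ℝ 1 w) (hc : HasCompactSupport w) (j : Fin 3) :
    Continuous (pderiv j w) ∧ HasCompactSupport (pderiv j w) ∧ tsupport (pderiv j w) ⊆ tsupport w := by
  refine ⟨?_, hc.fderiv_apply ℝ _, tsupport_fderiv_apply_subset ℝ _⟩
  exact (hw.continuous_fderiv (by simp)).clm_apply continuous_const

lemma IsTest.extD_prop {U : Set E3} {w : E3 → Form} (h : IsTest 1 U w) :
    Continuous (extD w) ∧ HasCompactSupport (extD w) ∧ tsupport (extD w) ⊆ U := by
  have hp := fun j => pderiv_test h.contDiff h.hasCompactSupport j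
  have hsub : Function.support (extD w) ⊆ tsupport w := by
    intro x hx
    by_contra hx'
    refine hx ?_
    unfold extD
    refine Finset.sum_eq_zero fun j _ => ?_
    rw [image_eq_zero_of_notMem_tsupport (fun h' => hx' ((hp j).2.2 h'))]
    exact (wedgeL j).map_zero
  have hts : tsupport (extD w) ⊆ tsupport w := closure_minimal hsub isClosed_closure
  refine ⟨?_, h.hasCompactSupport.of_isClosed_subset isClosed_closure hts, hts.trans h.tsupport_subset⟩
  exact continuous_finsetSum _ fun j _ => (wedgeL j).continuous.comp (hp j).1

lemma IsTest.codiff_prop {U : Set E3} {w : E3 → Form} (h : IsTest 1 U w) :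
    Continuous (codiff w) ∧ HasCompactSupport (codiff w) ∧ tsupport (codiff w) ⊆ U := by
  have hp := fun j => pderiv_test h.contDiff h.hasCompactSupport j
  have he : codiff w = fun x => - ∑ j, cont j (pderiv j w x) :=
    funext fun x => codiff_eq h.differentiable.differentiableAt
  have hsub : Function.support (codiff w) ⊆ tsupport w := by
    intro x hx
    by_contra hx'
    refine hx ?_
    rw [he]
    simp only [neg_eq_zero]
    refine Finset.sum_eq_zero fun j _ => ?_
    rw [image_eq_zero_of_notMem_tsupport (fun h' => hx' ((hp j).2.2 h'))]
    exact (contL j).map_zero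
  have hts : tsupport (codiff w) ⊆ tsupport w := closure_minimal hsub isClosed_closure
  refine ⟨?_, h.hasCompactSupport.of_isClosed_subset isClosed_closure hts, hts.trans h.tsupport_subset⟩
  rw [he]
  exact (continuous_finsetSum _ fun j _ => (contL j).continuous.comp (hp j).1).neg

lemma ip_add_left (a b c : Form) : ip (a + b) c = ip a c + ip b c := by
  simp [ip, add_mul, Finset.sum_add_distrib]
lemma ip_smul_left (k : ℂ) (a c : Form) : ip (k • a) c = k * ip a c := by
  simp [ip, Finset.mul_sum, mul_assoc]
lemma ip_comm (a b : Form) : ip a b = ip b a := by simp [ip, mul_comm]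
lemma ip_sum_left {ι : Type*} (s : Finset ι) (f : ι → Form) (c : Form) :
    ip (∑ i ∈ s, f i) c = ∑ i ∈ s, ip (f i) c := by
  classical
  induction s using Finset.induction_on with
  | empty => simp [ip]
  | insert a s ha ih => rw [Finset.sum_insert ha, Finset.sum_insert ha, ip_add_left, ih]

lemma IsWeakD.add {U : Set E3} (hU : IsOpen U) {u v u' v' : E3 → Form} (h : IsWeakD U u v)
    (h' : IsWeakD U u' v') : IsWeakD U (u + u') (v + v') := by
  refine ⟨h.locInt.add h'.locInt, h.locInt'.add h'.locInt', fun w hw => ?_⟩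
  have hc := hw.codiff_prop
  simp only [Pi.add_apply, ip_add_left]
  rw [integral_add, integral_add, h.integral_eq w hw, h'.integral_eq w hw]
  · exact integrable_ip_cpt hU h.locInt hc.1 hc.2.1 hc.2.2
  · exact integrable_ip_cpt hU h'.locInt hc.1 hc.2.1 hc.2.2
  · exact integrable_ip_cpt hU h.locInt' hw.contDiff.continuous hw.2 hw.3
  · exact integrable_ip_cpt hU h'.locInt' hw.contDiff.continuous hw.2 hw.3

lemma IsWeakCod.add {U : Set E3} (hU : IsOpen U) {u v u' v' : E3 → Form} (h : IsWeakCod U u v)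
    (h' : IsWeakCod U u' v') : IsWeakCod U (u + u') (v + v') := by
  refine ⟨h.locInt.add h'.locInt, h.locInt'.add h'.locInt', fun w hw => ?_⟩
  have hc := hw.extD_prop
  simp only [Pi.add_apply, ip_add_left]
  rw [integral_add, integral_add, h.integral_eq w hw, h'.integral_eq w hw]
  · exact integrable_ip_cpt hU h.locInt hc.1 hc.2.1 hc.2.2
  · exact integrable_ip_cpt hU h'.locInt hc.1 hc.2.1 hc.2.2
  · exact integrable_ip_cpt hU h.locInt' hw.contDiff.continuous hw.2 hw.3
  · exact integrable_ip_cpt hU h'.locInt' hw.contDiff.continuous hw.2 hw.3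

lemma IsWeakD.smul {U : Set E3} {u v : E3 → Form} (h : IsWeakD U u v) (c : ℂ) :
    IsWeakD U (c • u) (c • v) := by
  refine ⟨h.locInt.smul c, h.locInt'.smul c, fun w hw => ?_⟩
  simp only [Pi.smul_apply, ip_smul_left, integral_const_mul, h.integral_eq w hw]

lemma IsWeakCod.smul {U : Set E3} {u v : E3 → Form} (h : IsWeakCod U u v) (c : ℂ) :
    IsWeakCod U (c • u) (c • v) := by
  refine ⟨h.locInt.smul c, h.locInt'.smul c, fun w hw => ?_⟩
  simp only [Pi.smul_apply, ip_smul_left, integral_const_mul, h.integral_eq w hw]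

lemma ae_eq_of_test {U : Set E3} (hU : IsOpen U) {v v' : E3 → Form} (hv : LocallyIntegrableOn v U)
    (hv' : LocallyIntegrableOn v' U)
    (h : ∀ w, IsTest 1 U w → ∫ x in U, ip (v x) (w x) = ∫ x in U, ip (v' x) (w x)) :
    v =ᵐ[volume.restrict U] v' := by
  have hS : ∀ S, ∀ᵐ x ∂(volume : Measure E3), x ∈ U → v x S - v' x S = 0 := by
    intro S
    let P : Form →L[ℂ] ℂ := ContinuousLinearMap.proj (R := ℂ) (φ := fun _ : Finset (Fin 3) => ℂ) S
    have l1 : LocallyIntegrableOn (fun x => v x S) U := P.locallyIntegrableOn_comp hv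
    have l2 : LocallyIntegrableOn (fun x => v' x S) U := P.locallyIntegrableOn_comp hv'
    refine hU.ae_eq_zero_of_integral_contDiff_smul_eq_zero (f := fun x => v x S - v' x S)
      (l1.sub l2) ?_
    intro g hg hgc hgs
    let φ : E3 → ℂ := fun x => (g x : ℂ)
    have hφ : ContDiff ℝ 1 φ := Complex.ofRealCLM.contDiff.comp (hg.of_le (by simp))
    have hφc : HasCompactSupport φ := hgc.comp_left (g := fun r : ℝ => (r : ℂ)) (by simp)
    have hφs : tsupport φ ⊆ U :=
      (tsupport_comp_subset (g := fun r : ℝ => (r : ℂ)) (by simp) g).trans hgs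
    let w : E3 → Form := fun x => Pi.single S (φ x)
    let Q : ℂ →L[ℝ] Form := LinearMap.toContinuousLinearMap (LinearMap.single ℝ (fun _ : Finset (Fin 3) => ℂ) S)
    have hw : IsTest 1 U w := by
      refine ⟨Q.contDiff.comp hφ, hφc.comp_left (g := Q) (map_zero _), (tsupport_comp_subset (g := Q) (map_zero _) φ).trans hφs⟩
    have hip : ∀ (v : E3 → Form) x, ip (v x) (w x) = v x S * φ x := by
      intro v x
      simp only [ip, w]
      rw [Finset.sum_eq_single S]
      · simp
      · intro b _ hb; simp [hb]
      · simp
    have := h w hw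
    simp only [hip] at this
    rw [← setIntegral_eq_integral_of_forall_compl_eq_zero (s := U)]
    · have h3 : ∀ x, g x • (v x S - v' x S) = v x S * φ x - v' x S * φ x := by
        intro x; simp only [Complex.real_smul, φ]; ring
      simp only [h3]
      rw [integral_sub, this, sub_self]
      · exact integrable_mul_cpt hU l1 hφ.continuous hφc hφs
      · exact integrable_mul_cpt hU l2 hφ.continuous hφc hφs
    · intro x hx
      rw [image_eq_zero_of_notMem_tsupport (fun h' => hx (hgs h')), zero_smul]
  rw [Filter.EventuallyEq, ae_restrict_iff' hU.measurableSet]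
  filter_upwards [ae_all_iff.2 hS] with x hx hxU
  funext S
  exact sub_eq_zero.1 (hx S hxU)

lemma IsWeakD.ae_eq {U : Set E3} (hU : IsOpen U) {u v v' : E3 → Form} (h : IsWeakD U u v)
    (h' : IsWeakD U u v') : v =ᵐ[volume.restrict U] v' :=
  ae_eq_of_test hU h.locInt' h'.locInt' fun w hw => by rw [h.integral_eq w hw, h'.integral_eq w hw]

lemma IsWeakCod.ae_eq {U : Set E3} (hU : IsOpen U) {u v v' : E3 → Form} (h : IsWeakCod U u v)
    (h' : IsWeakCod U u v') : v =ᵐ[volume.restrict U] v' :=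
  ae_eq_of_test hU h.locInt' h'.locInt' fun w hw => by rw [h.integral_eq w hw, h'.integral_eq w hw]

/-- `g` is the weak `j`-th partial derivative of `f` in `U` (auxiliary). -/
def HasWeakPartial (U : Set E3) (j : Fin 3) (f g : E3 → ℂ) : Prop :=
  ∀ φ : E3 → ℂ, ContDiff ℝ 1 φ → HasCompactSupport φ → tsupport φ ⊆ U →
    ∫ x in U, g x * φ x = - ∫ x in U, f x * pderiv j φ x

lemma ip_scalarForm (c : ℂ) (u : Form) : ip (scalarForm c) u = c * u ∅ := by
  unfold ip scalarForm
  rw [Finset.sum_eq_single ∅]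
  · simp
  · intro b _ hb; simp [hb]
  · simp

lemma IsWeakD.hasWeakPartial {U : Set E3} {f : E3 → ℂ} {g : E3 → Form}
    (h : IsWeakD U (fun x => scalarForm (f x)) g) (j : Fin 3) :
    HasWeakPartial U j f (fun x => g x {j}) := by
  intro φ hφ hφc hφs
  let Q : ℂ →L[ℝ] Form :=
    LinearMap.toContinuousLinearMap (LinearMap.single ℝ (fun _ : Finset (Fin 3) => ℂ) {j})
  let w : E3 → Form := fun x => Pi.single {j} (φ x)
  have hw : IsTest 1 U w := ⟨Q.contDiff.comp hφ, hφc.comp_left (g := Q) (map_zero _),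
    (tsupport_comp_subset (g := Q) (map_zero _) φ).trans hφs⟩
  have h1 := h.integral_eq w hw
  have hip : ∀ x, ip (g x) (w x) = g x {j} * φ x := by
    intro x
    simp only [ip, w]
    rw [Finset.sum_eq_single {j}]
    · simp
    · intro b _ hb; simp [hb]
    · simp
  have hcod : ∀ x, codiff w x ∅ = - pderiv j φ x := by
    intro x
    rw [codiff_eq hw.differentiable.differentiableAt]
    simp only [Pi.neg_apply, Finset.sum_apply, neg_inj, cont, Finset.notMem_empty, if_false]
    have : ∀ k, pderiv k w x {k} = if k = j then pderiv j φ x else 0 := by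
      intro k
      rw [pderiv_apply hw.differentiable.differentiableAt]
      split_ifs with hk
      · subst hk; simp [w]
      · have hz : (fun y => w y {k}) = fun _ => 0 := by
          funext y; simp [w, hk]
        rw [hz]; simp [pderiv]
    simp [this, shuffleSign]
  simp only [hip, ip_scalarForm, hcod, mul_neg] at h1
  rw [h1, integral_neg]

lemma weak_of_partials {U : Set E3} (hU : IsOpen U) {u : E3 → Form} {G : Fin 3 → E3 → Form}
    (hu : LocallyIntegrableOn u U) (hG : ∀ j, LocallyIntegrableOn (G j) U)
    (h : ∀ j S, HasWeakPartial U j (fun x => u x S) (fun x => G j x S)) :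
    IsWeakD U u (fun x => ∑ j, wedge (dx j) (G j x)) ∧
    IsWeakCod U u (fun x => - ∑ j, cont j (G j x)) := by
  have key : ∀ (j : Fin 3) (L : Form →L[ℂ] Form) (w : E3 → Form), IsTest 1 U w →
      IntegrableOn (fun x => ip (G j x) (L (w x))) U ∧
      IntegrableOn (fun x => ip (u x) (L (pderiv j w x))) U ∧
      ∫ x in U, ip (G j x) (L (w x)) = - ∫ x in U, ip (u x) (L (pderiv j w x)) := by
    intro j L w hw
    have hLw : IsTest 1 U (fun x => L (w x)) :=
      ⟨(L.restrictScalars ℝ).contDiff.comp hw.1, hw.2.comp_left (g := L) (map_zero _),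
        (tsupport_comp_subset (g := L) (map_zero _) w).trans hw.3⟩
    have hp := pderiv_test hLw.1 hLw.2 j
    have hps := hp.2.2.trans hLw.3
    have hfe : ∀ x, L (pderiv j w x) = pderiv j (fun x => L (w x)) x := fun x =>
      (pderiv_clm L hw.differentiable.differentiableAt j).symm
    simp only [hfe]
    refine ⟨integrable_ip_cpt hU (hG j) hLw.1.continuous hLw.2 hLw.3,
      integrable_ip_cpt hU hu hp.1 hp.2.1 hps, ?_⟩
    have e1 : ∀ S : Finset (Fin 3), HasCompactSupport (fun x => L (w x) S) := fun S =>
      hLw.2.comp_left (g := fun v : Form => v S) rfl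
    have e2 : ∀ S : Finset (Fin 3), tsupport (fun x => L (w x) S) ⊆ U := fun S =>
      (tsupport_comp_subset (g := fun v : Form => v S) rfl (fun x => L (w x))).trans hLw.3
    have e3 : ∀ S : Finset (Fin 3), ContDiff ℝ 1 (fun x => L (w x) S) := fun S =>
      contDiff_pi.1 hLw.1 S
    have pc : ∀ {v : E3 → Form} (_ : LocallyIntegrableOn v U) (S : Finset (Fin 3)),
        LocallyIntegrableOn (fun x => v x S) U := fun hv S =>
      (ContinuousLinearMap.proj (R := ℂ) (φ := fun _ : Finset (Fin 3) => ℂ) S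
        ).locallyIntegrableOn_comp hv
    simp only [ip]
    rw [integral_finsetSum, integral_finsetSum, ← Finset.sum_neg_distrib]
    · refine Finset.sum_congr rfl fun S _ => ?_
      rw [h j S _ (e3 S) (e1 S) (e2 S)]
      simp only [pderiv_apply hLw.differentiable.differentiableAt]
    · intro S _
      simp only [pderiv_apply hLw.differentiable.differentiableAt]
      have := pderiv_test (e3 S) (e1 S) j
      exact integrable_mul_cpt hU (pc hu S) this.1 this.2.1 (this.2.2.trans (e2 S))
    · intro S _
      exact integrable_mul_cpt hU (pc (hG j) S) (e3 S).continuous (e1 S) (e2 S)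
  have li : ∀ L : Fin 3 → (Form →L[ℂ] Form),
      LocallyIntegrableOn (fun x => ∑ j, L j (G j x)) U := by
    intro L
    have h1 : ∀ j, LocallyIntegrableOn (fun x => L j (G j x)) U := fun j =>
      (L j).locallyIntegrableOn_comp (hG j)
    simp only [Fin.sum_univ_three]
    exact ((h1 0).add (h1 1)).add (h1 2)
  constructor
  · refine ⟨hu, li wedgeL, fun w hw => ?_⟩
    have k := fun j => key j (contL j) w hw
    have e : ∀ x, ip (∑ j, wedge (dx j) (G j x)) (w x) = ∑ j, ip (G j x) (contL j (w x)) := by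
      intro x; rw [ip_sum_left]; exact Finset.sum_congr rfl fun j _ => ip_wedge_dx _ _ _
    have e' : ∀ x, ip (u x) (codiff w x) = - ∑ j, ip (u x) (contL j (pderiv j w x)) := by
      intro x
      rw [codiff_eq hw.differentiable.differentiableAt, ip_comm, ← neg_one_smul ℂ, ip_smul_left,
        ip_sum_left, neg_one_mul]
      congr 1; exact Finset.sum_congr rfl fun j _ => ip_comm _ _
    simp only [e, e']
    rw [integral_finsetSum _ fun j _ => (k j).1, integral_neg,
      integral_finsetSum _ fun j _ => (k j).2.1, ← Finset.sum_neg_distrib]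
    exact Finset.sum_congr rfl fun j _ => (k j).2.2
  · refine ⟨hu, (li contL).neg, fun w hw => ?_⟩
    have k := fun j => key j (wedgeL j) w hw
    have e : ∀ x, ip (- ∑ j, cont j (G j x)) (w x) = - ∑ j, ip (G j x) (wedgeL j (w x)) := by
      intro x
      rw [← neg_one_smul ℂ, ip_smul_left, ip_sum_left, neg_one_mul]
      congr 1
      refine Finset.sum_congr rfl fun j _ => ?_
      rw [ip_comm, ← ip_wedge_dx, ip_comm]; rfl
    have e' : ∀ x, ip (u x) (extD w x) = ∑ j, ip (u x) (wedgeL j (pderiv j w x)) := by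
      intro x
      rw [extD, ip_comm, ip_sum_left]
      exact Finset.sum_congr rfl fun j _ => ip_comm _ _
    simp only [e, e']
    rw [integral_neg, integral_finsetSum _ fun j _ => (k j).1,
      integral_finsetSum _ fun j _ => (k j).2.1, ← Finset.sum_neg_distrib]
    refine Finset.sum_congr rfl fun j _ => ?_
    rw [(k j).2.2, neg_neg]

lemma hasWeakPartial_of_contDiff {U : Set E3} (j : Fin 3) {f : E3 → ℂ}
    (hf : ContDiff ℝ 1 f) (hc : HasCompactSupport f) : HasWeakPartial U j f (pderiv j f) := by
  intro φ hφ hφc hφs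
  have z : ∀ x, x ∉ U → φ x = 0 := fun x hx =>
    image_eq_zero_of_notMem_tsupport fun h => hx (hφs h)
  have pf := pderiv_test hf hc j
  have pφ := pderiv_test hφ hφc j
  have z' : ∀ x, x ∉ U → pderiv j φ x = 0 := fun x hx =>
    image_eq_zero_of_notMem_tsupport fun h => hx (hφs (pφ.2.2 h))
  rw [setIntegral_eq_integral_of_forall_compl_eq_zero (fun x hx => by rw [z x hx, mul_zero]),
    setIntegral_eq_integral_of_forall_compl_eq_zero (fun x hx => by rw [z' x hx, mul_zero])]
  have := integral_mul_fderiv_eq_neg_fderiv_mul_of_integrable (μ := (volume : Measure E3))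
    (f := f) (g := φ) (v := EuclideanSpace.single j 1) ?_ ?_ ?_ ?_ ?_
  · unfold pderiv; rw [this, neg_neg]
  · exact (pf.1.mul hφ.continuous).integrable_of_hasCompactSupport hφc.mul_left
  · exact (hf.continuous.mul pφ.1).integrable_of_hasCompactSupport hc.mul_right
  · exact (hf.continuous.mul hφ.continuous).integrable_of_hasCompactSupport hc.mul_right
  · exact fun x _ => (hf.differentiable (by simp)).differentiableAt
  · exact fun x _ => (hφ.differentiable (by simp)).differentiableAt

/-- `u` is an `l`-form. -/
def IsHom (l : ℕ) (u : E3 → Form) : Prop := ∀ x S, S.card ≠ l → u x S = 0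

/-- `u ∈ L²(U)`. -/
def MemL2 (U : Set E3) (u : E3 → Form) : Prop := MemLp u 2 (volume.restrict U)

/-- `u ∈ H^d(U; Λˡ)`. -/
def MemHd (U : Set E3) (l : ℕ) (u : E3 → Form) : Prop :=
  IsHom l u ∧ MemL2 U u ∧ ∃ v, IsWeakD U u v ∧ MemL2 U v

/-- `u ∈ H^δ(U; Λˡ)`. -/
def MemHcod (U : Set E3) (l : ℕ) (u : E3 → Form) : Prop :=
  IsHom l u ∧ MemL2 U u ∧ ∃ v, IsWeakCod U u v ∧ MemL2 U v

/-- The component function `u_S`, as a `0`-form. -/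
def comp (u : E3 → Form) (S : Finset (Fin 3)) : E3 → Form := fun x => scalarForm (u x S)

/-- `u ∈ H¹(U)`: `u ∈ L²` and `d u_S ∈ L²` for all component functions `u_S`. -/
def MemH1 (U : Set E3) (u : E3 → Form) : Prop :=
  MemL2 U u ∧ ∀ S, ∃ g, IsWeakD U (comp u S) g ∧ MemL2 U g

lemma comp_add (u v : E3 → Form) (S : Finset (Fin 3)) : comp (u + v) S = comp u S + comp v S := by
  funext x; simp [comp, scalarForm, Pi.single_add]

lemma comp_smul (c : ℂ) (u : E3 → Form) (S : Finset (Fin 3)) : comp (c • u) S = c • comp u S := by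
  funext x; exact Pi.single_smul (f := fun _ => ℂ) ∅ c (u x S)

lemma isWeakD_zero (U : Set E3) : IsWeakD U 0 0 :=
  ⟨locallyIntegrable_zero.locallyIntegrableOn _, locallyIntegrable_zero.locallyIntegrableOn _,
    fun w _ => by simp [ip]⟩

lemma MemH1.add {U : Set E3} (hU : IsOpen U) {u v : E3 → Form} (hu : MemH1 U u)
    (hv : MemH1 U v) : MemH1 U (u + v) := by
  refine ⟨MemLp.add hu.1 hv.1, fun S => ?_⟩
  obtain ⟨g, hg, hg'⟩ := hu.2 S
  obtain ⟨k, hk, hk'⟩ := hv.2 S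
  exact ⟨g + k, by rw [comp_add]; exact hg.add hU hk, MemLp.add hg' hk'⟩

lemma MemH1.smul {U : Set E3} (c : ℂ) {u : E3 → Form} (hu : MemH1 U u) : MemH1 U (c • u) := by
  refine ⟨MemLp.const_smul hu.1 c, fun S => ?_⟩
  obtain ⟨g, hg, hg'⟩ := hu.2 S
  exact ⟨c • g, by rw [comp_smul]; exact hg.smul c, MemLp.const_smul hg' c⟩

/-- The space `H¹(U; Λˡ)` (of representatives). -/
def H1 (U : TopologicalSpace.Opens E3) (l : ℕ) : Submodule ℂ (E3 → Form) where
  carrier := {u | IsHom l u ∧ MemH1 U u}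
  add_mem' := fun {a b} ha hb =>
    ⟨fun x S hS => by simp [ha.1 x S hS, hb.1 x S hS], ha.2.add U.isOpen hb.2⟩
  zero_mem' := ⟨fun _ _ _ => rfl, MemLp.zero, fun S =>
    ⟨0, by
      have : comp 0 S = 0 := by funext x; simp [comp, scalarForm]
      rw [this]; exact isWeakD_zero _, MemLp.zero⟩⟩
  smul_mem' := fun c {a} ha => ⟨fun x S hS => by simp [ha.1 x S hS], ha.2.smul c⟩

/-- `|a|² = ⟨a, ā⟩`. -/
def normSq (a : Form) : ℝ := ∑ S, ‖a S‖ ^ 2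

/-- The square of the `H¹(U)` norm. -/
def h1NormSq (U : Set E3) (u : E3 → Form) : ℝ :=
  (∫ x in U, normSq (u x)) + ∑ S, ∫ x in U, normSq (weakD U (comp u S) x)

lemma MemL2.locInt {U : Set E3} {u : E3 → Form} (h : MemL2 U u) : LocallyIntegrableOn u U :=
  locallyIntegrableOn_of_locallyIntegrable_restrict (MemLp.locallyIntegrable h (by norm_num))

lemma normSq_nonneg (a : Form) : 0 ≤ normSq a := Finset.sum_nonneg fun _ _ => by positivity

lemma normSq_smul (c : ℂ) (a : Form) : normSq (c • a) = ‖c‖ ^ 2 * normSq a := by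
  simp [normSq, Finset.mul_sum, mul_pow]

lemma normSq_add_le (a b : Form) : normSq (a + b) ≤ 2 * normSq a + 2 * normSq b := by
  unfold normSq
  rw [Finset.mul_sum, Finset.mul_sum, ← Finset.sum_add_distrib]
  refine Finset.sum_le_sum fun S _ => ?_
  have := norm_add_le (a S) (b S)
  have h0 := norm_nonneg (a S + b S)
  simp only [Pi.add_apply]
  nlinarith [sq_nonneg (‖a S‖ - ‖b S‖)]

lemma norm_ip_le (a b : Form) {t : ℝ} (ht : 0 < t) :
    ‖ip a b‖ ≤ t * normSq a + t⁻¹ * normSq b := by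
  unfold ip normSq
  rw [Finset.mul_sum, Finset.mul_sum, ← Finset.sum_add_distrib]
  refine (norm_sum_le _ _).trans (Finset.sum_le_sum fun S _ => ?_)
  rw [norm_mul]
  have h1 : t * t⁻¹ = 1 := mul_inv_cancel₀ ht.ne'
  have h2 : 0 < t⁻¹ := inv_pos.2 ht
  have h3 : 0 ≤ t⁻¹ * (t * ‖a S‖ - ‖b S‖) ^ 2 := by positivity
  have h4 : t⁻¹ * (t * ‖a S‖ - ‖b S‖) ^ 2 =
      (t * t⁻¹) * t * ‖a S‖ ^ 2 - 2 * (t * t⁻¹) * (‖a S‖ * ‖b S‖) + t⁻¹ * ‖b S‖ ^ 2 := by ring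
  rw [h4, h1] at h3
  have h5 : 0 ≤ ‖a S‖ * ‖b S‖ := by positivity
  linarith

lemma MemL2.eval {U : Set E3} {u : E3 → Form} (h : MemL2 U u) (S : Finset (Fin 3)) :
    MemLp (fun x => u x S) 2 (volume.restrict U) := memLp_pi_iff.1 h S

lemma MemL2.integrable_normSq {U : Set E3} {u : E3 → Form} (h : MemL2 U u) :
    IntegrableOn (fun x => normSq (u x)) U :=
  integrable_finsetSum _ fun S _ =>
    (memLp_two_iff_integrable_sq_norm (h.eval S).1).1 (h.eval S)

lemma MemL2.integrable_ip {U : Set E3} {u v : E3 → Form} (h : MemL2 U u) (h' : MemL2 U v) :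
    IntegrableOn (fun x => ip (u x) (v x)) U :=
  integrable_finsetSum _ fun S _ => (h.eval S).integrable_mul (h'.eval S)

/-- `gradComp U u j` has the weak partial derivatives `∂_j u_S` as its components. -/
def gradComp (U : Set E3) (u : E3 → Form) (j : Fin 3) : E3 → Form :=
  fun x S => weakD U (comp u S) x {j}

lemma MemH1.spec {U : Set E3} {u : E3 → Form} (hU : IsOpen U) (hu : MemH1 U u)
    (S : Finset (Fin 3)) :
    IsWeakD U (comp u S) (weakD U (comp u S)) ∧ MemL2 U (weakD U (comp u S)) := by
  obtain ⟨g, hg, hg'⟩ := hu.2 S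
  have := weakD_spec ⟨g, hg⟩
  exact ⟨this, (memLp_congr_ae (hg.ae_eq hU this)).1 hg'⟩

lemma MemH1.weak {U : Set E3} {u : E3 → Form} (hU : IsOpen U) (hu : MemH1 U u) :
    (∀ j, MemL2 U (gradComp U u j)) ∧
    IsWeakD U u (fun x => ∑ j, wedge (dx j) (gradComp U u j x)) ∧
    IsWeakCod U u (fun x => - ∑ j, cont j (gradComp U u j x)) := by
  have h1 : ∀ j, MemL2 U (gradComp U u j) := fun j =>
    memLp_pi_iff.2 fun S => (hu.spec hU S).2.eval {j}
  refine ⟨h1, weak_of_partials hU hu.1.locInt (fun j => (h1 j).locInt) fun j S => ?_⟩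
  exact (hu.spec hU S).1.hasWeakPartial j

lemma IsTest.memH1 {U : Set E3} (hU : IsOpen U) {φ : E3 → Form} (h : IsTest 1 U φ) :
    MemH1 U φ ∧ IsWeakD U φ (extD φ) ∧ IsWeakCod U φ (codiff φ) := by
  have L2 : ∀ {w : E3 → Form}, Continuous w → HasCompactSupport w → MemL2 U w := fun hw hc =>
    (hw.memLp_of_hasCompactSupport hc).restrict U
  have hp := fun j => pderiv_test h.1 h.2 j
  have h0 := L2 h.1.continuous h.2
  have hw := weak_of_partials (U := U) (u := φ) (G := fun j => pderiv j φ) hU h0.locInt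
    (fun j => (L2 (hp j).1 (hp j).2.1).locInt) (fun j S => by
      simp only [pderiv_apply h.differentiable.differentiableAt]
      exact hasWeakPartial_of_contDiff j (contDiff_pi.1 h.1 S)
        (h.2.comp_left (g := fun v : Form => v S) rfl))
  refine ⟨⟨h0, fun S => ?_⟩, hw.1, ?_⟩
  · let Q : Form →L[ℂ] Form := LinearMap.toContinuousLinearMap
      ((LinearMap.single ℂ (fun _ : Finset (Fin 3) => ℂ) ∅).comp (LinearMap.proj S))
    have hQ : comp φ S = fun x => Q (φ x) := rfl
    have ht : IsTest 1 U (comp φ S) := by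
      rw [hQ]
      exact ⟨(Q.restrictScalars ℝ).contDiff.comp h.1, h.2.comp_left (g := Q) (map_zero _),
        (tsupport_comp_subset (g := Q) (map_zero _) φ).trans h.3⟩
    have hp' := fun j => pderiv_test ht.1 ht.2 j
    have hw' := weak_of_partials (U := U) (u := comp φ S) (G := fun j => pderiv j (comp φ S)) hU
      (L2 ht.1.continuous ht.2).locInt
      (fun j => (L2 (hp' j).1 (hp' j).2.1).locInt) (fun j T => by
        simp only [pderiv_apply ht.differentiable.differentiableAt]
        exact hasWeakPartial_of_contDiff j (contDiff_pi.1 ht.1 T)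
          (ht.2.comp_left (g := fun v : Form => v T) rfl))
    exact ⟨_, hw'.1, L2 ht.extD_prop.1 ht.extD_prop.2.1⟩
  · have : codiff φ = fun x => - ∑ j, cont j (pderiv j φ x) :=
      funext fun x => codiff_eq h.differentiable.differentiableAt
    rw [this]; exact hw.2

lemma h1NormSq_smul {U : Set E3} (hU : IsOpen U) {u : E3 → Form} (hu : MemH1 U u) (c : ℂ) :
    h1NormSq U (c • u) = ‖c‖ ^ 2 * h1NormSq U u := by
  unfold h1NormSq
  rw [mul_add, Finset.mul_sum]
  congr 1
  · simp only [Pi.smul_apply, normSq_smul, integral_const_mul]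
  · refine Finset.sum_congr rfl fun S _ => ?_
    rw [← integral_const_mul]
    refine integral_congr_ae ?_
    have h1 := ((hu.spec hU S).1.smul c).ae_eq hU
      (by rw [← comp_smul]; exact ((hu.smul c).spec hU S).1)
    filter_upwards [h1] with x hx
    rw [← hx, Pi.smul_apply, normSq_smul]

lemma h1NormSq_add_le {U : Set E3} (hU : IsOpen U) {u v : E3 → Form} (hu : MemH1 U u)
    (hv : MemH1 U v) : h1NormSq U (u + v) ≤ 2 * h1NormSq U u + 2 * h1NormSq U v := by
  have gen : ∀ {a b c : E3 → Form}, MemL2 U a → MemL2 U b → c =ᵐ[volume.restrict U] a + b →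
      ∫ x in U, normSq (c x) ≤ 2 * (∫ x in U, normSq (a x)) + 2 * ∫ x in U, normSq (b x) := by
    intro a b c ha hb hc
    rw [← integral_const_mul, ← integral_const_mul, ← integral_add
      (ha.integrable_normSq.const_mul 2) (hb.integrable_normSq.const_mul 2)]
    refine integral_mono_of_nonneg (Filter.Eventually.of_forall fun x => normSq_nonneg _)
      ((ha.integrable_normSq.const_mul 2).add (hb.integrable_normSq.const_mul 2)) ?_
    filter_upwards [hc] with x hx
    rw [hx]; exact normSq_add_le _ _
  unfold h1NormSq
  have h1 := gen hu.1 hv.1 (Filter.EventuallyEq.refl _ (u + v))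
  have h2 : ∑ S, ∫ x in U, normSq (weakD U (comp (u + v) S) x) ≤
      ∑ S, (2 * (∫ x in U, normSq (weakD U (comp u S) x)) +
        2 * ∫ x in U, normSq (weakD U (comp v S) x)) := by
    refine Finset.sum_le_sum fun S _ => gen (hu.spec hU S).2 (hv.spec hU S).2 ?_
    refine ((hu.add hU hv).spec hU S).1.ae_eq hU ?_
    rw [comp_add]; exact (hu.spec hU S).1.add hU (hv.spec hU S).1
  rw [Finset.sum_add_distrib, ← Finset.mul_sum, ← Finset.mul_sum] at h2
  linarith

lemma IsTest.of_top {U : Set E3} {φ : E3 → Form} (h : IsTest ((⊤ : ℕ∞) : WithTop ℕ∞) U φ) :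
    IsTest 1 U φ := ⟨h.1.of_le (by simp), h.2, h.3⟩

lemma IsTest.add {U : Set E3} {k : WithTop ℕ∞} {φ ψ : E3 → Form} (h : IsTest k U φ)
    (h' : IsTest k U ψ) : IsTest k U (φ + ψ) :=
  ⟨h.1.add h'.1, h.2.add h'.2, (tsupport_add φ ψ).trans (Set.union_subset h.3 h'.3)⟩

lemma IsTest.smul {U : Set E3} {k : WithTop ℕ∞} {φ : E3 → Form} (h : IsTest k U φ) (c : ℂ) :
    IsTest k U (c • φ) :=
  ⟨contDiff_const.smul h.1, h.2.comp_left (g := fun v : Form => c • v) (smul_zero c),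
    (tsupport_comp_subset (g := fun v : Form => c • v) (smul_zero c) φ).trans h.3⟩

lemma MemH1.sub {U : Set E3} (hU : IsOpen U) {u v : E3 → Form} (hu : MemH1 U u)
    (hv : MemH1 U v) : MemH1 U (u - v) := by
  have := hu.add hU (hv.smul (-1)); rwa [neg_one_smul, ← sub_eq_add_neg] at this

/-- `H¹₀(U; Λˡ)`: the closure in `H¹(U; Λˡ)` of the smooth forms with compact support in `U`.
It contains every form that vanishes almost everywhere in `U`. -/
def H10 (U : TopologicalSpace.Opens E3) (l : ℕ) : Submodule ℂ (H1 U l) where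
  carrier := {u | ∀ ε > 0, ∃ φ : E3 → Form,
    IsTest ((⊤ : ℕ∞) : WithTop ℕ∞) U φ ∧ IsHom l φ ∧ h1NormSq U ((u : E3 → Form) - φ) < ε}
  add_mem' := by
    intro a b ha hb ε hε
    obtain ⟨φ, hφ, hφl, hφε⟩ := ha (ε / 4) (by positivity)
    obtain ⟨ψ, hψ, hψl, hψε⟩ := hb (ε / 4) (by positivity)
    refine ⟨φ + ψ, hφ.add hψ, fun x S hS => by simp [hφl x S hS, hψl x S hS], ?_⟩
    have := h1NormSq_add_le U.isOpen (a.2.2.sub U.isOpen (hφ.of_top.memH1 U.isOpen).1)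
      (b.2.2.sub U.isOpen (hψ.of_top.memH1 U.isOpen).1)
    have e : (((a + b : H1 U l) : E3 → Form) - (φ + ψ)) = ((a : E3 → Form) - φ) + (b - ψ) := by
      rw [Submodule.coe_add]; abel
    rw [e]; linarith
  zero_mem' := by
    intro ε hε
    refine ⟨0, ⟨contDiff_const, HasCompactSupport.zero, by simp [tsupport]⟩, fun _ _ _ => rfl, ?_⟩
    have := h1NormSq_smul U.isOpen (H1 U l).zero_mem.2 0
    simp only [smul_zero, norm_zero, ne_eq, OfNat.ofNat_ne_zero, not_false_eq_true, zero_pow,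
      zero_mul] at this
    simpa [this] using hε
  smul_mem' := by
    intro c a ha ε hε
    obtain ⟨φ, hφ, hφl, hφε⟩ := ha (ε / (‖c‖ ^ 2 + 1)) (by positivity)
    refine ⟨c • φ, hφ.smul c, fun x S hS => by simp [hφl x S hS], ?_⟩
    have e : (((c • a : H1 U l) : E3 → Form) - c • φ) = c • ((a : E3 → Form) - φ) := by
      rw [Submodule.coe_smul, smul_sub]
    refine (congrArg (h1NormSq (U : Set E3)) e).trans_lt ?_
    rw [h1NormSq_smul U.isOpen (a.2.2.sub U.isOpen (hφ.of_top.memH1 U.isOpen).1)]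
    rw [lt_div_iff₀ (by positivity)] at hφε
    have h0 : 0 ≤ h1NormSq U ((a : E3 → Form) - φ) :=
      add_nonneg (integral_nonneg fun _ => normSq_nonneg _)
        (Finset.sum_nonneg fun _ _ => integral_nonneg fun _ => normSq_nonneg _)
    nlinarith

/-- The trace space `TH¹(∂U; Λˡ) = H¹(U; Λˡ) / H¹₀(U; Λˡ)`. -/
abbrev TH1 (U : TopologicalSpace.Opens E3) (l : ℕ) : Type := H1 U l ⧸ H10 U l

lemma normSq_eval_le (a : Form) (S : Finset (Fin 3)) : ‖a S‖ ^ 2 ≤ normSq a :=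
  Finset.single_le_sum (f := fun S => ‖a S‖ ^ 2) (fun _ _ => by positivity) (Finset.mem_univ S)

lemma normSq_symbol_le (L : Form →L[ℂ] Form) :
    ∃ C : ℝ, 0 ≤ C ∧ ∀ a, normSq (L a) ≤ C * normSq a := by
  refine ⟨8 * (‖L‖ ^ 2), by positivity, fun a => ?_⟩
  have h1 : ‖a‖ ^ 2 ≤ normSq a := by
    have h := (pi_norm_le_iff_of_nonneg (x := a) (Real.sqrt_nonneg (normSq a))).2 fun S => by
      rw [← Real.sqrt_sq (norm_nonneg (a S))]
      exact Real.sqrt_le_sqrt (normSq_eval_le a S)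
    calc ‖a‖ ^ 2 ≤ (Real.sqrt (normSq a)) ^ 2 := by gcongr
      _ = _ := Real.sq_sqrt (normSq_nonneg a)
  have h2 : normSq (L a) ≤ ∑ _S : Finset (Fin 3), ‖L a‖ ^ 2 :=
    Finset.sum_le_sum fun S _ => by gcongr; exact norm_le_pi_norm _ S
  have h3 : ∑ _S : Finset (Fin 3), ‖L a‖ ^ 2 = 8 * ‖L a‖ ^ 2 := by
    simp
  have h4 : ‖L a‖ ^ 2 ≤ (‖L‖ * ‖a‖) ^ 2 := by gcongr; exact L.le_opNorm a
  calc normSq (L a) ≤ 8 * ‖L a‖ ^ 2 := h2.trans_eq h3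
    _ ≤ 8 * (‖L‖ * ‖a‖) ^ 2 := by gcongr
    _ = 8 * ‖L‖ ^ 2 * ‖a‖ ^ 2 := by ring
    _ ≤ _ := by gcongr

/-- A first order operator in terms of component gradients is bounded on `H¹`. -/
lemma integral_op_le {U : Set E3} {u : E3 → Form} (hU : IsOpen U) (hu : MemH1 U u)
    {C : ℝ} (hC : 0 ≤ C) {L : Fin 3 → (Form →L[ℂ] Form)}
    (hL : ∀ j a, normSq (L j a) ≤ C * normSq a) {z : E3 → Form}
    (hz : z =ᵐ[volume.restrict U] fun x => ∑ j, L j (gradComp U u j x)) :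
    ∫ x in U, normSq (z x) ≤ 24 * C * ∑ S, ∫ x in U, normSq (weakD U (comp u S) x) := by
  rw [← integral_finsetSum _ fun S _ => (hu.spec hU S).2.integrable_normSq, ← integral_const_mul]
  refine integral_mono_of_nonneg (Filter.Eventually.of_forall fun x => normSq_nonneg _)
    ((integrable_finsetSum _ fun S _ => (hu.spec hU S).2.integrable_normSq).const_mul _) ?_
  filter_upwards [hz] with x hx
  rw [hx]
  set P := ∑ S, normSq (weakD U (comp u S) x) with hP
  have hg : ∀ j, normSq (gradComp U u j x) ≤ P := fun j =>
    Finset.sum_le_sum fun S _ => normSq_eval_le (weakD U (comp u S) x) {j}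
  have hg' : ∀ j, normSq (L j (gradComp U u j x)) ≤ C * P := fun j =>
    (hL j _).trans (mul_le_mul_of_nonneg_left (hg j) hC)
  have hP0 : 0 ≤ C * P := (normSq_nonneg _).trans (hg' 0)
  rw [Fin.sum_univ_three]
  have a1 := normSq_add_le (L 0 (gradComp U u 0 x) + L 1 (gradComp U u 1 x))
    (L 2 (gradComp U u 2 x))
  have a2 := normSq_add_le (L 0 (gradComp U u 0 x)) (L 1 (gradComp U u 1 x))
  have b0 := hg' 0
  have b1 := hg' 1
  have b2 := hg' 2
  linarith

/-- The functional `u ↦ ∫ ⟨a, u⟩ - ∫ ⟨b, op u⟩` descends to `H¹ / H¹₀`. -/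
def descend (U : TopologicalSpace.Opens E3) (l : ℕ) (op : (E3 → Form) → E3 → Form)
    (L : Fin 3 → (Form →L[ℂ] Form))
    (hop : ∀ u, MemH1 U u → op u =ᵐ[volume.restrict (U : Set E3)]
      fun x => ∑ j, L j (gradComp U u j x))
    {a b : E3 → Form} (ha : MemL2 U a) (hb : MemL2 U b)
    (h0 : ∀ φ, IsTest 1 (U : Set E3) φ →
      ∫ x in (U : Set E3), ip (a x) (φ x) = ∫ x in (U : Set E3), ip (b x) (op φ x)) :
    TH1 U l →ₗ[ℂ] ℂ :=
  have hL2 : ∀ u, MemH1 U u → MemL2 U (op u) := fun u hu =>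
    (memLp_congr_ae (hop u hu)).2 <| memLp_finsetSum _ fun j _ =>
      (L j).comp_memLp' ((hu.weak U.isOpen).1 j)
  have hgadd : ∀ u v, MemH1 U u → MemH1 U v → ∀ j, gradComp U (u + v) j
      =ᵐ[volume.restrict (U : Set E3)] gradComp U u j + gradComp U v j := by
    intro u v hu hv j
    have : ∀ S, weakD U (comp (u + v) S) =ᵐ[volume.restrict (U : Set E3)]
        weakD U (comp u S) + weakD U (comp v S) := fun S =>
      ((hu.add U.isOpen hv).spec U.isOpen S).1.ae_eq U.isOpen <| by
        rw [comp_add]; exact (hu.spec U.isOpen S).1.add U.isOpen (hv.spec U.isOpen S).1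
    filter_upwards [ae_all_iff.2 this] with x hx
    funext S
    simp only [gradComp, hx S, Pi.add_apply]
  have hgsmul : ∀ (c : ℂ) u, MemH1 U u → ∀ j, gradComp U (c • u) j
      =ᵐ[volume.restrict (U : Set E3)] c • gradComp U u j := by
    intro c u hu j
    have : ∀ S, weakD U (comp (c • u) S) =ᵐ[volume.restrict (U : Set E3)]
        c • weakD U (comp u S) := fun S =>
      ((hu.smul c).spec U.isOpen S).1.ae_eq U.isOpen <| by
        rw [comp_smul]; exact (hu.spec U.isOpen S).1.smul c
    filter_upwards [ae_all_iff.2 this] with x hx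
    funext S
    simp only [gradComp, hx S, Pi.smul_apply]
  have hadd : ∀ u v, MemH1 U u → MemH1 U v →
      op (u + v) =ᵐ[volume.restrict (U : Set E3)] op u + op v := by
    intro u v hu hv
    filter_upwards [hop u hu, hop v hv, hop _ (hu.add U.isOpen hv),
      ae_all_iff.2 (hgadd u v hu hv)] with x h1 h2 h3 h4
    simp only [Pi.add_apply, h1, h2, h3, h4, map_add, Finset.sum_add_distrib]
  have hsmul : ∀ (c : ℂ) u, MemH1 U u →
      op (c • u) =ᵐ[volume.restrict (U : Set E3)] c • op u := by
    intro c u hu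
    filter_upwards [hop u hu, hop _ (hu.smul c), ae_all_iff.2 (hgsmul c u hu)] with x h1 h3 h4
    simp only [Pi.smul_apply, h1, h3, h4, map_smul, Finset.smul_sum]
  have ipar : ∀ (k p q : Form), ip k (p + q) = ip k p + ip k q := fun k p q => by
    rw [ip_comm, ip_add_left, ip_comm p, ip_comm q]
  have ipsr : ∀ (c : ℂ) (k p : Form), ip k (c • p) = c * ip k p := fun c k p => by
    rw [ip_comm, ip_smul_left, ip_comm p]
  let T : H1 U l →ₗ[ℂ] ℂ :=
    { toFun := fun u => (∫ x in (U : Set E3), ip (a x) ((u : E3 → Form) x)) -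
        ∫ x in (U : Set E3), ip (b x) (op u x)
      map_add' := by
        intro u v
        have e : ∫ x in (U : Set E3), ip (b x) (op ((u + v : H1 U l) : E3 → Form) x) =
            ∫ x in (U : Set E3), (ip (b x) (op u x) + ip (b x) (op v x)) := by
          refine integral_congr_ae ?_
          filter_upwards [hadd u v u.2.2 v.2.2] with x hx
          rw [Submodule.coe_add, hx, Pi.add_apply, ipar]
        rw [e, integral_add (hb.integrable_ip (hL2 u u.2.2)) (hb.integrable_ip (hL2 v v.2.2))]
        simp only [Submodule.coe_add, Pi.add_apply, ipar]
        rw [integral_add (ha.integrable_ip u.2.2.1) (ha.integrable_ip v.2.2.1)]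
        ring
      map_smul' := by
        intro c u
        have e : ∫ x in (U : Set E3), ip (b x) (op ((c • u : H1 U l) : E3 → Form) x) =
            ∫ x in (U : Set E3), c * ip (b x) (op u x) := by
          refine integral_congr_ae ?_
          filter_upwards [hsmul c u u.2.2] with x hx
          rw [Submodule.coe_smul, hx, Pi.smul_apply, ipsr]
        rw [e]
        simp only [Submodule.coe_smul, Pi.smul_apply, ipsr, integral_const_mul, RingHom.id_apply,
          smul_eq_mul]
        ring }
  (H10 U l).liftQ T <| by
    intro u hu
    rw [LinearMap.mem_ker]
    choose C hC0 hC using fun j => normSq_symbol_le (L j)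
    set D := C 0 + C 1 + C 2 with hD
    have hD0 : 0 ≤ D := by have := hC0 0; have := hC0 1; have := hC0 2; linarith
    have hDL : ∀ j p, normSq (L j p) ≤ D * normSq p := by
      intro j p
      refine (hC j p).trans (mul_le_mul_of_nonneg_right ?_ (normSq_nonneg p))
      have := hC0 0; have := hC0 1; have := hC0 2
      fin_cases j <;> simp [hD] <;> linarith
    set K := (∫ x in (U : Set E3), normSq (a x)) + ∫ x in (U : Set E3), normSq (b x) with hK
    have bound : ∀ t : ℝ, 0 < t → ‖T u‖ ≤ t * (K + (1 + 24 * D)) := by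
      intro t ht
      obtain ⟨φ, hφ, hφl, hφε⟩ := hu (t ^ 2) (by positivity)
      have hφ1 := (hφ.of_top.memH1 U.isOpen).1
      let ψ : H1 U l := ⟨φ, hφl, hφ1⟩
      have hTψ : T ψ = 0 := sub_eq_zero.2 (h0 φ hφ.of_top)
      have hTe : T u = T (u - ψ) := by rw [map_sub, hTψ, sub_zero]
      rw [hTe]
      set z : E3 → Form := (u : E3 → Form) - φ with hz
      have hz1 : MemH1 U z := u.2.2.sub U.isOpen hφ1
      have est : ∀ {p q : E3 → Form}, MemL2 U p → MemL2 U q →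
          ‖∫ x in (U : Set E3), ip (p x) (q x)‖ ≤
          t * (∫ x in (U : Set E3), normSq (p x)) + t⁻¹ * ∫ x in (U : Set E3), normSq (q x) := by
        intro p q hp hq
        rw [← integral_const_mul, ← integral_const_mul, ← integral_add
          (hp.integrable_normSq.const_mul _) (hq.integrable_normSq.const_mul _)]
        exact norm_integral_le_of_norm_le
          ((hp.integrable_normSq.const_mul _).add (hq.integrable_normSq.const_mul _))
          (Filter.Eventually.of_forall fun x => norm_ip_le _ _ ht)
      have e1 := est ha hz1.1
      have e2 := est hb (hL2 z hz1)
      have e3 := integral_op_le U.isOpen hz1 hD0 hDL (hop z hz1)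
      have e4 : ‖T (u - ψ)‖ ≤ ‖∫ x in (U : Set E3), ip (a x) (z x)‖ +
          ‖∫ x in (U : Set E3), ip (b x) (op z x)‖ := norm_sub_le _ _
      set A := ∫ x in (U : Set E3), normSq (z x) with hA
      set B := ∑ S, ∫ x in (U : Set E3), normSq (weakD U (comp z S) x) with hB
      have hA0 : 0 ≤ A := integral_nonneg fun _ => normSq_nonneg _
      have hB0 : 0 ≤ B := Finset.sum_nonneg fun _ _ => integral_nonneg fun _ => normSq_nonneg _
      have hAB : A + B < t ^ 2 := hφε
      have hti : 0 < t⁻¹ := inv_pos.2 ht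
      have f1 : A + (∫ x in (U : Set E3), normSq (op z x)) ≤ t ^ 2 * (1 + 24 * D) := by
        have : A + 24 * D * B ≤ (A + B) * (1 + 24 * D) := by
          nlinarith [mul_nonneg hA0 hD0]
        have h5 : (A + B) * (1 + 24 * D) ≤ t ^ 2 * (1 + 24 * D) := by gcongr
        linarith
      have f2 := mul_le_mul_of_nonneg_left f1 hti.le
      have f3 : t⁻¹ * (t ^ 2 * (1 + 24 * D)) = t * (1 + 24 * D) := by field_simp
      rw [f3] at f2
      calc ‖T (u - ψ)‖ ≤ _ := e4
        _ ≤ _ := add_le_add e1 e2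
        _ = t * K + t⁻¹ * (A + ∫ x in (U : Set E3), normSq (op z x)) := by rw [hK]; ring
        _ ≤ t * K + t * (1 + 24 * D) := by gcongr
        _ = _ := by ring
    have hK0 : 0 ≤ K := add_nonneg (integral_nonneg fun _ => normSq_nonneg _)
      (integral_nonneg fun _ => normSq_nonneg _)
    by_contra hne
    have hpos : 0 < ‖T u‖ := norm_pos_iff.2 hne
    have hM : 0 < K + (1 + 24 * D) := by linarith
    have := bound (‖T u‖ / (2 * (K + (1 + 24 * D)))) (by positivity)
    have e : ‖T u‖ / (2 * (K + (1 + 24 * D))) * (K + (1 + 24 * D)) = ‖T u‖ / 2 := by field_simp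
    rw [e] at this
    linarith

lemma MemHd.spec {U : Set E3} (hU : IsOpen U) {l : ℕ} {v : E3 → Form} (h : MemHd U l v) :
    IsWeakD U v (weakD U v) ∧ MemL2 U (weakD U v) := by
  obtain ⟨g, hg, hg'⟩ := h.2.2
  have := weakD_spec ⟨g, hg⟩
  exact ⟨this, (memLp_congr_ae (hg.ae_eq hU this)).1 hg'⟩

lemma MemHcod.spec {U : Set E3} (hU : IsOpen U) {l : ℕ} {v : E3 → Form} (h : MemHcod U l v) :
    IsWeakCod U v (weakCod U v) ∧ MemL2 U (weakCod U v) := by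
  obtain ⟨g, hg, hg'⟩ := h.2.2
  have := weakCod_spec ⟨g, hg⟩
  exact ⟨this, (memLp_congr_ae (hg.ae_eq hU this)).1 hg'⟩

lemma MemH1.weakD_ae {U : Set E3} (hU : IsOpen U) {u : E3 → Form} (hu : MemH1 U u) :
    weakD U u =ᵐ[volume.restrict U] fun x => ∑ j, wedgeL j (gradComp U u j x) :=
  (weakD_spec ⟨_, (hu.weak hU).2.1⟩).ae_eq hU (hu.weak hU).2.1

lemma MemH1.weakCod_ae {U : Set E3} (hU : IsOpen U) {u : E3 → Form} (hu : MemH1 U u) :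
    weakCod U u =ᵐ[volume.restrict U] fun x => ∑ j, (- contL j) (gradComp U u j x) := by
  refine ((weakCod_spec ⟨_, (hu.weak hU).2.2⟩).ae_eq hU (hu.weak hU).2.2).trans ?_
  refine Filter.Eventually.of_forall fun x => ?_
  simp only [neg_apply, Finset.sum_neg_distrib]
  rfl

/-- The trace `d tr v` of `v ∈ H^d(U; Λˡ)`, a linear functional on `TH¹(∂U; Λ^(l+1))`:
`⟨d tr v, [u]⟩ = ∫_U ⟨dv, u⟩ - ∫_U ⟨v, δu⟩`, as `dTrace_mk` says. -/
def dTrace (U : TopologicalSpace.Opens E3) {l : ℕ} {v : E3 → Form} (hv : MemHd U l v) :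
    TH1 U (l + 1) →ₗ[ℂ] ℂ :=
  descend U (l + 1) (weakCod U) (fun j => - contL j) (fun _ hu => hu.weakCod_ae U.isOpen)
    (a := weakD U v) (b := v) (hv.spec U.isOpen).2 hv.2.1 <| by
      intro φ hφ
      rw [(hv.spec U.isOpen).1.integral_eq φ hφ]
      have h := (hφ.memH1 U.isOpen).2.2
      refine integral_congr_ae ?_
      filter_upwards [h.ae_eq U.isOpen (weakCod_spec ⟨_, h⟩)] with x hx
      rw [hx]

lemma dTrace_mk (U : TopologicalSpace.Opens E3) {l : ℕ} {v : E3 → Form} (hv : MemHd U l v)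
    (u : H1 U (l + 1)) : dTrace U hv (Submodule.Quotient.mk u) =
      (∫ x in (U : Set E3), ip (weakD U v x) ((u : E3 → Form) x)) -
        ∫ x in (U : Set E3), ip (v x) (weakCod U u x) := rfl

/-- The trace `δ tr v` of `v ∈ H^δ(U; Λ^(l+1))`, a linear functional on `TH¹(∂U; Λˡ)`:
`⟨δ tr v, [u]⟩ = (-1)^(l+1) (∫_U ⟨δv, u⟩ - ∫_U ⟨v, du⟩)`, as `codTrace_mk` says. -/
def codTrace (U : TopologicalSpace.Opens E3) {l : ℕ} {v : E3 → Form} (hv : MemHcod U (l + 1) v) :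
    TH1 U l →ₗ[ℂ] ℂ :=
  ((-1 : ℂ) ^ (l + 1)) • descend U l (weakD U) wedgeL (fun _ hu => hu.weakD_ae U.isOpen)
    (a := weakCod U v) (b := v) (hv.spec U.isOpen).2 hv.2.1 (by
      intro φ hφ
      rw [(hv.spec U.isOpen).1.integral_eq φ hφ]
      have h := (hφ.memH1 U.isOpen).2.1
      refine integral_congr_ae ?_
      filter_upwards [h.ae_eq U.isOpen (weakD_spec ⟨_, h⟩)] with x hx
      exact congrArg _ hx)

lemma codTrace_mk (U : TopologicalSpace.Opens E3) {l : ℕ} {v : E3 → Form}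
    (hv : MemHcod U (l + 1) v) (u : H1 U l) : codTrace U hv (Submodule.Quotient.mk u) =
      (-1 : ℂ) ^ (l + 1) * ((∫ x in (U : Set E3), ip (weakCod U v x) ((u : E3 → Form) x)) -
        ∫ x in (U : Set E3), ip (v x) (weakD U u x)) := rfl

/-- The Cauchy data set `C(μ, ε, σ; ω)`: the pairs `(f¹, f²) = (δ tr u², d tr u¹)` of boundary forms
of the solutions `u¹ + u² ∈ H^d(Ω; Λ¹) ⊕ H^δ(Ω; Λ²)` of
`δu² + iωε u¹ - du¹ + iωμ u² = σ u¹` almost everywhere in `Ω`. -/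
def CauchyData (Ω : TopologicalSpace.Opens E3) (μ ε σ : E3 → ℝ) (ω : ℝ) :
    Set ((TH1 Ω 1 →ₗ[ℂ] ℂ) × (TH1 Ω 2 →ₗ[ℂ] ℂ)) :=
  {f | ∃ (u₁ u₂ : E3 → Form) (h₁ : MemHd Ω 1 u₁) (h₂ : MemHcod Ω 2 u₂),
    (∀ᵐ x ∂(volume.restrict (Ω : Set E3)),
      weakCod Ω u₂ x + (Complex.I * ω * ε x) • u₁ x - weakD Ω u₁ x + (Complex.I * ω * μ x) • u₂ x =
        (σ x : ℂ) • u₁ x) ∧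
    codTrace Ω h₂ = f.1 ∧ dTrace Ω h₁ = f.2}

/-- `u` is square integrable on bounded sets. -/
def MemL2Loc (u : E3 → Form) : Prop :=
  ∀ U : Set E3, IsOpen U → Bornology.IsBounded U → MemL2 U u

/-- `u ∈ H¹_loc(ℝ³)`: `u` and the weak derivatives `d u_S` of its component functions are square
integrable on bounded sets. -/
def MemH1Loc (u : E3 → Form) : Prop :=
  MemL2Loc u ∧ ∀ S, ∃ g, IsWeakD Set.univ (comp u S) g ∧ MemL2Loc g

/-- The classical derivative `df`, a one-form, of a function `f`. -/
def dScalar (f : E3 → ℂ) : E3 → Form := extD (fun y => scalarForm (f y))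

/-- The function `½ log f` (principal branch). -/
def halfLog (f : E3 → ℂ) : E3 → ℂ := fun x => Complex.log (f x) / 2

/-- The function `γ^{1/2} μ^{1/2}` (principal branches). -/
def rootProd (γ μ : E3 → ℂ) : E3 → ℂ := fun x => γ x ^ (1 / 2 : ℂ) * μ x ^ (1 / 2 : ℂ)

/-- The operator `P(d + δ; γ, μ, ω)ᵗ`: with `a = ½ log γ` and `b = ½ log μ`, it maps `w` to
`(d + δ) ∑ₗ (-1)^(l+1) wˡ + db ∧ w¹ + db ∨ (w¹ + w³) + da ∧ (w⁰ + w²) - da ∨ w² + iω γ^{1/2} μ^{1/2} w`. -/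
def Pt (γ μ : E3 → ℂ) (ω : ℝ) (w : E3 → Form) : E3 → Form := fun x =>
  let w' : E3 → Form := fun y => ∑ l ∈ Finset.range 4, ((-1 : ℂ) ^ (l + 1)) • deg l (w y)
  let da := dScalar (halfLog γ) x
  let db := dScalar (halfLog μ) x
  weakD Set.univ w' x + weakCod Set.univ w' x
    + wedge db (deg 1 (w x)) + vee db (deg 1 (w x) + deg 3 (w x))
    + wedge da (deg 0 (w x) + deg 2 (w x)) - vee da (deg 2 (w x))
    + (Complex.I * ω * rootProd γ μ x) • w x

/-- The symmetric product `u ⊙ v = ½ (u ⊗ v + v ⊗ u)` of the one-form parts of `u` and `v`, as the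
symmetric matrix `A` of its coefficients in `∑ A i j dx^i ⊗ dx^j = ∑ A i j dx^i ⊙ dx^j`. -/
def symProd (u v : Form) : Fin 3 → Fin 3 → ℂ :=
  fun i j => (u {i} * v {j} + u {j} * v {i}) / 2

/-- The inner product of symmetric two-tensors: the bilinear extension of
`⟨dx^i ⊙ dx^j, dx^k ⊙ dx^m⟩ = δ_ik δ_jm + δ_im δ_jk`. -/
def symIp (A B : Fin 3 → Fin 3 → ℂ) : ℂ :=
  ∑ i, ∑ j, ∑ k, ∑ m, A i j * B k m *
    ((if i = k ∧ j = m then 1 else 0) + (if i = m ∧ j = k then 1 else 0))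

/-- The symmetric derivative `Dw = ∑ dw_j ⊙ dx^j` of (the one-form part of) `w`. -/
def symD (w : E3 → Form) (x : E3) : Fin 3 → Fin 3 → ℂ :=
  fun i j => (pderiv i w x {j} + pderiv j w x {i}) / 2

/-- The one-form `v` is the formal adjoint symmetric derivative `D* A` of the symmetric two-tensor
field `A` in `ℝ³`.  If `A = u ⊙ v` is of class `C¹`, then
`D* A = - ∑ₖ (∑ⱼ ∂_j (u_j v_k + u_k v_j)) dx^k`. -/
structure IsWeakSymAdj (A : E3 → Fin 3 → Fin 3 → ℂ) (v : E3 → Form) : Prop where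
  isHom : IsHom 1 v
  locInt : LocallyIntegrable A
  locInt' : LocallyIntegrable v
  integral_eq : ∀ w, IsTest 1 Set.univ w → IsHom 1 w →
    ∫ x, ip (v x) (w x) = ∫ x, symIp (A x) (symD w x)

open Classical in
/-- The formal adjoint symmetric derivative `D* A` (unique up to null sets); zero if there is
none. -/
def symAdj (A : E3 → Fin 3 → Fin 3 → ℂ) : E3 → Form :=
  if h : ∃ v, IsWeakSymAdj A v then h.choose else 0

/-- The bracket `⟨Q(γ, μ, ω) w, φ⟩` of the weak potential `Q(γ, μ, ω)`, for graded forms `w`, `φ` of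
class `H¹_loc`. -/
def Qform (μ₀ ε₀ : ℝ) (γ μ : E3 → ℂ) (ω : ℝ) (w φ : E3 → Form) : ℂ :=
  let da := dScalar (halfLog γ)
  let db := dScalar (halfLog μ)
  let dk := dScalar (rootProd γ μ)
  let I₁ : ℂ := ∫ x, (ω : ℂ) ^ 2 * (γ x * μ x - ε₀ * μ₀) * ip (w x) (φ x)
  let I₂ : ℂ := ∫ x, ip ((2 * Complex.I * ω) • vee (dk x) (deg 1 (w x) + deg 3 (w x))
    + (2 * Complex.I * ω) • wedge (dk x) (deg 0 (w x) + deg 2 (w x))) (φ x)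
  let I₃ : ℂ := ∫ x, (ip (da x) (da x) * ip (deg 0 (w x) + deg 2 (w x)) (deg 0 (φ x) + deg 2 (φ x))
    + ip (db x) (db x) * ip (deg 1 (w x) + deg 3 (w x)) (deg 1 (φ x) + deg 3 (φ x)))
  let I₄ : ℂ := ∫ x,
    (ip (da x) (weakD Set.univ (fun y => scalarForm
        (ip (- deg 0 (w y) + deg 2 (w y)) (deg 0 (φ y) + deg 2 (φ y)))) x)
      + ip (db x) (weakD Set.univ (fun y => scalarForm
        (ip (deg 1 (w y) - deg 3 (w y)) (deg 1 (φ y) + deg 3 (φ y)))) x))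
  let I₅ : ℂ := ∫ x, ip (db x) (symAdj (fun y => symProd (deg 1 (w y)) (deg 1 (φ y))) x)
  let I₆ : ℂ := ∫ x, ip (da x) (symAdj (fun y =>
    symProd (hodgeStar (deg 2 (w y))) (hodgeStar (deg 2 (φ y)))) x)
  I₂ - I₁ + I₃ + I₄ + I₅ + I₆

/-- The complex coefficient `γ = ε + iσ/ω`. -/
def permittivity (ω : ℝ) (ε σ : E3 → ℝ) : E3 → ℂ := fun x => ε x + Complex.I * σ x / ω

/-- Coefficients `μ, ε, σ` of class `C¹` in `ℝ³` with `μ ≥ μ₀`, `ε ≥ ε₀`, `σ ≥ 0` such that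
`μ - μ₀` and `γ - ε₀` are supported in the ball `B = {|x| < R}`.  (They and their first derivatives
are then bounded.) -/
structure Admissible (R μ₀ ε₀ ω : ℝ) (μ ε σ : E3 → ℝ) : Prop where
  contDiff_mu : ContDiff ℝ 1 μ
  contDiff_eps : ContDiff ℝ 1 ε
  contDiff_sigma : ContDiff ℝ 1 σ
  le_mu : ∀ x, μ₀ ≤ μ x
  le_eps : ∀ x, ε₀ ≤ ε x
  sigma_nonneg : ∀ x, 0 ≤ σ x
  supp_mu : tsupport (fun x => μ x - μ₀) ⊆ Metric.ball 0 R
  supp_gamma : tsupport (fun x => permittivity ω ε σ x - ε₀) ⊆ Metric.ball 0 R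

/-- The boundary of `Ω` is locally, in suitable orthonormal coordinates, the graph of a Lipschitz
function. -/
def HasLipschitzBoundary (Ω : Set E3) : Prop :=
  ∀ x ∈ frontier Ω, ∃ (e : E3 ≃ᵢ E3) (h : EuclideanSpace ℝ (Fin 2) → ℝ) (K : NNReal) (V : Set E3),
    LipschitzWith K h ∧ IsOpen V ∧ x ∈ V ∧
      ∀ y ∈ V, y ∈ frontier Ω ↔ (e y) 2 = h !₂[(e y) 0, (e y) 1]

end GradedForms

end

open GradedForms

/-! The proof rests on a factorisation of the Schrödinger form. For w of class H¹_loc and φ of class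
H¹ vanishing outside a ball, `energy_eq` says that ∫ ⟨δw,δφ⟩ + ⟨dw,dφ⟩ − ω²ε₀μ₀⟨w,φ⟩ + ⟨Q(γ,μ)w,φ⟩ =
∫ ⟨Pᵗw, Pᵗφ⟩. Pointwise, the two integrands differ by antisymmetrised products ∂ₖf ∂ⱼg − ∂ⱼf ∂ₖg, by
the same expressions with f = a or b and g a product of components, and by a divergence coming from
k = iωγ^{1/2}μ^{1/2}. All of these integrate to zero (`ip_ptSymb`, `intZero_energy`). The
coefficients are only C¹ and the fields only H¹, so every integration by parts is first made against
smooth tests and then extended by mollification (`weak_identity_extend`).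

The factorisation has two consequences. First, v₁ = P₁ᵗw₁ satisfies ∫ ⟨v₁, P₁ᵗφ⟩ = 0 for all such φ
(`intZero_of_schroedinger`). Since v₁ has no parts of degree 0 and 3, this says that u¹ =
γ₁^{-1/2}v₁¹, u² = μ₁^{-1/2}v₁² solve du¹ = iωμ₁u², δu² = −iωγ₁u¹ in the whole space
(`weakMaxwell_of_pt`). The traces of this solution on Ω belong to C₁ = C₂, hence are also the traces
of a solution in Ω for the second coefficients. Replacing u by it inside Ω gives a global Maxwell
solution for (γ₂,μ₂), because equal traces are exactly what makes the contributions of Ω to the weak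
equations agree (`weakMaxwell_glue`, `WeakMaxwell.exists_glue`). Multiplying its two parts by
γ₂^{1/2} and μ₂^{1/2} gives a form v with ∫ ⟨v, P₂ᵗφ⟩ = 0 (`WeakMaxwell.intZero_pt`) and v = v₁
outside Ω.

Second, let χ be a cutoff equal to 1 near the closure of B. The coefficients are constant outside B,
so ⟨Qⱼw₁,v₂⟩ = ⟨Qⱼw₁,χv₂⟩ (`Qform_congr_right`). Subtracting the energy identities for j = 2 and j =
1 with φ = χv₂ cancels the part without potential, and the j = 1 right-hand side is zero. What
remains is ∫ ⟨P₂ᵗw₁, P₂ᵗ(χv₂)⟩. As P₂ᵗv₂ = 0, the second factor contains only derivatives of χ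
(`ptSymb_cutoff`) and so lives outside B, where P₂ᵗw₁ = P₁ᵗw₁ = v₁ = v. The integral therefore
equals ∫ ⟨v, P₂ᵗ(χv₂)⟩ = 0. -/

noncomputable section

namespace GradedForms

open Filter

/-! ### Square-integrable fields, locally and with bounded support -/

/-- `f` is square integrable on balls. -/
def L2Loc {F : Type*} [NormedAddCommGroup F] (f : E3 → F) : Prop :=
  ∀ r : ℝ, MemLp f 2 (volume.restrict (Metric.ball (0 : E3) r))

/-- `f` is square integrable and vanishes outside a ball. -/
structure L2c {F : Type*} [NormedAddCommGroup F] (f : E3 → F) : Prop where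
  memLp : MemLp f 2 volume
  bounded : ∃ r : ℝ, ∀ x, r ≤ ‖x‖ → f x = 0

section
variable {F : Type*} [NormedAddCommGroup F] {f g : E3 → F}

lemma L2c.l2Loc (h : L2c f) : L2Loc f := fun _ => h.memLp.restrict _

lemma L2Loc.add (hf : L2Loc f) (hg : L2Loc g) : L2Loc (fun x => f x + g x) :=
  fun r => (hf r).add (hg r)

lemma L2Loc.neg (hf : L2Loc f) : L2Loc (fun x => - f x) := fun r => (hf r).neg

lemma L2c.add (hf : L2c f) (hg : L2c g) : L2c (fun x => f x + g x) := by
  obtain ⟨r, hr⟩ := hf.bounded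
  obtain ⟨s, hs⟩ := hg.bounded
  refine ⟨hf.memLp.add hg.memLp, max r s, fun x hx => ?_⟩
  rw [hr x ((le_max_left _ _).trans hx), hs x ((le_max_right _ _).trans hx), add_zero]

lemma L2Loc.locallyIntegrable (hf : L2Loc f) : LocallyIntegrable f := by
  intro x
  refine ⟨Metric.ball 0 (‖x‖ + 1), Metric.isOpen_ball.mem_nhds (by simp), ?_⟩
  have : IsFiniteMeasure (volume.restrict (Metric.ball (0 : E3) (‖x‖ + 1))) :=
    ⟨by rw [Measure.restrict_apply_univ]; exact measure_ball_lt_top⟩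
  exact (hf _).integrable (by norm_num)

lemma l2Loc_of_continuous (hf : Continuous f) : L2Loc f := by
  intro r
  have hK : IsCompact (Metric.closedBall (0 : E3) r) := isCompact_closedBall _ _
  obtain ⟨C, hC⟩ := hK.exists_bound_of_continuousOn hf.continuousOn
  have : IsFiniteMeasure (volume.restrict (Metric.ball (0 : E3) r)) :=
    ⟨by rw [Measure.restrict_apply_univ]; exact measure_ball_lt_top⟩
  refine MemLp.of_bound hf.aestronglyMeasurable C ?_
  filter_upwards [ae_restrict_mem measurableSet_ball] with x hx
  exact hC x (Metric.ball_subset_closedBall hx)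

lemma exists_ball_of_hasCompactSupport (h : HasCompactSupport f) :
    ∃ r : ℝ, ∀ x, r ≤ ‖x‖ → f x = 0 := by
  obtain ⟨r, hr⟩ := h.isCompact.isBounded.subset_ball (0 : E3)
  refine ⟨r, fun x hx => image_eq_zero_of_notMem_tsupport fun h' => ?_⟩
  have := hr h'
  simp at this
  linarith

lemma l2c_of_continuous (hf : Continuous f) (hc : HasCompactSupport f) : L2c f :=
  ⟨hf.memLp_of_hasCompactSupport hc, exists_ball_of_hasCompactSupport hc⟩

lemma hasCompactSupport_of_ball {r : ℝ} (h : ∀ x, r ≤ ‖x‖ → f x = 0) : HasCompactSupport f := by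
  refine HasCompactSupport.of_support_subset_isCompact (isCompact_closedBall (0 : E3) r) ?_
  intro x hx
  by_contra h'
  simp at h'
  exact hx (h x h'.le)

lemma L2c.of_l2Loc {r : ℝ} (hf : L2Loc f) (h : ∀ x, r ≤ ‖x‖ → f x = 0) : L2c f := by
  refine ⟨?_, r, h⟩
  have : f = (Metric.ball (0 : E3) r).indicator f := by
    funext x
    by_cases hx : x ∈ Metric.ball (0 : E3) r
    · simp [hx]
    · simp only [hx, not_false_eq_true, Set.indicator_of_notMem]
      simp at hx
      exact h x hx
  rw [this]
  exact (memLp_indicator_iff_restrict measurableSet_ball).2 (hf r)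

variable [NormedSpace ℂ F]

lemma L2Loc.smul_continuous {c : E3 → ℂ} (hc : Continuous c) (hf : L2Loc f) :
    L2Loc (fun x => c x • f x) := by
  intro r
  have hK : IsCompact (Metric.closedBall (0 : E3) r) := isCompact_closedBall _ _
  obtain ⟨C, hC⟩ := hK.exists_bound_of_continuousOn hc.continuousOn
  refine MemLp.of_le_mul (c := C) (hf r) (hc.aestronglyMeasurable.smul (hf r).1) ?_
  filter_upwards [ae_restrict_mem measurableSet_ball] with x hx
  rw [norm_smul]
  gcongr
  exact hC x (Metric.ball_subset_closedBall hx)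

lemma L2c.smul_continuous {c : E3 → ℂ} (hc : Continuous c) (hf : L2c f) :
    L2c (fun x => c x • f x) := by
  obtain ⟨r, hr⟩ := hf.bounded
  exact .of_l2Loc (hf.l2Loc.smul_continuous hc) (r := r) fun x hx => by rw [hr x hx, smul_zero]

lemma L2Loc.smul_l2c {c : E3 → ℂ} (hc : Continuous c) (hcc : HasCompactSupport c)
    (hf : L2Loc f) : L2c (fun x => c x • f x) := by
  obtain ⟨r, hr⟩ := exists_ball_of_hasCompactSupport hcc
  exact .of_l2Loc (hf.smul_continuous hc) (r := r) fun x hx => by rw [hr x hx, zero_smul]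

lemma L2Loc.clm {G : Type*} [NormedAddCommGroup G] [NormedSpace ℂ G] (L : F →L[ℂ] G)
    (hf : L2Loc f) : L2Loc (fun x => L (f x)) := fun r => L.comp_memLp' (hf r)

lemma L2c.clm {G : Type*} [NormedAddCommGroup G] [NormedSpace ℂ G] (L : F →L[ℂ] G)
    (hf : L2c f) : L2c (fun x => L (f x)) := by
  obtain ⟨r, hr⟩ := hf.bounded
  exact ⟨L.comp_memLp' hf.memLp, r, fun x hx => by rw [hr x hx, map_zero]⟩
end

/-! ### Mollification, and extension of weak identities to H¹ tests -/

lemma L2Loc.mul_l2c {f g : E3 → ℂ} (hf : L2Loc f) (hg : L2c g) :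
    Integrable (fun x => f x * g x) := by
  obtain ⟨r, hr⟩ := hg.bounded
  have h : IntegrableOn (fun x => f x * g x) (Metric.ball 0 r) :=
    (hf r).integrable_mul (hg.memLp.restrict _)
  refine h.integrable_of_forall_notMem_eq_zero fun x hx => ?_
  simp at hx
  simp [hr x hx]

/-- Translation is strongly continuous on L², and the integral is an L² inner product with a
translate of g. -/
lemma integral_l2_pairing_continuous {f g : E3 → ℂ} (hf : MemLp f 2 volume)
    (hg : MemLp g 2 volume) : Continuous (fun y => ∫ x, f x * g (x + y)) := by
  -- The pairing is bilinear while the L² inner product is conjugate-linear in its first argument,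
  -- hence the conjugate.
  have hf' : MemLp (fun x => star (f x)) 2 volume := hf.star
  have hmp : ∀ y : E3, MeasurePreserving (fun x : E3 => x + y) volume volume :=
    fun y => measurePreserving_add_right volume y
  have hcont : Continuous (fun y : E3 => (⟨fun x : E3 => x + y, by fun_prop⟩ : C(E3, E3))) :=
    ContinuousMap.continuous_of_continuous_uncurry _ (by
      simp only [Function.uncurry_def, ContinuousMap.coe_mk]; fun_prop)
  have key : Continuous fun y : E3 => Lp.compMeasurePreserving (fun x : E3 => x + y) (hmp y)
      (hg.toLp g) :=
    Continuous.compMeasurePreservingLp (f := fun _ => hg.toLp g) continuous_const hcont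
      (fun y => hmp y) (by norm_num)
  have h2 : Continuous fun y : E3 => inner ℂ (hf'.toLp _)
      (Lp.compMeasurePreserving (fun x : E3 => x + y) (hmp y) (hg.toLp g)) :=
    continuous_const.inner key
  convert h2 using 2 with y
  rw [L2.inner_def]
  refine integral_congr_ae ?_
  filter_upwards [hf'.coeFn_toLp, Lp.coeFn_compMeasurePreserving (hg.toLp g) (hmp y),
    (hmp y).quasiMeasurePreserving.ae_eq_comp hg.coeFn_toLp] with x h1 h2 h3
  rw [h1, h2, h3]
  simp [mul_comm]

open scoped Convolution
open ContinuousLinearMap (lsmul)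

/-- By Fubini the integral is the mollification, evaluated at 0, of the function y ↦ ∫ f(x) g(x + y)
dx, which is continuous. This avoids convergence of the mollified g in L². -/
lemma integral_mul_convolution_tendsto {ρ : ℕ → ContDiffBump (0 : E3)}
    (hρ : Tendsto (fun n => (ρ n).rOut) atTop (𝓝 0)) (hρ1 : ∀ n, (ρ n).rOut ≤ 1)
    {f g : E3 → ℂ} (hf : L2Loc f) (hg : L2c g) :
    Tendsto (fun n => ∫ x, f x * ((ρ n).normed volume ⋆[lsmul ℝ ℝ, volume] g) x) atTop
      (𝓝 (∫ x, f x * g x)) := by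
  obtain ⟨r, hr⟩ := hg.bounded
  -- Mollifiers of radius at most 1 enlarge the ball carrying g by at most 1. Only this part of f
  -- matters, and it is globally in L².
  set f' : E3 → ℂ := (Metric.ball (0 : E3) (r + 1)).indicator f with hf'
  have hf'2 : MemLp f' 2 volume := (memLp_indicator_iff_restrict measurableSet_ball).2 (hf _)
  have hz : ∀ {h : E3 → ℂ}, (∀ x, r + 1 ≤ ‖x‖ → h x = 0) →
      ∀ x, f x * h x = f' x * h x := by
    intro h hh x
    by_cases hx : x ∈ Metric.ball (0 : E3) (r + 1)
    · simp [hf', hx]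
    · rw [hh x (by simpa using hx), mul_zero, mul_zero]
  have hconv : ∀ n x, r + 1 ≤ ‖x‖ → ((ρ n).normed volume ⋆[lsmul ℝ ℝ, volume] g) x = 0 := by
    intro n x hx
    rw [convolution_def]
    refine integral_eq_zero_of_ae (Eventually.of_forall fun t => ?_)
    by_cases ht : t ∈ Metric.ball (0 : E3) (ρ n).rOut
    · have : r ≤ ‖x - t‖ := by
        have h1 := norm_sub_norm_le x t
        have h2 := hρ1 n
        simp at ht
        linarith
      simp [hr _ this]
    · have : (ρ n).normed volume t = 0 := by
        rw [← Function.notMem_support, (ρ n).support_normed_eq]; exact ht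
      simp [this]
  have hswap : ∀ n, ∫ x, f' x * ((ρ n).normed volume ⋆[lsmul ℝ ℝ, volume] g) x =
      ((ρ n).normed volume ⋆[lsmul ℝ ℝ, volume] (fun y => ∫ x, f' x * g (x + y))) 0 := by
    intro n
    -- Since |f||g| ≤ |f|² + |g|², the integrand is dominated by a product of integrable functions
    -- plus an integrable convolution integrand.
    have hint : Integrable (fun p : E3 × E3 =>
        f' p.1 * (((ρ n).normed volume p.2 : ℂ) * g (p.1 - p.2))) (volume.prod volume) := by
      have i1 : Integrable (fun p : E3 × E3 => (‖f' p.1‖ ^ 2) * (ρ n).normed volume p.2)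
          (volume.prod volume) :=
        ((memLp_two_iff_integrable_sq_norm hf'2.1).1 hf'2).mul_prod (ρ n).integrable_normed
      have i2 : Integrable (fun p : E3 × E3 => (ρ n).normed volume p.2 * ‖g (p.1 - p.2)‖ ^ 2)
          (volume.prod volume) :=
        Integrable.convolution_integrand (lsmul ℝ ℝ) (ρ n).integrable_normed
          ((memLp_two_iff_integrable_sq_norm hg.memLp.1).1 hg.memLp)
      have hm : AEStronglyMeasurable (fun p : E3 × E3 =>
        f' p.1 * (((ρ n).normed volume p.2 : ℂ) * g (p.1 - p.2))) (volume.prod volume) := by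
        refine hf'2.1.comp_fst.mul (AEStronglyMeasurable.mul ?_ ?_)
        · exact (Complex.continuous_ofReal.comp
            ((ρ n).continuous_normed.comp continuous_snd)).aestronglyMeasurable
        · exact hg.memLp.1.comp_quasiMeasurePreserving
            (quasiMeasurePreserving_sub_of_right_invariant volume volume)
      refine (i1.add i2).mono' hm (Eventually.of_forall fun p => ?_)
      have h0 := (ρ n).nonneg_normed (μ := volume) p.2
      rw [norm_mul, norm_mul, Complex.norm_real, Real.norm_of_nonneg h0, Pi.add_apply]
      have h1 := norm_nonneg (f' p.1)
      have h2 := norm_nonneg (g (p.1 - p.2))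
      nlinarith [mul_nonneg h0 (sq_nonneg (‖f' p.1‖ - ‖g (p.1 - p.2)‖)),
        mul_nonneg h0 (add_nonneg (sq_nonneg ‖f' p.1‖) (sq_nonneg ‖g (p.1 - p.2)‖))]
    have e1 : ∀ x, f' x * ((ρ n).normed volume ⋆[lsmul ℝ ℝ, volume] g) x =
        ∫ y, f' x * (((ρ n).normed volume y : ℂ) * g (x - y)) := by
      intro x
      rw [convolution_def, integral_const_mul]
      simp
    simp only [e1]
    rw [integral_integral_swap hint, convolution_def]
    refine integral_congr_ae (Eventually.of_forall fun y => ?_)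
    simp only [zero_sub, ContinuousLinearMap.lsmul_apply, Complex.real_smul]
    rw [← integral_const_mul]
    refine integral_congr_ae (Eventually.of_forall fun x => ?_)
    simp only [← sub_eq_add_neg]
    ring
  have hlim := ContDiffBump.convolution_tendsto_right_of_continuous (μ := volume) hρ
    (integral_l2_pairing_continuous hf'2 hg.memLp) 0
  have hzg := hz (h := g) fun x hx => hr x (by linarith)
  simp only [hzg]
  refine (tendsto_congr fun n => ?_).2 (by simpa using hlim)
  simp only [hz (hconv n)]
  exact hswap n

/-- `F j` are the weak partial derivatives of `f ∈ L²_loc`, and are in `L²_loc`. -/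
structure HasGrad (f : E3 → ℂ) (F : Fin 3 → E3 → ℂ) : Prop where
  mem : L2Loc f
  memGrad : ∀ j, L2Loc (F j)
  weak : ∀ j, HasWeakPartial Set.univ j f (F j)

/-- `f` is an `H¹` function vanishing outside a ball. -/
structure HasGradC (f : E3 → ℂ) (F : Fin 3 → E3 → ℂ) : Prop where
  mem : L2c f
  memGrad : ∀ j, L2c (F j)
  weak : ∀ j, HasWeakPartial Set.univ j f (F j)

lemma HasGradC.hasGrad {f : E3 → ℂ} {F : Fin 3 → E3 → ℂ} (h : HasGradC f F) : HasGrad f F :=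
  ⟨h.mem.l2Loc, fun j => (h.memGrad j).l2Loc, h.weak⟩

/-- The derivative falls on ρ, and s ↦ ρ(x − s) is a test function for the weak derivative of g. The
sign from the reflection s ↦ x − s cancels the sign in the definition of the weak derivative. -/
lemma pderiv_convolution {ρ : E3 → ℝ} (hρ : ContDiff ℝ 1 ρ) (hρc : HasCompactSupport ρ)
    {g G : E3 → ℂ} (hg : LocallyIntegrable g) {j : Fin 3}
    (hw : HasWeakPartial Set.univ j g G) (x : E3) :
    pderiv j (ρ ⋆[lsmul ℝ ℝ, volume] g) x = (ρ ⋆[lsmul ℝ ℝ, volume] G) x := by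
  have h1 := (hρc.hasFDerivAt_convolution_left (lsmul ℝ ℝ) hρ hg x).fderiv
  have hce : ConvolutionExistsAt (fderiv ℝ ρ) g x
      ((lsmul ℝ ℝ : ℝ →L[ℝ] ℂ →L[ℝ] ℂ).precompL E3) volume :=
    (hρc.fderiv ℝ).convolutionExists_left _ (hρ.continuous_fderiv (by simp)) hg x
  unfold pderiv
  rw [h1, convolution_def, ContinuousLinearMap.integral_apply hce]
  simp only [ContinuousLinearMap.precompL_apply, ContinuousLinearMap.lsmul_apply,
    Complex.real_smul]
  rw [← integral_sub_left_eq_self _ volume x]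
  have h2 := hw (fun s => (ρ (x - s) : ℂ))
    (Complex.ofRealCLM.contDiff.comp (hρ.comp (contDiff_const.sub contDiff_id)))
    ((hρc.comp_homeomorph (Homeomorph.subLeft x)).comp_left
      (g := fun r : ℝ => (r : ℂ)) (by simp)) (Set.subset_univ _)
  have hd : ∀ s, pderiv j (fun s => (ρ (x - s) : ℂ)) s =
      -((fderiv ℝ ρ (x - s) (EuclideanSpace.single j 1) : ℝ) : ℂ) := by
    intro s
    have h3 : HasFDerivAt ρ (fderiv ℝ ρ (x - s)) (x - s) :=
      ((hρ.differentiable (by simp)) _).hasFDerivAt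
    have h4 := Complex.ofRealCLM.hasFDerivAt.comp s
      (h3.comp s ((hasFDerivAt_const x s).sub (hasFDerivAt_id s)))
    have h5 : (fun s => (ρ (x - s) : ℂ)) = Complex.ofRealCLM ∘ (ρ ∘ fun s => x - s) := rfl
    unfold pderiv
    rw [h5]
    refine (congrArg (fun T : E3 →L[ℝ] ℂ => T (EuclideanSpace.single j 1)) h4.fderiv).trans ?_
    simp
  simp only [hd, Measure.restrict_univ, mul_neg, integral_neg, neg_neg] at h2
  rw [convolution_eq_swap]
  simp only [ContinuousLinearMap.lsmul_apply, Complex.real_smul, sub_sub_cancel]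
  simp only [mul_comm] at h2 ⊢
  exact h2.symm

/-- A first-order weak identity that holds against smooth test functions holds against compactly
supported `H¹` functions. -/
theorem weak_identity_extend {f : E3 → ℂ} {F : Fin 3 → E3 → ℂ} (hf : L2Loc f)
    (hF : ∀ j, L2Loc (F j))
    (h : ∀ φ : E3 → ℂ, ContDiff ℝ ((⊤ : ℕ∞) : WithTop ℕ∞) φ → HasCompactSupport φ →
      ∫ x, (f x * φ x + ∑ j, F j x * pderiv j φ x) = 0)
    {g : E3 → ℂ} {G : Fin 3 → E3 → ℂ} (hg : HasGradC g G) :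
    ∫ x, (f x * g x + ∑ j, F j x * G j x) = 0 := by
  -- The outer radii 1/(n+1) tend to 0 and never exceed 1, as `integral_mul_convolution_tendsto`
  -- requires.
  let ρ : ℕ → ContDiffBump (0 : E3) := fun n =>
    ⟨1 / (2 * ((n : ℝ) + 1)), 1 / ((n : ℝ) + 1), by positivity, by
      apply one_div_lt_one_div_of_lt <;> nlinarith [Nat.cast_nonneg (α := ℝ) n]⟩
  have hρ : Tendsto (fun n => (ρ n).rOut) atTop (𝓝 0) := tendsto_one_div_add_atTop_nhds_zero_nat
  have hρ1 : ∀ n, (ρ n).rOut ≤ 1 := fun n => by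
    simp only [ρ]
    rw [div_le_one (by positivity)]
    linarith [Nat.cast_nonneg (α := ℝ) n]
  have hsplit : ∀ {u : E3 → ℂ} {U : Fin 3 → E3 → ℂ}, L2c u → (∀ j, L2c (U j)) →
      ∫ x, (f x * u x + ∑ j, F j x * U j x) =
        (∫ x, f x * u x) + ∑ j, ∫ x, F j x * U j x := by
    intro u U hu hU
    rw [integral_add (hf.mul_l2c hu) (integrable_finsetSum _ fun j _ => (hF j).mul_l2c (hU j)),
      integral_finsetSum _ fun j _ => (hF j).mul_l2c (hU j)]
  rw [hsplit hg.mem hg.memGrad]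
  have hgl := hg.mem.l2Loc.locallyIntegrable
  have lim : Tendsto (fun n => (∫ x, f x * ((ρ n).normed volume ⋆[lsmul ℝ ℝ, volume] g) x) +
      ∑ j, ∫ x, F j x * ((ρ n).normed volume ⋆[lsmul ℝ ℝ, volume] (G j)) x) atTop
      (𝓝 ((∫ x, f x * g x) + ∑ j, ∫ x, F j x * G j x)) :=
    (integral_mul_convolution_tendsto hρ hρ1 hf hg.mem).add
      (tendsto_finsetSum _ fun j _ => integral_mul_convolution_tendsto hρ hρ1 (hF j) (hg.memGrad j))
  -- The mollified g is a smooth compactly supported test function whose partial derivatives are the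
  -- mollified G j, so every member of the sequence is zero by hypothesis.
  refine tendsto_nhds_unique lim ((tendsto_congr fun n => ?_).2 tendsto_const_nhds)
  set φ := (ρ n).normed volume ⋆[lsmul ℝ ℝ, volume] g with hφ
  have hφs : ContDiff ℝ ((⊤ : ℕ∞) : WithTop ℕ∞) φ :=
    (ρ n).hasCompactSupport_normed.contDiff_convolution_left _ (ρ n).contDiff_normed hgl
  have hgc : HasCompactSupport g := by
    obtain ⟨r, hr⟩ := hg.mem.bounded
    exact hasCompactSupport_of_ball hr
  have hφc : HasCompactSupport φ := (ρ n).hasCompactSupport_normed.convolution _ hgc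
  have hd : ∀ j x, pderiv j φ x = ((ρ n).normed volume ⋆[lsmul ℝ ℝ, volume] (G j)) x := fun j x =>
    pderiv_convolution (ρ n).contDiff_normed (ρ n).hasCompactSupport_normed hgl (hg.weak j) x
  have h0 := h φ hφs hφc
  have hp := fun j => pderiv_test (hφs.of_le (by simp)) hφc j
  rw [hsplit (l2c_of_continuous hφs.continuous hφc) fun j => l2c_of_continuous (hp j).1 (hp j).2.1] at h0
  simp only [← hd]
  exact h0

/-! ### Calculus of weak derivatives -/

/-- `f` is integrable with vanishing integral. -/
def IntZero (f : E3 → ℂ) : Prop := Integrable f ∧ ∫ x, f x = 0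

lemma IntZero.add {f g : E3 → ℂ} (hf : IntZero f) (hg : IntZero g) :
    IntZero (fun x => f x + g x) :=
  ⟨hf.1.add hg.1, by rw [integral_add hf.1 hg.1, hf.2, hg.2, add_zero]⟩

lemma IntZero.sub {f g : E3 → ℂ} (hf : IntZero f) (hg : IntZero g) :
    IntZero (fun x => f x - g x) :=
  ⟨hf.1.sub hg.1, by rw [integral_sub hf.1 hg.1, hf.2, hg.2, sub_zero]⟩

lemma IntZero.const_mul {f : E3 → ℂ} (hf : IntZero f) (c : ℂ) : IntZero (fun x => c * f x) :=
  ⟨hf.1.const_mul c, by rw [integral_const_mul, hf.2, mul_zero]⟩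

lemma IntZero.sum {ι : Type*} {s : Finset ι} {f : ι → E3 → ℂ} (h : ∀ i ∈ s, IntZero (f i)) :
    IntZero (fun x => ∑ i ∈ s, f i x) :=
  ⟨integrable_finsetSum _ fun i hi => (h i hi).1, by
    rw [integral_finsetSum _ fun i hi => (h i hi).1]
    exact Finset.sum_eq_zero fun i hi => (h i hi).2⟩

lemma IntZero.congr {f g : E3 → ℂ} (hf : IntZero f) (h : ∀ᵐ x, f x = g x) : IntZero g :=
  ⟨hf.1.congr h, by rw [← integral_congr_ae h, hf.2]⟩

lemma L2Loc.mul {f g : E3 → ℂ} (hf : L2Loc f) (hg : L2Loc g) :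
    LocallyIntegrable (fun x => f x * g x) := by
  intro x
  exact ⟨Metric.ball 0 (‖x‖ + 1), Metric.isOpen_ball.mem_nhds (by simp),
    (hf _).integrable_mul (hg _)⟩

section pderiv

lemma pderiv_mul {f g : E3 → ℂ} {x : E3} (hf : DifferentiableAt ℝ f x)
    (hg : DifferentiableAt ℝ g x) (j : Fin 3) :
    pderiv j (fun y => f y * g y) x = pderiv j f x * g x + f x * pderiv j g x := by
  unfold pderiv
  rw [fderiv_fun_mul hf hg]
  simp
  ring

lemma continuous_pderiv {F : Type*} [NormedAddCommGroup F] [NormedSpace ℝ F] {f : E3 → F}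
    (hf : ContDiff ℝ 1 f) (j : Fin 3) : Continuous (pderiv j f) :=
  (hf.continuous_fderiv (by simp)).clm_apply continuous_const

lemma contDiff_pderiv {F : Type*} [NormedAddCommGroup F] [NormedSpace ℝ F] {f : E3 → F}
    (hf : ContDiff ℝ ((⊤ : ℕ∞) : WithTop ℕ∞) f) (j : Fin 3) :
    ContDiff ℝ ((⊤ : ℕ∞) : WithTop ℕ∞) (pderiv j f) :=
  (hf.fderiv_right (m := ((⊤ : ℕ∞) : WithTop ℕ∞)) le_rfl).clm_apply contDiff_const

lemma pderiv_pderiv {F : Type*} [NormedAddCommGroup F] [NormedSpace ℝ F] {f : E3 → F}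
    (hf : ContDiff ℝ ((⊤ : ℕ∞) : WithTop ℕ∞) f) (j k : Fin 3) (x : E3) :
    pderiv j (pderiv k f) x = pderiv k (pderiv j f) x := by
  have hd : DifferentiableAt ℝ (fderiv ℝ f) x :=
    ((hf.fderiv_right (m := ((⊤ : ℕ∞) : WithTop ℕ∞)) le_rfl).differentiable (by simp)) x
  have e : ∀ a b : Fin 3, pderiv a (pderiv b f) x =
      fderiv ℝ (fderiv ℝ f) x (EuclideanSpace.single a 1) (EuclideanSpace.single b 1) := by
    intro a b
    unfold pderiv
    rw [fderiv_clm_apply hd (differentiableAt_const _)]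
    simp
  rw [e, e]
  have hs : IsSymmSndFDerivAt ℝ f x :=
    hf.contDiffAt.isSymmSndFDerivAt (by
      rw [minSmoothness_of_isRCLikeNormedField]; exact WithTop.coe_le_coe.2 le_top)
  exact hs _ _

end pderiv

/-- Compact support of the test function alone makes the products integrable, so f, here a
coefficient, need not have compact support. -/
lemma hasWeakPartial_of_contDiff' (j : Fin 3) {f : E3 → ℂ} (hf : ContDiff ℝ 1 f) :
    HasWeakPartial Set.univ j f (pderiv j f) := by
  intro φ hφ hφc _
  have pφ := pderiv_test hφ hφc j
  have := integral_mul_fderiv_eq_neg_fderiv_mul_of_integrable (μ := (volume : Measure E3))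
    (f := f) (g := φ) (v := EuclideanSpace.single j 1) ?_ ?_ ?_ ?_ ?_
  · simp only [Measure.restrict_univ]
    unfold pderiv; rw [this, neg_neg]
  · exact ((continuous_pderiv hf j).mul hφ.continuous).integrable_of_hasCompactSupport
      hφc.mul_left
  · exact (hf.continuous.mul pφ.1).integrable_of_hasCompactSupport pφ.2.1.mul_left
  · exact (hf.continuous.mul hφ.continuous).integrable_of_hasCompactSupport hφc.mul_left
  · exact fun x _ => (hf.differentiable (by simp)).differentiableAt
  · exact fun x _ => (hφ.differentiable (by simp)).differentiableAt

lemma hasGrad_of_contDiff {f : E3 → ℂ} (hf : ContDiff ℝ 1 f) :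
    HasGrad f (fun j => pderiv j f) :=
  ⟨l2Loc_of_continuous hf.continuous, fun j => l2Loc_of_continuous (continuous_pderiv hf j),
    fun j => hasWeakPartial_of_contDiff' j hf⟩

lemma hasGradC_of_contDiff {f : E3 → ℂ} (hf : ContDiff ℝ 1 f) (hc : HasCompactSupport f) :
    HasGradC f (fun j => pderiv j f) :=
  ⟨l2c_of_continuous hf.continuous hc,
    fun j => l2c_of_continuous (pderiv_test hf hc j).1 (pderiv_test hf hc j).2.1,
    fun j => hasWeakPartial_of_contDiff' j hf⟩

lemma _root_.MeasureTheory.LocallyIntegrable.integrable_mul_test {f φ : E3 → ℂ} (hf : LocallyIntegrable f)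
    (hφ : Continuous φ) (hc : HasCompactSupport φ) : Integrable (fun x => f x * φ x) := by
  simpa using integrable_mul_cpt isOpen_univ (hf.locallyIntegrableOn _) hφ hc (Set.subset_univ _)

lemma HasWeakPartial.add {j : Fin 3} {f g F G : E3 → ℂ} (hf : LocallyIntegrable f)
    (hg : LocallyIntegrable g) (hF : LocallyIntegrable F) (hG : LocallyIntegrable G)
    (h : HasWeakPartial Set.univ j f F) (h' : HasWeakPartial Set.univ j g G) :
    HasWeakPartial Set.univ j (fun x => f x + g x) (fun x => F x + G x) := by
  intro φ hφ hc hs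
  have e := h φ hφ hc hs
  have e' := h' φ hφ hc hs
  have p := pderiv_test hφ hc j
  simp only [Measure.restrict_univ] at *
  simp only [add_mul]
  rw [integral_add (hF.integrable_mul_test hφ.continuous hc)
    (hG.integrable_mul_test hφ.continuous hc), integral_add (hf.integrable_mul_test p.1 p.2.1)
    (hg.integrable_mul_test p.1 p.2.1), e, e', neg_add]

lemma HasWeakPartial.const_mul {j : Fin 3} {f F : E3 → ℂ}
    (h : HasWeakPartial Set.univ j f F) (c : ℂ) :
    HasWeakPartial Set.univ j (fun x => c * f x) (fun x => c * F x) := by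
  intro φ hφ hc hs
  simp only [mul_assoc, integral_const_mul, h φ hφ hc hs, mul_neg]

/-- Test functions are only required to be C¹, so c φ is again one. The rule follows by testing f
with it. -/
lemma HasWeakPartial.mul_contDiff {j : Fin 3} {f F c : E3 → ℂ} (hf : LocallyIntegrable f)
    (hF : LocallyIntegrable F) (h : HasWeakPartial Set.univ j f F) (hc : ContDiff ℝ 1 c) :
    HasWeakPartial Set.univ j (fun x => c x * f x) (fun x => c x * F x + pderiv j c x * f x) := by
  intro φ hφ hφc _
  have e := h (fun x => c x * φ x) (hc.mul hφ) hφc.mul_left (Set.subset_univ _)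
  have p := pderiv_test hφ hφc j
  simp only [pderiv_mul (hc.differentiable (by simp) _) (hφ.differentiable (by simp) _),
    Measure.restrict_univ] at e ⊢
  have i1 : Integrable fun x => f x * (pderiv j c x * φ x) :=
    hf.integrable_mul_test ((continuous_pderiv hc j).mul hφ.continuous) hφc.mul_left
  have i2 : Integrable fun x => f x * (c x * pderiv j φ x) :=
    hf.integrable_mul_test (hc.continuous.mul p.1) p.2.1.mul_left
  have i3 : Integrable fun x => F x * (c x * φ x) :=
    hF.integrable_mul_test (hc.continuous.mul hφ.continuous) hφc.mul_left
  simp only [mul_add] at e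
  rw [integral_add i1 i2] at e
  have e1 : ∀ x, (c x * F x + pderiv j c x * f x) * φ x =
    F x * (c x * φ x) + f x * (pderiv j c x * φ x) := fun x => by ring
  have e2 : ∀ x, c x * f x * pderiv j φ x = f x * (c x * pderiv j φ x) := fun x => by ring
  simp only [e1, e2]
  rw [integral_add i3 i1, e]
  ring

/-- `F j` are the weak partial derivatives of the locally integrable function `f`. -/
structure HasGrad1 (f : E3 → ℂ) (F : Fin 3 → E3 → ℂ) : Prop where
  mem : LocallyIntegrable f
  memGrad : ∀ j, LocallyIntegrable (F j)
  weak : ∀ j, HasWeakPartial Set.univ j f (F j)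

lemma HasGrad.hasGrad1 {f : E3 → ℂ} {F : Fin 3 → E3 → ℂ} (h : HasGrad f F) : HasGrad1 f F :=
  ⟨h.mem.locallyIntegrable, fun j => (h.memGrad j).locallyIntegrable, h.weak⟩

section
variable {f g : E3 → ℂ} {F G : Fin 3 → E3 → ℂ}

lemma HasGrad1.add (hf : HasGrad1 f F) (hg : HasGrad1 g G) :
    HasGrad1 (fun x => f x + g x) (fun j x => F j x + G j x) :=
  ⟨hf.mem.add hg.mem, fun j => (hf.memGrad j).add (hg.memGrad j), fun j =>
    (hf.weak j).add hf.mem hg.mem (hf.memGrad j) (hg.memGrad j) (hg.weak j)⟩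

lemma HasGrad.add (hf : HasGrad f F) (hg : HasGrad g G) :
    HasGrad (fun x => f x + g x) (fun j x => F j x + G j x) :=
  ⟨hf.mem.add hg.mem, fun j => (hf.memGrad j).add (hg.memGrad j),
    (hf.hasGrad1.add hg.hasGrad1).weak⟩

lemma HasGrad.const_mul (hf : HasGrad f F) (c : ℂ) :
    HasGrad (fun x => c * f x) (fun j x => c * F j x) :=
  ⟨hf.mem.smul_continuous (c := fun _ => c) continuous_const,
    fun j => (hf.memGrad j).smul_continuous (c := fun _ => c) continuous_const,
    fun j => (hf.weak j).const_mul c⟩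

lemma HasGrad.mul_contDiff (hf : HasGrad f F) {c : E3 → ℂ} (hc : ContDiff ℝ 1 c) :
    HasGrad (fun x => c x * f x) (fun j x => c x * F j x + pderiv j c x * f x) :=
  ⟨hf.mem.smul_continuous hc.continuous, fun j =>
    ((hf.memGrad j).smul_continuous hc.continuous).add
      (hf.mem.smul_continuous (continuous_pderiv hc j)),
    fun j => (hf.weak j).mul_contDiff hf.mem.locallyIntegrable (hf.memGrad j).locallyIntegrable hc⟩

lemma HasGrad.mul_test (hf : HasGrad f F) {c : E3 → ℂ} (hc : ContDiff ℝ 1 c)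
    (hcc : HasCompactSupport c) :
    HasGradC (fun x => c x * f x) (fun j x => c x * F j x + pderiv j c x * f x) :=
  ⟨hf.mem.smul_l2c hc.continuous hcc, fun j =>
    ((hf.memGrad j).smul_l2c hc.continuous hcc).add
      (hf.mem.smul_l2c (continuous_pderiv hc j) (pderiv_test hc hcc j).2.1),
    (hf.mul_contDiff hc).weak⟩

lemma HasGradC.mul_contDiff (hf : HasGradC f F) {c : E3 → ℂ} (hc : ContDiff ℝ 1 c) :
    HasGradC (fun x => c x * f x) (fun j x => c x * F j x + pderiv j c x * f x) :=
  ⟨hf.mem.smul_continuous hc.continuous, fun j =>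
    ((hf.memGrad j).smul_continuous hc.continuous).add
      (hf.mem.smul_continuous (continuous_pderiv hc j)),
    (hf.hasGrad.mul_contDiff hc).weak⟩

/-- Integration by parts. -/
lemma HasGrad.ibp (hf : HasGrad f F) (hg : HasGradC g G) (j : Fin 3) :
    IntZero (fun x => F j x * g x + f x * G j x) := by
  refine ⟨((hf.memGrad j).mul_l2c hg.mem).add (hf.mem.mul_l2c (hg.memGrad j)), ?_⟩
  -- The definition of the weak derivative is read as a first-order identity in φ whose only
  -- derivative coefficient is f, in direction j.
  have := weak_identity_extend (f := F j) (F := fun i => if i = j then f else 0) (hf.memGrad j)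
    (fun i => by
      split_ifs
      · exact hf.mem
      · exact fun r => MemLp.zero) ?_ hg
  · simpa [ite_apply, ite_mul] using this
  · intro φ hφ hc
    have h1 := hφ.of_le (m := 1) (by simp)
    have e := hf.weak j φ h1 hc (Set.subset_univ _)
    have p := pderiv_test h1 hc j
    simp only [Measure.restrict_univ] at e
    simp only [ite_apply, ite_mul, Pi.zero_apply, zero_mul, Finset.sum_ite_eq',
      Finset.mem_univ, if_true]
    rw [integral_add ((hf.memGrad j).locallyIntegrable.integrable_mul_test h1.continuous hc)
      (hf.mem.locallyIntegrable.integrable_mul_test p.1 p.2.1), e]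
    ring

/-- The product rule in `H¹_loc`. -/
lemma HasGrad.mul (hf : HasGrad f F) (hg : HasGrad g G) :
    HasGrad1 (fun x => f x * g x) (fun j x => F j x * g x + f x * G j x) := by
  refine ⟨hf.mem.mul hg.mem, fun j => ((hf.memGrad j).mul hg.mem).add (hf.mem.mul (hg.memGrad j)),
    fun j φ hφ hc _ => ?_⟩
  -- φ g is an H¹ function vanishing outside a ball. Integrating f by parts against it is the weak
  -- product rule for f g.
  have h := (hf.ibp (hg.mul_test hφ hc) j).2
  have p := pderiv_test hφ hc j
  simp only [Measure.restrict_univ]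
  have i1 : Integrable fun x => (F j x * g x + f x * G j x) * φ x :=
    (((hf.memGrad j).mul hg.mem).add (hf.mem.mul (hg.memGrad j))).integrable_mul_test
      hφ.continuous hc
  have i2 : Integrable fun x => (f x * g x) * pderiv j φ x :=
    (hf.mem.mul hg.mem).integrable_mul_test p.1 p.2.1
  have e : ∀ x, F j x * (φ x * g x) + f x * (φ x * G j x + pderiv j φ x * g x) =
    (F j x * g x + f x * G j x) * φ x + (f x * g x) * pderiv j φ x := fun x => by ring
  simp only [e] at h
  rw [integral_add i1 i2] at h
  exact eq_neg_of_add_eq_zero_left h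

lemma sum_ite_pair (a b : ℂ) (H : Fin 3 → ℂ) (j k : Fin 3) :
    ∑ i, ((if i = j then a else 0) - (if i = k then b else 0)) * H i = a * H j - b * H k := by
  simp [sub_mul, Finset.sum_sub_distrib]

lemma l2Loc_ite_pair {a b : E3 → ℂ} (ha : L2Loc a) (hb : L2Loc b) (i j k : Fin 3) :
    L2Loc (fun x => (if i = j then a x else 0) - (if i = k then b x else 0)) := by
  intro r
  refine MemLp.sub ?_ ?_
  · split_ifs
    exacts [ha r, MemLp.zero]
  · split_ifs
    exacts [hb r, MemLp.zero]

/-- The curl of a weak gradient vanishes. -/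
lemma HasGrad.curl (hf : HasGrad f F) (hg : HasGradC g G) (j k : Fin 3) :
    IntZero (fun x => F k x * G j x - F j x * G k x) := by
  refine ⟨((hf.memGrad k).mul_l2c (hg.memGrad j)).sub ((hf.memGrad j).mul_l2c (hg.memGrad k)), ?_⟩
  have := weak_identity_extend (f := fun _ => 0)
    (F := fun i x => (if i = j then F k x else 0) - (if i = k then F j x else 0))
    (fun r => MemLp.zero) (fun i => l2Loc_ite_pair (hf.memGrad k) (hf.memGrad j) i j k) ?_ hg
  · simpa [sum_ite_pair] using this
  · intro φ hφ hc
    have h1 := hφ.of_le (m := 1) (by simp)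
    have c1 := fun i => (contDiff_pderiv hφ i).of_le (m := 1) (by simp)
    have p := pderiv_test h1 hc
    -- For smooth φ the functions ∂ⱼφ and ∂ₖφ are test functions for f, and the two integrals agree
    -- because second derivatives of φ commute.
    have e := fun i i' => hf.weak i (pderiv i' φ) (c1 i') (p i').2.1 (Set.subset_univ _)
    simp only [Measure.restrict_univ] at e
    simp only [zero_mul, zero_add, sum_ite_pair]
    rw [integral_sub ((hf.memGrad k).locallyIntegrable.integrable_mul_test (p j).1 (p j).2.1)
      ((hf.memGrad j).locallyIntegrable.integrable_mul_test (p k).1 (p k).2.1), e, e]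
    simp only [pderiv_pderiv hφ k j]
    ring

/-- A gradient `∇a` is curl free against the product of two `H¹` functions. -/
lemma curl_mul {a : E3 → ℂ} (ha : ContDiff ℝ 1 a) (hf : HasGrad f F) (hg : HasGradC g G)
    (j k : Fin 3) :
    IntZero (fun x => pderiv k a x * (F j x * g x + f x * G j x)
      - pderiv j a x * (F k x * g x + f x * G k x)) := by
  have L := fun i i' => (hf.memGrad i).smul_continuous (continuous_pderiv ha i')
  have M := fun i => hf.mem.smul_continuous (continuous_pderiv ha i)
  simp only [smul_eq_mul] at L M
  have i1 := fun i i' => (L i i').mul_l2c hg.mem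
  have i2 := fun i i' => (M i).mul_l2c (hg.memGrad i')
  refine ⟨((((i1 j k).add (i2 k j)).sub ((i1 k j).add (i2 j k)))).congr
    (Eventually.of_forall fun x => ?_), ?_⟩
  · simp only [Pi.add_apply, Pi.sub_apply]; ring
  have := weak_identity_extend
    (f := fun x => pderiv k a x * F j x + -(pderiv j a x * F k x))
    (F := fun i x => (if i = j then pderiv k a x * f x else 0)
      - (if i = k then pderiv j a x * f x else 0))
    ((L j k).add (L k j).neg) (fun i => l2Loc_ite_pair (M k) (M j) i j k) ?_ hg
  · rw [← this]
    refine integral_congr_ae (Eventually.of_forall fun x => ?_)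
    simp only [sum_ite_pair]; ring
  · intro φ hφ hc
    -- With a smooth φ in place of g, the product φ f is of class H¹ and `HasGrad.curl` applies to
    -- it and a. The product f g itself only has an integrable gradient, so g is reached by
    -- extension.
    refine Eq.trans ?_ ((hasGrad_of_contDiff ha).curl (hf.mul_test (hφ.of_le (by simp)) hc) j k).2
    refine integral_congr_ae (Eventually.of_forall fun x => ?_)
    simp only [sum_ite_pair]; ring

end

/-! ### Exterior algebra in the eight components -/

lemma form_sum {M : Type*} [AddCommMonoid M] (f : Finset (Fin 3) → M) :
    ∑ S, f S = f ∅ + (f {0} + (f {1} + (f {2} + (f {0, 1} + (f {0, 2} + (f {1, 2} +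
      f {0, 1, 2})))))) := by
  rw [show (Finset.univ : Finset (Finset (Fin 3))) =
    {∅, {0}, {1}, {2}, {0, 1}, {0, 2}, {1, 2}, {0, 1, 2}} by decide]
  rw [Finset.sum_insert (by decide), Finset.sum_insert (by decide), Finset.sum_insert (by decide),
    Finset.sum_insert (by decide), Finset.sum_insert (by decide), Finset.sum_insert (by decide),
    Finset.sum_insert (by decide), Finset.sum_singleton]

lemma form_ext {u v : Form} (h0 : u ∅ = v ∅) (h1 : u {0} = v {0}) (h2 : u {1} = v {1})
    (h3 : u {2} = v {2}) (h4 : u {0, 1} = v {0, 1}) (h5 : u {0, 2} = v {0, 2})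
    (h6 : u {1, 2} = v {1, 2}) (h7 : u {0, 1, 2} = v {0, 1, 2}) : u = v := by
  have key : ∀ S : Finset (Fin 3), S = ∅ ∨ S = {0} ∨ S = {1} ∨ S = {2} ∨ S = {0, 1} ∨ S = {0, 2} ∨
    S = {1, 2} ∨ S = {0, 1, 2} := by decide
  funext S
  rcases key S with h | h | h | h | h | h | h | h <;> rw [h] <;> assumption

/-- The resulting set and the number of inversions are separate arguments, so that `decide` can
evaluate them in the tables below. With the tables, identities between forms become polynomial
identities in the components. -/
lemma wedge_dx_of_mem {j : Fin 3} {A B : Finset (Fin 3)} {n : ℕ} {u : Form} (h : j ∈ A)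
    (hB : A \ {j} = B)
    (hn : ((({j} : Finset (Fin 3)) ×ˢ B).filter (fun p => p.2 < p.1)).card = n) :
    wedge (dx j) u A = (-1) ^ n * u B := by
  rw [wedge_dx, ← hn, ← hB]
  exact if_pos h

lemma cont_of_notMem {j : Fin 3} {A B : Finset (Fin 3)} {n : ℕ} {u : Form} (h : j ∉ A)
    (hB : insert j A = B)
    (hn : ((({j} : Finset (Fin 3)) ×ˢ A).filter (fun p => p.2 < p.1)).card = n) :
    cont j u A = (-1) ^ n * u B := by
  rw [← hn, ← hB]
  exact if_neg h

lemma hodgeStar_of_compl {A B : Finset (Fin 3)} {n : ℕ} {u : Form} (hB : Aᶜ = B)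
    (hn : ((B ×ˢ A).filter (fun p => p.2 < p.1)).card = n) :
    hodgeStar u A = (-1) ^ n * u B := by
  rw [← hn, ← hB]
  rfl

lemma wedge_table_zero (u : Form) :
    wedge (dx 0) u ∅ = 0 ∧ wedge (dx 0) u {0} = u ∅ ∧
    wedge (dx 0) u {1} = 0 ∧ wedge (dx 0) u {2} = 0 ∧
    wedge (dx 0) u {0, 1} = u {1} ∧ wedge (dx 0) u {0, 2} = u {2} ∧
    wedge (dx 0) u {1, 2} = 0 ∧ wedge (dx 0) u {0, 1, 2} = u {1, 2} :=
  ⟨by rw [wedge_dx]; exact if_neg (by decide),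
    by rw [wedge_dx_of_mem (n := 0) (by decide) (by decide : _ = (∅ : Finset (Fin 3))) (by decide)]; norm_num,
    by rw [wedge_dx]; exact if_neg (by decide),
    by rw [wedge_dx]; exact if_neg (by decide),
    by rw [wedge_dx_of_mem (n := 0) (by decide) (by decide : _ = ({1} : Finset (Fin 3))) (by decide)]; norm_num,
    by rw [wedge_dx_of_mem (n := 0) (by decide) (by decide : _ = ({2} : Finset (Fin 3))) (by decide)]; norm_num,
    by rw [wedge_dx]; exact if_neg (by decide),
    by rw [wedge_dx_of_mem (n := 0) (by decide) (by decide : _ = ({1, 2} : Finset (Fin 3))) (by decide)]; norm_num⟩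

lemma wedge_table_one (u : Form) :
    wedge (dx 1) u ∅ = 0 ∧ wedge (dx 1) u {0} = 0 ∧
    wedge (dx 1) u {1} = u ∅ ∧ wedge (dx 1) u {2} = 0 ∧
    wedge (dx 1) u {0, 1} = -u {0} ∧ wedge (dx 1) u {0, 2} = 0 ∧
    wedge (dx 1) u {1, 2} = u {2} ∧ wedge (dx 1) u {0, 1, 2} = -u {0, 2} :=
  ⟨by rw [wedge_dx]; exact if_neg (by decide),
    by rw [wedge_dx]; exact if_neg (by decide),
    by rw [wedge_dx_of_mem (n := 0) (by decide) (by decide : _ = (∅ : Finset (Fin 3))) (by decide)]; norm_num,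
    by rw [wedge_dx]; exact if_neg (by decide),
    by rw [wedge_dx_of_mem (n := 1) (by decide) (by decide : _ = ({0} : Finset (Fin 3))) (by decide)]; norm_num,
    by rw [wedge_dx]; exact if_neg (by decide),
    by rw [wedge_dx_of_mem (n := 0) (by decide) (by decide : _ = ({2} : Finset (Fin 3))) (by decide)]; norm_num,
    by rw [wedge_dx_of_mem (n := 1) (by decide) (by decide : _ = ({0, 2} : Finset (Fin 3))) (by decide)]; norm_num⟩

lemma wedge_table_two (u : Form) :
    wedge (dx 2) u ∅ = 0 ∧ wedge (dx 2) u {0} = 0 ∧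
    wedge (dx 2) u {1} = 0 ∧ wedge (dx 2) u {2} = u ∅ ∧
    wedge (dx 2) u {0, 1} = 0 ∧ wedge (dx 2) u {0, 2} = -u {0} ∧
    wedge (dx 2) u {1, 2} = -u {1} ∧ wedge (dx 2) u {0, 1, 2} = u {0, 1} :=
  ⟨by rw [wedge_dx]; exact if_neg (by decide),
    by rw [wedge_dx]; exact if_neg (by decide),
    by rw [wedge_dx]; exact if_neg (by decide),
    by rw [wedge_dx_of_mem (n := 0) (by decide) (by decide : _ = (∅ : Finset (Fin 3))) (by decide)]; norm_num,
    by rw [wedge_dx]; exact if_neg (by decide),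
    by rw [wedge_dx_of_mem (n := 1) (by decide) (by decide : _ = ({0} : Finset (Fin 3))) (by decide)]; norm_num,
    by rw [wedge_dx_of_mem (n := 1) (by decide) (by decide : _ = ({1} : Finset (Fin 3))) (by decide)]; norm_num,
    by rw [wedge_dx_of_mem (n := 2) (by decide) (by decide : _ = ({0, 1} : Finset (Fin 3))) (by decide)]; norm_num⟩

lemma cont_table_zero (u : Form) :
    cont 0 u ∅ = u {0} ∧ cont 0 u {0} = 0 ∧
    cont 0 u {1} = u {0, 1} ∧ cont 0 u {2} = u {0, 2} ∧
    cont 0 u {0, 1} = 0 ∧ cont 0 u {0, 2} = 0 ∧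
    cont 0 u {1, 2} = u {0, 1, 2} ∧ cont 0 u {0, 1, 2} = 0 :=
  ⟨by rw [cont_of_notMem (n := 0) (by decide) (by decide : _ = ({0} : Finset (Fin 3))) (by decide)]; norm_num,
    if_pos (by decide),
    by rw [cont_of_notMem (n := 0) (by decide) (by decide : _ = ({0, 1} : Finset (Fin 3))) (by decide)]; norm_num,
    by rw [cont_of_notMem (n := 0) (by decide) (by decide : _ = ({0, 2} : Finset (Fin 3))) (by decide)]; norm_num,
    if_pos (by decide),
    if_pos (by decide),
    by rw [cont_of_notMem (n := 0) (by decide) (by decide : _ = ({0, 1, 2} : Finset (Fin 3))) (by decide)]; norm_num,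
    if_pos (by decide)⟩

lemma cont_table_one (u : Form) :
    cont 1 u ∅ = u {1} ∧ cont 1 u {0} = -u {0, 1} ∧
    cont 1 u {1} = 0 ∧ cont 1 u {2} = u {1, 2} ∧
    cont 1 u {0, 1} = 0 ∧ cont 1 u {0, 2} = -u {0, 1, 2} ∧
    cont 1 u {1, 2} = 0 ∧ cont 1 u {0, 1, 2} = 0 :=
  ⟨by rw [cont_of_notMem (n := 0) (by decide) (by decide : _ = ({1} : Finset (Fin 3))) (by decide)]; norm_num,
    by rw [cont_of_notMem (n := 1) (by decide) (by decide : _ = ({0, 1} : Finset (Fin 3))) (by decide)]; norm_num,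
    if_pos (by decide),
    by rw [cont_of_notMem (n := 0) (by decide) (by decide : _ = ({1, 2} : Finset (Fin 3))) (by decide)]; norm_num,
    if_pos (by decide),
    by rw [cont_of_notMem (n := 1) (by decide) (by decide : _ = ({0, 1, 2} : Finset (Fin 3))) (by decide)]; norm_num,
    if_pos (by decide),
    if_pos (by decide)⟩

lemma cont_table_two (u : Form) :
    cont 2 u ∅ = u {2} ∧ cont 2 u {0} = -u {0, 2} ∧
    cont 2 u {1} = -u {1, 2} ∧ cont 2 u {2} = 0 ∧
    cont 2 u {0, 1} = u {0, 1, 2} ∧ cont 2 u {0, 2} = 0 ∧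
    cont 2 u {1, 2} = 0 ∧ cont 2 u {0, 1, 2} = 0 :=
  ⟨by rw [cont_of_notMem (n := 0) (by decide) (by decide : _ = ({2} : Finset (Fin 3))) (by decide)]; norm_num,
    by rw [cont_of_notMem (n := 1) (by decide) (by decide : _ = ({0, 2} : Finset (Fin 3))) (by decide)]; norm_num,
    by rw [cont_of_notMem (n := 1) (by decide) (by decide : _ = ({1, 2} : Finset (Fin 3))) (by decide)]; norm_num,
    if_pos (by decide),
    by rw [cont_of_notMem (n := 2) (by decide) (by decide : _ = ({0, 1, 2} : Finset (Fin 3))) (by decide)]; norm_num,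
    if_pos (by decide),
    if_pos (by decide),
    if_pos (by decide)⟩

lemma hodgeStar_table (u : Form) :
    hodgeStar u ∅ = u {0, 1, 2} ∧ hodgeStar u {0} = u {1, 2} ∧
    hodgeStar u {1} = -u {0, 2} ∧ hodgeStar u {2} = u {0, 1} ∧
    hodgeStar u {0, 1} = u {2} ∧ hodgeStar u {0, 2} = -u {1} ∧
    hodgeStar u {1, 2} = u {0} ∧ hodgeStar u {0, 1, 2} = u ∅ :=
  ⟨by rw [hodgeStar_of_compl (n := 0) (by decide : _ = ({0, 1, 2} : Finset (Fin 3))) (by decide)]; norm_num,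
    by rw [hodgeStar_of_compl (n := 2) (by decide : _ = ({1, 2} : Finset (Fin 3))) (by decide)]; norm_num,
    by rw [hodgeStar_of_compl (n := 1) (by decide : _ = ({0, 2} : Finset (Fin 3))) (by decide)]; norm_num,
    by rw [hodgeStar_of_compl (n := 0) (by decide : _ = ({0, 1} : Finset (Fin 3))) (by decide)]; norm_num,
    by rw [hodgeStar_of_compl (n := 2) (by decide : _ = ({2} : Finset (Fin 3))) (by decide)]; norm_num,
    by rw [hodgeStar_of_compl (n := 1) (by decide : _ = ({1} : Finset (Fin 3))) (by decide)]; norm_num,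
    by rw [hodgeStar_of_compl (n := 0) (by decide : _ = ({0} : Finset (Fin 3))) (by decide)]; norm_num,
    by rw [hodgeStar_of_compl (n := 0) (by decide : _ = (∅ : Finset (Fin 3))) (by decide)]; norm_num⟩

lemma card_table : (∅ : Finset (Fin 3)).card = 0 ∧ ({0} : Finset (Fin 3)).card = 1 ∧
    ({1} : Finset (Fin 3)).card = 1 ∧ ({2} : Finset (Fin 3)).card = 1 ∧
    ({0, 1} : Finset (Fin 3)).card = 2 ∧ ({0, 2} : Finset (Fin 3)).card = 2 ∧
    ({1, 2} : Finset (Fin 3)).card = 2 ∧ ({0, 1, 2} : Finset (Fin 3)).card = 3 := by decide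

lemma wedgeL_apply (j : Fin 3) (u : Form) : wedgeL j u = wedge (dx j) u := rfl

lemma contL_apply (j : Fin 3) (u : Form) : contL j u = cont j u := rfl

/-! ### Pᵗ as a first-order operator with matrix coefficients -/

/-- `u ↦ uˡ` as a linear map. -/
def degL (l : ℕ) : Form →L[ℂ] Form := LinearMap.toContinuousLinearMap
  { toFun := deg l
    map_add' := by intro a b; funext A; simp [deg]; split_ifs <;> simp
    map_smul' := by intro c b; funext A; simp [deg] }

lemma degL_apply (l : ℕ) (u : Form) : degL l u = deg l u := rfl

/-- `u ↦ ∑ₗ (-1)^(l+1) uˡ`. -/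
def sgnL : Form →L[ℂ] Form := ∑ l ∈ Finset.range 4, ((-1 : ℂ) ^ (l + 1)) • degL l

lemma sgnL_apply (u : Form) (S : Finset (Fin 3)) : sgnL u S = (-1) ^ (S.card + 1) * u S := by
  have h : S.card < 4 := by
    have := Finset.card_le_univ S
    simp at this; omega
  simp [sgnL, degL_apply, deg, h]

/-- The symbol of `(d + δ) ∑ₗ (-1)^(l+1) wˡ`. -/
def sigma (j : Fin 3) : Form →L[ℂ] Form := (wedgeL j - contL j).comp sgnL

/-- The coefficient of `∂_j a` in `Pᵗ`. -/
def aOp (j : Fin 3) : Form →L[ℂ] Form :=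
  (wedgeL j).comp (degL 0 + degL 2) + (contL j).comp (degL 2)

/-- The coefficient of `∂_j b` in `Pᵗ`. -/
def bOp (j : Fin 3) : Form →L[ℂ] Form :=
  (wedgeL j).comp (degL 1) + (contL j).comp (degL 1 + degL 3)

/-- The value of `Pᵗ w` at a point in terms of `α = ∇a`, `β = ∇b`, `k = iω γ^{1/2} μ^{1/2}`, `w` and
its partial derivatives `G`. -/
def ptSymb (α β : Fin 3 → ℂ) (k : ℂ) (w : Form) (G : Fin 3 → Form) : Form :=
  ∑ j, (sigma j (G j) + α j • aOp j w + β j • bOp j w) + k • w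

/-- The symbol of the exterior derivative. -/
def dSymb (G : Fin 3 → Form) : Form := ∑ j, wedge (dx j) (G j)

/-- The symbol of the formal adjoint derivative. -/
def codSymb (G : Fin 3 → Form) : Form := - ∑ j, cont j (G j)

/-- The one-form with coefficients `α`. -/
def oneForm (α : Fin 3 → ℂ) : Form := ∑ j, α j • dx j

lemma oneForm_table (α : Fin 3 → ℂ) : oneForm α ∅ = 0 ∧ oneForm α {0} = α 0 ∧
    oneForm α {1} = α 1 ∧ oneForm α {2} = α 2 ∧ oneForm α {0, 1} = 0 ∧ oneForm α {0, 2} = 0 ∧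
    oneForm α {1, 2} = 0 ∧ oneForm α {0, 1, 2} = 0 := by
  have h : ∀ S, oneForm α S = ∑ j, if S = {j} then α j else 0 := by
    intro S
    simp only [oneForm, dx, Finset.sum_apply, Pi.smul_apply, smul_eq_mul, Pi.single_apply,
      mul_ite, mul_one, mul_zero]
  refine ⟨?_, ?_, ?_, ?_, ?_, ?_, ?_, ?_⟩ <;> rw [h, Fin.sum_univ_three] <;>
    simp +decide

lemma wedge_oneForm (α : Fin 3 → ℂ) (u : Form) :
    wedge (oneForm α) u = ∑ j, α j • wedge (dx j) u := by
  funext A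
  simp only [wedge, oneForm, Finset.sum_apply, Pi.smul_apply, smul_eq_mul, Finset.mul_sum,
    Finset.sum_mul]
  rw [Finset.sum_comm]
  exact Finset.sum_congr rfl fun j _ => Finset.sum_congr rfl fun S _ => by ring

lemma ip_expand (u v : Form) : ip u v = u ∅ * v ∅ + (u {0} * v {0} + (u {1} * v {1} +
    (u {2} * v {2} + (u {0, 1} * v {0, 1} + (u {0, 2} * v {0, 2} + (u {1, 2} * v {1, 2} +
    u {0, 1, 2} * v {0, 1, 2})))))) := form_sum _

lemma deg_table (l : ℕ) (u : Form) :
    deg l u ∅ = (if 0 = l then u ∅ else 0) ∧ deg l u {0} = (if 1 = l then u {0} else 0) ∧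
    deg l u {1} = (if 1 = l then u {1} else 0) ∧ deg l u {2} = (if 1 = l then u {2} else 0) ∧
    deg l u {0, 1} = (if 2 = l then u {0, 1} else 0) ∧
    deg l u {0, 2} = (if 2 = l then u {0, 2} else 0) ∧
    deg l u {1, 2} = (if 2 = l then u {1, 2} else 0) ∧
    deg l u {0, 1, 2} = (if 3 = l then u {0, 1, 2} else 0) :=
  ⟨rfl, rfl, rfl, rfl, rfl, rfl, rfl, rfl⟩

/-- Only m = 1 contributes, where the exponent (4 − l)(l − 1) is even for l = 1, 2, 3. The sign on
two-forms therefore comes from the two Hodge stars. It turns −da ∨ w² into the contraction with a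
plus sign in `aOp`. -/
lemma vee_oneForm (α : Fin 3 → ℂ) (u : Form) :
    vee (oneForm α) u = ∑ j, α j • (cont j (deg 1 u) - cont j (deg 2 u) + cont j (deg 3 u)) := by
  have h1 : deg 1 (oneForm α) = oneForm α := by
    apply form_ext <;> simp [deg_table, oneForm_table]
  have h2 : ∀ m, m ≠ 1 → deg m (oneForm α) = 0 := by
    intro m hm
    apply form_ext <;> simp [deg_table, oneForm_table, hm.symm]
  have h3 : ∀ v, hodgeStar (wedge 0 v) = 0 := by
    intro v; funext A; simp [hodgeStar, wedge]
  have e : vee (oneForm α) u = ∑ l ∈ Finset.Icc 1 3, ((-1 : ℂ) ^ ((3 + 1 - l) * (l - 1))) •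
      hodgeStar (wedge (oneForm α) (hodgeStar (deg l u))) := by
    unfold vee
    rw [Finset.sum_eq_single 1]
    · rw [h1]
    · intro m _ hm
      simp [h2 m hm, h3]
    · simp
  rw [e, show Finset.Icc 1 3 = {1, 2, 3} by decide, Finset.sum_insert (by decide),
    Finset.sum_insert (by decide), Finset.sum_singleton]
  simp only [wedge_oneForm, Fin.sum_univ_three]
  apply form_ext <;> simp [hodgeStar_table, wedge_table_zero, wedge_table_one, wedge_table_two,
    cont_table_zero, cont_table_one, cont_table_two, deg_table]
  ring

lemma sigma_table (j : Fin 3) (u : Form) (S : Finset (Fin 3)) :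
    sigma j u S = wedge (dx j) (sgnL u) S - cont j (sgnL u) S := rfl

lemma aOp_table (j : Fin 3) (u : Form) (S : Finset (Fin 3)) :
    aOp j u S = wedge (dx j) (deg 0 u + deg 2 u) S + cont j (deg 2 u) S := rfl

lemma bOp_table (j : Fin 3) (u : Form) (S : Finset (Fin 3)) :
    bOp j u S = wedge (dx j) (deg 1 u) S + cont j (deg 1 u + deg 3 u) S := rfl

/-! ### Pointwise expansion of ⟨Pᵗw, Pᵗφ⟩ -/

section symbols
variable (α β : Fin 3 → ℂ) (k : ℂ) (w φ : Form) (G H : Fin 3 → Form)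

/-- The divergence `∑ⱼ ∂_j (u_j v_k + u_k v_j)` in terms of one-forms and partial derivatives. -/
def symDiv (k : Fin 3) (u v : Form) (U V : Fin 3 → Form) : ℂ :=
  ∑ j, (U j {j} * v {k} + u {j} * V j {k} + U j {k} * v {j} + u {k} * V j {j})

/-- Difference of products of derivatives. -/
def curlPair (S T : Finset (Fin 3)) (j k : Fin 3) : ℂ := G k S * H j T - G j S * H k T

/-- Difference of products of derivatives, with coefficients. -/
def curlCoeff (c : Fin 3 → ℂ) (S T : Finset (Fin 3)) (j k : Fin 3) : ℂ :=
  c k * (G j S * φ T + w S * H j T) - c j * (G k S * φ T + w S * H k T)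

/-- The products of d with d and of δ with δ give the two main terms, the degree signs squaring to
1. In the products of d with δ, components of degrees l and l + 2 meet, and antisymmetry leaves only
differences of the type `curlPair`. -/
lemma ip_principal : ip (∑ j, sigma j (G j)) (∑ j, sigma j (H j)) =
    ip (codSymb G) (codSymb H) + ip (dSymb G) (dSymb H)
    + (curlPair G H {0} {0, 1, 2} 2 1 + curlPair G H {1} {0, 1, 2} 0 2
      + curlPair G H {2} {0, 1, 2} 1 0
      - curlPair G H ∅ {0, 1} 0 1 - curlPair G H ∅ {0, 2} 0 2 - curlPair G H ∅ {1, 2} 1 2)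
    + (curlPair G H {0, 1, 2} {0} 1 2 + curlPair G H {0, 1, 2} {1} 2 0
      + curlPair G H {0, 1, 2} {2} 0 1
      - curlPair G H {0, 1} ∅ 1 0 - curlPair G H {0, 2} ∅ 2 0 - curlPair G H {1, 2} ∅ 2 1) := by
  simp only [ip_expand, codSymb, dSymb, Fin.sum_univ_three, Pi.add_apply, Pi.neg_apply,
    sigma_table, wedge_table_zero, wedge_table_one, wedge_table_two,
    cont_table_zero, cont_table_one, cont_table_two, sgnL_apply, card_table, curlPair]
  ring

/-- Adding both orders completes every term to a derivative of a product of components. Sorted by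
the direction of α and of the derivative, these are the gradient term and the D* term of Q, plus
curl terms that pair degree 0 with degree 2. -/
lemma ip_aOp : ip (∑ j, sigma j (G j)) (∑ j, α j • aOp j φ)
    + ip (∑ j, α j • aOp j w) (∑ j, sigma j (H j)) =
    (∑ j, α j * (ip (- deg 0 (G j) + deg 2 (G j)) (deg 0 φ + deg 2 φ)
      + ip (- deg 0 w + deg 2 w) (deg 0 (H j) + deg 2 (H j))))
    - (∑ k, α k * symDiv k (hodgeStar (deg 2 w)) (hodgeStar (deg 2 φ))
        (fun j => hodgeStar (deg 2 (G j))) (fun j => hodgeStar (deg 2 (H j))))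
    + (curlCoeff w φ G H α ∅ {0, 1} 0 1 + curlCoeff w φ G H α ∅ {0, 2} 0 2
      + curlCoeff w φ G H α ∅ {1, 2} 1 2)
    + (curlCoeff w φ G H α {0, 1} ∅ 0 1 + curlCoeff w φ G H α {0, 2} ∅ 0 2
      + curlCoeff w φ G H α {1, 2} ∅ 1 2) := by
  simp [ip_expand, Fin.sum_univ_three, hodgeStar_table,
    sigma_table, aOp_table, wedge_table_zero, wedge_table_one, wedge_table_two, deg_table,
    cont_table_zero, cont_table_one, cont_table_two, sgnL_apply, curlCoeff, symDiv]
  ring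

/-- The counterpart of `ip_aOp` in odd degrees: gradient and D* terms, and curl terms that pair
degree 1 with degree 3. -/
lemma ip_bOp : ip (∑ j, sigma j (G j)) (∑ j, β j • bOp j φ)
    + ip (∑ j, β j • bOp j w) (∑ j, sigma j (H j)) =
    (∑ j, β j * (ip (deg 1 (G j) - deg 3 (G j)) (deg 1 φ + deg 3 φ)
      + ip (deg 1 w - deg 3 w) (deg 1 (H j) + deg 3 (H j))))
    - (∑ k, β k * symDiv k (deg 1 w) (deg 1 φ)
        (fun j => deg 1 (G j)) (fun j => deg 1 (H j)))
    + (curlCoeff w φ G H β {0} {0, 1, 2} 2 1 + curlCoeff w φ G H β {1} {0, 1, 2} 0 2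
      + curlCoeff w φ G H β {2} {0, 1, 2} 1 0)
    + (curlCoeff w φ G H β {0, 1, 2} {0} 2 1 + curlCoeff w φ G H β {0, 1, 2} {1} 0 2
      + curlCoeff w φ G H β {0, 1, 2} {2} 1 0) := by
  simp [ip_expand, Fin.sum_univ_three,
    sigma_table, bOp_table, wedge_table_zero, wedge_table_one, wedge_table_two, deg_table,
    cont_table_zero, cont_table_one, cont_table_two, sgnL_apply, curlCoeff, symDiv]
  ring

/-- The α-terms map even to odd degree and the β-terms odd to even, so no product of α and β
survives. Within one parity, α ∧ α = 0 and α ∧ (contraction) + contraction of (α ∧ ·) = ⟨α,α⟩. -/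
lemma ip_zeroth : ip (∑ j, (α j • aOp j w + β j • bOp j w)) (∑ j, (α j • aOp j φ + β j • bOp j φ)) =
    ip (oneForm α) (oneForm α) * ip (deg 0 w + deg 2 w) (deg 0 φ + deg 2 φ)
    + ip (oneForm β) (oneForm β) * ip (deg 1 w + deg 3 w) (deg 1 φ + deg 3 φ) := by
  simp [ip_expand, Fin.sum_univ_three, oneForm_table,
    bOp_table, aOp_table, wedge_table_zero, wedge_table_one, wedge_table_two, deg_table,
    cont_table_zero, cont_table_one, cont_table_two]
  ring

/-- Each `sigma j` is symmetric for `ip`. If ∂ⱼk = k(αⱼ + βⱼ), the last sum is therefore the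
divergence Σⱼ ∂ⱼ⟨w, σⱼ(kφ)⟩, and the first term on the right is the wave number term of Q. -/
lemma ip_wavenumber : k * ip (∑ j, sigma j (G j)) φ + k * ip w (∑ j, sigma j (H j))
    + k * ip (∑ j, (α j • aOp j w + β j • bOp j w)) φ
    + k * ip w (∑ j, (α j • aOp j φ + β j • bOp j φ)) =
    2 * k * ip (vee (oneForm (α + β)) (deg 1 w + deg 3 w)
      + wedge (oneForm (α + β)) (deg 0 w + deg 2 w)) φ
    + ∑ j, (ip (G j) (sigma j (k • φ))
      + ip w (sigma j (k • H j + (k * (α j + β j)) • φ))) := by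
  simp [ip_expand, Fin.sum_univ_three, vee_oneForm, wedge_oneForm,
    bOp_table, aOp_table, wedge_table_zero, wedge_table_one, wedge_table_two, deg_table,
    cont_table_zero, cont_table_one, cont_table_two, sigma_table, sgnL_apply]
  ring

end symbols

/-! ### Weak gradients of graded forms -/

lemma ip_add_right (a b c : Form) : ip a (b + c) = ip a b + ip a c := by
  rw [ip_comm, ip_add_left, ip_comm b, ip_comm c]

lemma ip_smul_right (k : ℂ) (a b : Form) : ip a (k • b) = k * ip a b := by
  rw [ip_comm, ip_smul_left, ip_comm]

lemma ip_sum_right {ι : Type*} (s : Finset ι) (f : ι → Form) (c : Form) :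
    ip c (∑ i ∈ s, f i) = ∑ i ∈ s, ip c (f i) := by
  rw [ip_comm, ip_sum_left]
  exact Finset.sum_congr rfl fun i _ => ip_comm _ _

lemma ip_single (u : Form) (S : Finset (Fin 3)) (c : ℂ) : ip u (Pi.single S c) = u S * c := by
  unfold ip
  rw [Finset.sum_eq_single S]
  · simp
  · intro b _ hb; simp [hb]
  · simp

/-- The transpose of a linear map with respect to the bilinear inner product. -/
def transp (L : Form →L[ℂ] Form) : Form →L[ℂ] Form := LinearMap.toContinuousLinearMap
  { toFun := fun u S => ip u (L (Pi.single S 1))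
    map_add' := by intro a b; funext S; simp [ip_add_left]
    map_smul' := by intro c a; funext S; simp [ip_smul_left] }

lemma clm_eq_sum (L : Form →L[ℂ] Form) (v : Form) : L v = ∑ S, v S • L (Pi.single S 1) := by
  have h : v = ∑ S, v S • (Pi.single S 1 : Form) := by
    funext T
    simp [Finset.sum_apply, Pi.single_apply]
  conv_lhs => rw [h]
  simp [map_sum]

lemma ip_transp (L : Form →L[ℂ] Form) (u v : Form) : ip (transp L u) v = ip u (L v) := by
  rw [clm_eq_sum L v, ip_sum_right]
  simp only [ip_smul_right]
  exact Finset.sum_congr rfl fun S _ => mul_comm _ _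

lemma l2Loc_form {w : E3 → Form} : L2Loc w ↔ ∀ S, L2Loc (fun x => w x S) :=
  ⟨fun h S r => memLp_pi_iff.1 (h r) S, fun h r => memLp_pi_iff.2 fun S => h S r⟩

lemma memL2Loc_iff {w : E3 → Form} : MemL2Loc w ↔ L2Loc w := by
  constructor
  · exact fun h r => h _ Metric.isOpen_ball Metric.isBounded_ball
  · intro h U _ hU
    obtain ⟨r, hr⟩ := hU.subset_ball (0 : E3)
    exact (h r).mono_measure (Measure.restrict_mono hr le_rfl)

/-- `G j` is the weak `j`-th partial derivative of the graded form `w ∈ H¹_loc`. -/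
def FGrad (w : E3 → Form) (G : Fin 3 → E3 → Form) : Prop :=
  ∀ S, HasGrad (fun x => w x S) (fun j x => G j x S)

/-- `G j` is the weak `j`-th partial derivative of `w ∈ H¹`, which vanishes outside a ball. -/
def FGradC (w : E3 → Form) (G : Fin 3 → E3 → Form) : Prop :=
  ∀ S, HasGradC (fun x => w x S) (fun j x => G j x S)

section
variable {w φ : E3 → Form} {G H : Fin 3 → E3 → Form}

lemma FGradC.fgrad (h : FGradC w G) : FGrad w G := fun S => (h S).hasGrad

lemma FGrad.mem (h : FGrad w G) : L2Loc w := l2Loc_form.2 fun S => (h S).mem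

lemma FGrad.memGrad (h : FGrad w G) (j : Fin 3) : L2Loc (G j) :=
  l2Loc_form.2 fun S => (h S).memGrad j

lemma HasGrad.sum {ι : Type*} (s : Finset ι) {f : ι → E3 → ℂ} {F : ι → Fin 3 → E3 → ℂ}
    (h : ∀ i, HasGrad (f i) (F i)) :
    HasGrad (fun x => ∑ i ∈ s, f i x) (fun j x => ∑ i ∈ s, F i j x) := by
  classical
  induction s using Finset.induction_on with
  | empty =>
    simp only [Finset.sum_empty]
    exact ⟨fun r => MemLp.zero, fun _ r => MemLp.zero, fun j φ _ _ _ => by simp⟩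
  | insert a s ha ih =>
    simp only [Finset.sum_insert ha]
    exact (h a).add ih

lemma FGrad.clm (h : FGrad w G) (L : Form →L[ℂ] Form) :
    FGrad (fun x => L (w x)) (fun j x => L (G j x)) := by
  intro S
  have e : ∀ v : Form, L v S = ∑ T, L (Pi.single T 1) S * v T := fun v => by
    rw [clm_eq_sum L v]
    simp [Finset.sum_apply, mul_comm]
  have := HasGrad.sum Finset.univ fun T => (h T).const_mul (L (Pi.single T 1) S)
  simpa only [← e] using this

lemma L2c.eval (h : L2c w) (S : Finset (Fin 3)) : L2c (fun x => w x S) := by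
  obtain ⟨r, hr⟩ := h.bounded
  exact ⟨memLp_pi_iff.1 h.memLp S, r, fun x hx => by rw [hr x hx]; rfl⟩

lemma l2c_form : L2c w ↔ ∀ S, L2c (fun x => w x S) := by
  refine ⟨fun h => h.eval, fun h => ⟨memLp_pi_iff.2 fun S => (h S).memLp, ?_⟩⟩
  choose r hr using fun S => (h S).bounded
  -- The sum of absolute values is a radius that serves all components at once.
  refine ⟨∑ S, |r S|, fun x hx => funext fun S => hr S x (le_trans ?_ hx)⟩
  exact (le_abs_self _).trans (Finset.single_le_sum (f := fun S => |r S|)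
    (fun _ _ => abs_nonneg _) (Finset.mem_univ S))

lemma FGradC.mem (h : FGradC w G) : L2c w := l2c_form.2 fun S => (h S).mem

lemma FGradC.memGrad (h : FGradC w G) (j : Fin 3) : L2c (G j) :=
  l2c_form.2 fun S => (h S).memGrad j

lemma FGradC.clm (h : FGradC w G) (L : Form →L[ℂ] Form) :
    FGradC (fun x => L (w x)) (fun j x => L (G j x)) := fun S =>
  ⟨(h.mem.clm L).eval S, fun j => ((h.memGrad j).clm L).eval S, (h.fgrad.clm L S).weak⟩

lemma FGradC.smul (h : FGradC w G) {c : E3 → ℂ} (hc : ContDiff ℝ 1 c) :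
    FGradC (fun x => c x • w x) (fun j x => c x • G j x + pderiv j c x • w x) :=
  fun S => (h S).mul_contDiff hc

lemma FGrad.smul_test (h : FGrad w G) {c : E3 → ℂ} (hc : ContDiff ℝ 1 c)
    (hcc : HasCompactSupport c) :
    FGradC (fun x => c x • w x) (fun j x => c x • G j x + pderiv j c x • w x) :=
  fun S => (h S).mul_test hc hcc

lemma IsTest.fgradC {U : Set E3} (h : IsTest 1 U φ) : FGradC φ (fun j => pderiv j φ) := by
  intro S
  have := hasGradC_of_contDiff (contDiff_pi.1 h.1 S)
    (h.2.comp_left (g := fun v : Form => v S) rfl)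
  simpa only [pderiv_apply h.differentiable.differentiableAt] using this

lemma MemH1Loc.exists_fgrad (h : MemH1Loc w) : ∃ G, FGrad w G := by
  choose g hg hg' using h.2
  refine ⟨fun j x S => g S x {j}, fun S => ⟨l2Loc_form.1 (memL2Loc_iff.1 h.1) S, fun j => ?_,
    fun j => (hg S).hasWeakPartial j⟩⟩
  exact l2Loc_form.1 (memL2Loc_iff.1 (hg' S)) {j}

lemma FGrad.isWeak (h : FGrad w G) :
    IsWeakD Set.univ w (fun x => dSymb fun j => G j x) ∧
    IsWeakCod Set.univ w (fun x => codSymb fun j => G j x) :=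
  weak_of_partials isOpen_univ (h.mem.locallyIntegrable.locallyIntegrableOn _)
    (fun j => (h.memGrad j).locallyIntegrable.locallyIntegrableOn _) fun j S => (h S).weak j

lemma FGrad.weakD_ae (h : FGrad w G) : ∀ᵐ x, weakD Set.univ w x = dSymb fun j => G j x := by
  have := (weakD_spec ⟨_, h.isWeak.1⟩).ae_eq isOpen_univ h.isWeak.1
  rwa [Measure.restrict_univ] at this

lemma FGrad.weakCod_ae (h : FGrad w G) : ∀ᵐ x, weakCod Set.univ w x = codSymb fun j => G j x := by
  have := (weakCod_spec ⟨_, h.isWeak.2⟩).ae_eq isOpen_univ h.isWeak.2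
  rwa [Measure.restrict_univ] at this

lemma integrable_ip {u v : E3 → Form} (hu : L2Loc u) (hv : L2c v) :
    Integrable (fun x => ip (u x) (v x)) :=
  integrable_finsetSum _ fun S _ => (l2Loc_form.1 hu S).mul_l2c (hv.eval S)

/-- Integration by parts for graded forms. -/
lemma FGrad.ibp (h : FGrad w G) (h' : FGradC φ H) (j : Fin 3) :
    IntZero (fun x => ip (G j x) (φ x) + ip (w x) (H j x)) := by
  simp only [ip, ← Finset.sum_add_distrib]
  exact IntZero.sum fun S _ => (h S).ibp (h' S) j

/-- The product rule for the inner product of graded forms in `H¹_loc`. -/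
lemma FGrad.ip (h : FGrad w G) (h' : FGrad φ H) :
    HasGrad1 (fun x => ip (w x) (φ x))
      (fun j x => GradedForms.ip (G j x) (φ x) + GradedForms.ip (w x) (H j x)) := by
  simp only [ip_expand]
  have k := fun S => (h S).mul (h' S)
  have := (k ∅).add ((k {0}).add ((k {1}).add ((k {2}).add ((k {0, 1}).add ((k {0, 2}).add
    ((k {1, 2}).add (k {0, 1, 2})))))))
  refine ⟨this.mem, fun j => (this.memGrad j).congr (Eventually.of_forall fun x => by ring),
    fun j => ?_⟩
  convert! this.weak j using 1
  funext x; ring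

end

/-- A first-order weak identity for graded forms extends from smooth test forms to compactly
supported `H¹` forms. -/
theorem form_identity_extend {F : E3 → Form} {K : Fin 3 → E3 → Form} (hF : L2Loc F)
    (hK : ∀ j, L2Loc (K j))
    (h : ∀ φ : E3 → Form, IsTest ((⊤ : ℕ∞) : WithTop ℕ∞) Set.univ φ →
      ∫ x, (ip (F x) (φ x) + ∑ j, ip (K j x) (pderiv j φ x)) = 0)
    {φ : E3 → Form} {H : Fin 3 → E3 → Form} (hφ : FGradC φ H) :
    IntZero (fun x => ip (F x) (φ x) + ∑ j, ip (K j x) (H j x)) := by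
  have hint : ∀ S, Integrable (fun x => F x S * φ x S + ∑ j, K j x S * H j x S) := fun S =>
    ((l2Loc_form.1 hF S).mul_l2c (hφ S).mem).add <| integrable_finsetSum _ fun j _ =>
      (l2Loc_form.1 (hK j) S).mul_l2c ((hφ S).memGrad j)
  have hS : ∀ S, IntZero (fun x => F x S * φ x S + ∑ j, K j x S * H j x S) := by
    refine fun S => ⟨hint S, weak_identity_extend (l2Loc_form.1 hF S)
      (fun j => l2Loc_form.1 (hK j) S) (fun f hf hc => ?_) (hφ S)⟩
    let Q : ℂ →L[ℝ] Form :=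
      LinearMap.toContinuousLinearMap (LinearMap.single ℝ (fun _ : Finset (Fin 3) => ℂ) S)
    have := h (fun x => Pi.single S (f x)) ⟨Q.contDiff.comp hf,
      hc.comp_left (g := Q) (map_zero _), Set.subset_univ _⟩
    have hd : ∀ j x, pderiv j (fun x => (Pi.single S (f x) : Form)) x
        = Pi.single S (pderiv j f x) := by
      intro j x
      have := (Q.hasFDerivAt.comp x ((hf.differentiable (by simp)) x).hasFDerivAt).fderiv
      exact congrArg (fun T : E3 →L[ℝ] Form => T (EuclideanSpace.single j 1)) this
    simpa only [hd, ip_single] using this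
  refine (IntZero.sum (s := Finset.univ) fun S _ => hS S).congr (Eventually.of_forall fun x => ?_)
  simp only [ip, Finset.sum_add_distrib]
  rw [Finset.sum_comm]

/-- The weak identity `∫ ⟨v, Pᵗ φ⟩ = 0` extends from smooth test forms to compactly supported `H¹`
forms. -/
theorem ptSymb_identity_extend {α β : E3 → Fin 3 → ℂ} {k : E3 → ℂ}
    (hα : ∀ j, Continuous fun x => α x j) (hβ : ∀ j, Continuous fun x => β x j)
    (hk : Continuous k) {v : E3 → Form} (hv : L2Loc v)
    (h : ∀ φ : E3 → Form, IsTest ((⊤ : ℕ∞) : WithTop ℕ∞) Set.univ φ →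
      ∫ x, ip (v x) (ptSymb (α x) (β x) (k x) (φ x) (fun j => pderiv j φ x)) = 0)
    {φ : E3 → Form} {H : Fin 3 → E3 → Form} (hφ : FGradC φ H) :
    IntZero (fun x => ip (v x) (ptSymb (α x) (β x) (k x) (φ x) (fun j => H j x))) := by
  -- Transposing the matrices onto v exhibits ⟨v, Pᵗφ⟩ as ⟨F, φ⟩ + Σⱼ ⟨Kⱼ, ∂ⱼφ⟩, where F and K
  -- contain v undifferentiated and are therefore locally square integrable.
  let F : E3 → Form := fun x => (α x 0 • transp (aOp 0) (v x) + β x 0 • transp (bOp 0) (v x)) +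
    ((α x 1 • transp (aOp 1) (v x) + β x 1 • transp (bOp 1) (v x)) +
    ((α x 2 • transp (aOp 2) (v x) + β x 2 • transp (bOp 2) (v x)) + k x • v x))
  let K : Fin 3 → E3 → Form := fun j x => transp (sigma j) (v x)
  have e : ∀ x (u : Form) (U : Fin 3 → Form), ip (v x) (ptSymb (α x) (β x) (k x) u U) =
      ip (F x) u + ∑ j, ip (K j x) (U j) := by
    intro x u U
    simp only [ptSymb, F, K, ip_add_left, ip_add_right, ip_smul_left, ip_smul_right, ip_transp,
      Fin.sum_univ_three]
    ring
  have hFa := fun j => (hv.clm (transp (aOp j))).smul_continuous (hα j)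
  have hFb := fun j => (hv.clm (transp (bOp j))).smul_continuous (hβ j)
  have hF : L2Loc F := ((hFa 0).add (hFb 0)).add (((hFa 1).add (hFb 1)).add
    (((hFa 2).add (hFb 2)).add (hv.smul_continuous hk)))
  simp only [e] at h ⊢
  exact form_identity_extend hF (fun j => hv.clm _) h hφ

/-! ### The energy identity up to terms of zero integral -/

/-- The classical gradient. -/
def gradV (f : E3 → ℂ) (x : E3) : Fin 3 → ℂ := fun j => pderiv j f x

section symbols
variable (α β : Fin 3 → ℂ) (k : ℂ) (w φ : Form) (G H : Fin 3 → Form)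

/-- The term of the potential with the wave number. -/
def qWave : ℂ := 2 * k * ip (vee (oneForm (α + β)) (deg 1 w + deg 3 w)
  + wedge (oneForm (α + β)) (deg 0 w + deg 2 w)) φ

/-- The quadratic term of the potential. -/
def qQuad : ℂ := ip (oneForm α) (oneForm α) * ip (deg 0 w + deg 2 w) (deg 0 φ + deg 2 φ)
  + ip (oneForm β) (oneForm β) * ip (deg 1 w + deg 3 w) (deg 1 φ + deg 3 φ)

/-- The gradient term of the potential. -/
def qGrad : ℂ :=
  (∑ j, α j * (ip (- deg 0 (G j) + deg 2 (G j)) (deg 0 φ + deg 2 φ)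
      + ip (- deg 0 w + deg 2 w) (deg 0 (H j) + deg 2 (H j))))
  + ∑ j, β j * (ip (deg 1 (G j) - deg 3 (G j)) (deg 1 φ + deg 3 φ)
      + ip (deg 1 w - deg 3 w) (deg 1 (H j) + deg 3 (H j)))

/-- The `D*` term of the potential for one-forms. -/
def qSymOne : ℂ := - ∑ i, β i * symDiv i (deg 1 w) (deg 1 φ)
        (fun j => deg 1 (G j)) (fun j => deg 1 (H j))

/-- The `D*` term of the potential for two-forms. -/
def qSymTwo : ℂ := - ∑ i, α i * symDiv i (hodgeStar (deg 2 w)) (hodgeStar (deg 2 φ))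
        (fun j => hodgeStar (deg 2 (G j))) (fun j => hodgeStar (deg 2 (H j)))

/-- The terms without coefficients that integrate to zero. -/
def curlFree : ℂ :=
  (curlPair G H {0} {0, 1, 2} 2 1 + curlPair G H {1} {0, 1, 2} 0 2
      + curlPair G H {2} {0, 1, 2} 1 0
      - curlPair G H ∅ {0, 1} 0 1 - curlPair G H ∅ {0, 2} 0 2 - curlPair G H ∅ {1, 2} 1 2)
    + (curlPair G H {0, 1, 2} {0} 1 2 + curlPair G H {0, 1, 2} {1} 2 0
      + curlPair G H {0, 1, 2} {2} 0 1
      - curlPair G H {0, 1} ∅ 1 0 - curlPair G H {0, 2} ∅ 2 0 - curlPair G H {1, 2} ∅ 2 1)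

/-- The terms with coefficients that integrate to zero. -/
def curlFreeCoeff : ℂ :=
  (curlCoeff w φ G H α ∅ {0, 1} 0 1 + curlCoeff w φ G H α ∅ {0, 2} 0 2
      + curlCoeff w φ G H α ∅ {1, 2} 1 2)
    + (curlCoeff w φ G H α {0, 1} ∅ 0 1 + curlCoeff w φ G H α {0, 2} ∅ 0 2
      + curlCoeff w φ G H α {1, 2} ∅ 1 2)
    + ((curlCoeff w φ G H β {0} {0, 1, 2} 2 1 + curlCoeff w φ G H β {1} {0, 1, 2} 0 2
      + curlCoeff w φ G H β {2} {0, 1, 2} 1 0)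
    + (curlCoeff w φ G H β {0, 1, 2} {0} 2 1 + curlCoeff w φ G H β {0, 1, 2} {1} 0 2
      + curlCoeff w φ G H β {0, 1, 2} {2} 1 0))

lemma ptSymb_eq : ptSymb α β k w G =
    ∑ j, sigma j (G j) + ∑ j, (α j • aOp j w + β j • bOp j w) + k • w := by
  simp only [ptSymb, Finset.sum_add_distrib, add_assoc]

/-- Expansion by bilinearity into the principal part, the parts linear in α and in β, the part
quadratic in them, and the part containing k. The second bracket collects what integrates to zero.
-/
lemma ip_ptSymb : ip (ptSymb α β k w G) (ptSymb α β k φ H) =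
    (ip (codSymb G) (codSymb H) + ip (dSymb G) (dSymb H) + k ^ 2 * ip w φ
      + (qWave α β k w φ + qQuad α β w φ + qGrad α β w φ G H + qSymOne β w φ G H
        + qSymTwo α w φ G H))
    + (curlFree G H + curlFreeCoeff α β w φ G H
      + ∑ j, (ip (G j) (sigma j (k • φ))
        + ip w (sigma j (k • H j + (k * (α j + β j)) • φ)))) := by
  have h1 := ip_principal G H
  have h2 := ip_aOp α w φ G H
  have h3 := ip_bOp β w φ G H
  have h4 := ip_zeroth α β w φ
  have h5 := ip_wavenumber α β k w φ G H
  simp only [ptSymb_eq, qWave, qQuad, qGrad, qSymOne, qSymTwo, curlFree, curlFreeCoeff]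
  simp only [Finset.sum_add_distrib (f := fun j => α j • aOp j _), ip_add_left, ip_add_right,
    ip_smul_left, ip_smul_right] at h1 h2 h3 h4 h5 ⊢
  linear_combination h1 + h2 + h3 + h4 + h5

end symbols

section integrals
variable {w φ : E3 → Form} {G H : Fin 3 → E3 → Form}

lemma intZero_curlFree (h : FGrad w G) (h' : FGradC φ H) :
    IntZero (fun x => curlFree (fun j => G j x) (fun j => H j x)) := by
  have c := fun S T j k => (h S).curl (h' T) j k
  exact (((((((c _ _ _ _).add (c _ _ _ _)).add (c _ _ _ _)).sub (c _ _ _ _)).sub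
    (c _ _ _ _)).sub (c _ _ _ _))).add
    (((((((c _ _ _ _).add (c _ _ _ _)).add (c _ _ _ _)).sub (c _ _ _ _)).sub
    (c _ _ _ _)).sub (c _ _ _ _)))

lemma intZero_curlFreeCoeff {a b : E3 → ℂ} (ha : ContDiff ℝ 1 a) (hb : ContDiff ℝ 1 b)
    (h : FGrad w G) (h' : FGradC φ H) :
    IntZero (fun x => curlFreeCoeff (gradV a x) (gradV b x) (w x) (φ x)
      (fun j => G j x) (fun j => H j x)) := by
  have c := fun S T j k => curl_mul ha (h S) (h' T) j k
  have d := fun S T j k => curl_mul hb (h S) (h' T) j k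
  exact ((((c _ _ _ _).add (c _ _ _ _)).add (c _ _ _ _)).add
    (((c _ _ _ _).add (c _ _ _ _)).add (c _ _ _ _))).add
    ((((d _ _ _ _).add (d _ _ _ _)).add (d _ _ _ _)).add
    (((d _ _ _ _).add (d _ _ _ _)).add (d _ _ _ _)))

lemma intZero_wavenumber {k : E3 → ℂ} (hk : ContDiff ℝ 1 k) (h : FGrad w G) (h' : FGradC φ H) :
    IntZero (fun x => ∑ j, (ip (G j x) (sigma j (k x • φ x))
        + ip (w x) (sigma j (k x • H j x + pderiv j k x • φ x)))) :=
  IntZero.sum fun j _ => h.ibp ((h'.smul hk).clm (sigma j)) j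

/-- The energy identity for `Pᵗ`, up to terms that integrate to zero. -/
theorem intZero_energy {a b k : E3 → ℂ} (ha : ContDiff ℝ 1 a) (hb : ContDiff ℝ 1 b)
    (hk : ContDiff ℝ 1 k) (hkd : ∀ j x, pderiv j k x = k x * (pderiv j a x + pderiv j b x))
    (h : FGrad w G) (h' : FGradC φ H) :
    IntZero (fun x =>
      ip (ptSymb (gradV a x) (gradV b x) (k x) (w x) (fun j => G j x))
        (ptSymb (gradV a x) (gradV b x) (k x) (φ x) (fun j => H j x))
      - (ip (codSymb fun j => G j x) (codSymb fun j => H j x)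
        + ip (dSymb fun j => G j x) (dSymb fun j => H j x) + k x ^ 2 * ip (w x) (φ x)
      + (qWave (gradV a x) (gradV b x) (k x) (w x) (φ x) + qQuad (gradV a x) (gradV b x) (w x) (φ x)
        + qGrad (gradV a x) (gradV b x) (w x) (φ x) (fun j => G j x) (fun j => H j x)
        + qSymOne (gradV b x) (w x) (φ x) (fun j => G j x) (fun j => H j x)
        + qSymTwo (gradV a x) (w x) (φ x) (fun j => G j x) (fun j => H j x)))) := by
  refine (((intZero_curlFree h h').add (intZero_curlFreeCoeff ha hb h h')).add
    (intZero_wavenumber hk h h')).congr (Eventually.of_forall fun x => ?_)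
  simp only [hkd]
  rw [ip_ptSymb]
  exact (add_sub_cancel_left _ _).symm

end integrals

lemma HasGrad1.intZero_test {f φ : E3 → ℂ} {F : Fin 3 → E3 → ℂ} (h : HasGrad1 f F)
    (hφ : ContDiff ℝ 1 φ) (hc : HasCompactSupport φ) (j : Fin 3) :
    IntZero (fun x => F j x * φ x + f x * pderiv j φ x) := by
  have p := pderiv_test hφ hc j
  have e := h.weak j φ hφ hc (Set.subset_univ _)
  have i1 := (h.memGrad j).integrable_mul_test hφ.continuous hc
  have i2 := h.mem.integrable_mul_test p.1 p.2.1
  refine ⟨i1.add i2, ?_⟩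
  simp only [Measure.restrict_univ] at e
  rw [integral_add i1 i2, e, neg_add_cancel]

/-! ### The weak derivatives of products that occur in Q -/

section potential
variable {w φ : E3 → Form} {G H : Fin 3 → E3 → Form}

lemma wedge_dx_scalarForm (j : Fin 3) (c : ℂ) : wedge (dx j) (scalarForm c) = c • dx j := by
  funext A
  rw [wedge_dx]
  simp only [scalarForm, dx, Pi.smul_apply, Pi.single_apply, smul_eq_mul, mul_ite, mul_one,
    mul_zero]
  by_cases h : A = {j}
  · simp [h, shuffleSign]
  · have : j ∈ A → A \ {j} ≠ ∅ := by
      intro hj he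
      rw [Finset.sdiff_eq_empty_iff_subset] at he
      exact h (Finset.Subset.antisymm he (Finset.singleton_subset_iff.2 hj))
    rw [if_neg h]
    split_ifs with hj h2
    · exact absurd h2 (this hj)
    · rfl
    · rfl

lemma dScalar_eq {f : E3 → ℂ} {x : E3} (hf : DifferentiableAt ℝ f x) :
    dScalar f x = oneForm (gradV f x) := by
  unfold dScalar extD oneForm
  refine Finset.sum_congr rfl fun j _ => ?_
  have : pderiv j (fun y => scalarForm (f y)) x = scalarForm (pderiv j f x) := by
    let Q : ℂ →L[ℝ] Form :=
      LinearMap.toContinuousLinearMap (LinearMap.single ℝ (fun _ : Finset (Fin 3) => ℂ) ∅)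
    exact congrArg (fun T : E3 →L[ℝ] Form => T (EuclideanSpace.single j 1))
      (Q.hasFDerivAt.comp x hf.hasFDerivAt).fderiv
  rw [this, wedge_dx_scalarForm]
  rfl

/-- Local integrability is all that can be asked here: the function will be an inner product of two
H¹_loc forms, which in general is not in H¹_loc. -/
lemma HasGrad1.weakD_ae {h : E3 → ℂ} {D : Fin 3 → E3 → ℂ} (hh : HasGrad1 h D) :
    ∀ᵐ x, weakD Set.univ (fun y => scalarForm (h y)) x = oneForm fun j => D j x := by
  let Q : ℂ →L[ℝ] Form :=
    LinearMap.toContinuousLinearMap (LinearMap.single ℝ (fun _ : Finset (Fin 3) => ℂ) ∅)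
  have hw : IsWeakD Set.univ (fun y => scalarForm (h y)) (fun x => oneForm fun j => D j x) := by
    have := (weak_of_partials (U := Set.univ) (u := fun y => scalarForm (h y))
      (G := fun j x => scalarForm (D j x)) isOpen_univ
      (Q.locallyIntegrableOn_comp (hh.mem.locallyIntegrableOn _))
      (fun j => Q.locallyIntegrableOn_comp ((hh.memGrad j).locallyIntegrableOn _))
      (fun j S => by
        by_cases hS : S = ∅
        · subst hS; simpa [scalarForm] using hh.weak j
        · intro φ _ _ _
          simp [scalarForm, hS])).1
    simp only [wedge_dx_scalarForm] at this
    exact this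
  have := (weakD_spec ⟨_, hw⟩).ae_eq isOpen_univ hw
  rwa [Measure.restrict_univ] at this

lemma ip_oneForm (α β : Fin 3 → ℂ) : ip (oneForm α) (oneForm β) = ∑ j, α j * β j := by
  rw [ip_expand, Fin.sum_univ_three]
  simp only [oneForm_table]
  ring

lemma isHom_oneForm (v : E3 → Fin 3 → ℂ) : IsHom 1 (fun x => oneForm (v x)) := by
  intro x S hS
  simp only [oneForm, dx, Finset.sum_apply, Pi.smul_apply, smul_eq_mul, Pi.single_apply]
  refine Finset.sum_eq_zero fun j _ => ?_
  rw [if_neg, mul_zero]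
  rintro rfl
  simp at hS

lemma IsHom.deg_eq {l : ℕ} {u : E3 → Form} (h : IsHom l u) (x : E3) : deg l (u x) = u x := by
  funext S
  unfold deg
  split_ifs with hS
  · rfl
  · exact (h x S hS).symm

lemma ip_deg_left (l : ℕ) (u v : Form) : ip (deg l u) v = ip u (deg l v) := by
  unfold ip deg
  refine Finset.sum_congr rfl fun S _ => ?_
  split_ifs <;> simp

lemma IsTest.clm {U : Set E3} {n : WithTop ℕ∞} (h : IsTest n U φ) (L : Form →L[ℂ] Form) :
    IsTest n U (fun x => L (φ x)) :=
  ⟨(L.restrictScalars ℝ).contDiff.comp h.1, h.2.comp_left (g := L) (map_zero _),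
    (tsupport_comp_subset (g := L) (map_zero _) φ).trans h.3⟩

lemma isHom_deg (l : ℕ) (φ : E3 → Form) : IsHom l (fun x => deg l (φ x)) :=
  fun _ _ hS => if_neg hS

/-- The defining identity tests only with one-forms. Since v and v' are one-forms, an arbitrary test
form may be replaced by its part of degree 1. -/
lemma IsWeakSymAdj.ae_eq {A : E3 → Fin 3 → Fin 3 → ℂ} {v v' : E3 → Form} (h : IsWeakSymAdj A v)
    (h' : IsWeakSymAdj A v') : ∀ᵐ x, v x = v' x := by
  have := ae_eq_of_test isOpen_univ (h.locInt'.locallyIntegrableOn _)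
    (h'.locInt'.locallyIntegrableOn _) fun w hw => by
      have hw1 : IsTest 1 Set.univ (fun x => deg 1 (w x)) := hw.clm (degL 1)
      have e := h.integral_eq _ hw1 (isHom_deg 1 w)
      have e' := h'.integral_eq _ hw1 (isHom_deg 1 w)
      simp only [← ip_deg_left, h.isHom.deg_eq, h'.isHom.deg_eq] at e e'
      rw [Measure.restrict_univ, e, e']
  rwa [Measure.restrict_univ] at this

lemma symAdj_ae {A : E3 → Fin 3 → Fin 3 → ℂ} {v : E3 → Form} (h : IsWeakSymAdj A v) :
    ∀ᵐ x, symAdj A x = v x := by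
  have hs : IsWeakSymAdj A (symAdj A) := by
    unfold symAdj
    rw [dif_pos ⟨v, h⟩]
    exact Exists.choose_spec _
  exact hs.ae_eq h

/-- The product `u ⊙ v` of one-forms in `H¹_loc` has the expected formal adjoint derivative. -/
lemma isWeakSymAdj_symProd (h : FGrad w G) (h' : FGrad φ H) :
    IsWeakSymAdj (fun x => symProd (w x) (φ x))
      (fun x => oneForm fun i => - symDiv i (w x) (φ x) (fun j => G j x) (fun j => H j x)) := by
  have hp := fun i j => ((h {i}).mul (h' {j})).add ((h {j}).mul (h' {i}))
  have hl : ∀ i, LocallyIntegrable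
      fun x => - symDiv i (w x) (φ x) (fun j => G j x) (fun j => H j x) := by
    intro i
    refine LocallyIntegrable.neg ?_
    simp only [symDiv, Fin.sum_univ_three]
    have h3 := (((hp 0 i).memGrad 0).add ((hp 1 i).memGrad 1)).add ((hp 2 i).memGrad 2)
    refine h3.congr (Eventually.of_forall fun x => ?_)
    simp only [Pi.add_apply]; ring
  refine ⟨isHom_oneForm _, ?_, ?_, ?_⟩
  · refine locallyIntegrable_iff.2 fun K hK => integrable_pi_iff.2 fun i => integrable_pi_iff.2
      fun j => ?_
    exact ((locallyIntegrable_iff.1 (hp i j).mem K hK).div_const 2).congr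
      (Eventually.of_forall fun x => by simp only [symProd])
  · refine locallyIntegrable_iff.2 fun K hK => ?_
    exact integrable_finsetSum _ fun i _ => (locallyIntegrable_iff.1 (hl i) K hK).smul_const _
  · intro ψ hψ _
    -- This is the product rule for wᵢφⱼ + wⱼφᵢ in direction i, tested with ψⱼ and summed. The
    -- factor 2 built into `symIp` absorbs the two factors ½ of ⊙ and of D.
    have hz := IntZero.sum (s := Finset.univ) fun i _ => IntZero.sum (s := Finset.univ) fun j _ =>
      (hp i j).intZero_test (contDiff_pi.1 hψ.1 {j})
        (hψ.2.comp_left (g := fun v : Form => v {j}) rfl) i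
    have i1 : Integrable fun x => ip (oneForm fun i => - symDiv i (w x) (φ x) (fun j => G j x)
        (fun j => H j x)) (ψ x) := by
      have : ∀ x, ip (oneForm fun i => - symDiv i (w x) (φ x) (fun j => G j x)
        (fun j => H j x)) (ψ x) = ∑ i, - symDiv i (w x) (φ x) (fun j => G j x)
        (fun j => H j x) * ψ x {i} := by
        intro x
        rw [ip_expand, Fin.sum_univ_three]
        simp only [oneForm_table]
        ring
      simp only [this]
      exact integrable_finsetSum _ fun i _ => (hl i).integrable_mul_test
        (contDiff_pi.1 hψ.1 {i}).continuous (hψ.2.comp_left (g := fun v : Form => v {i}) rfl)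
    have i2 : IntZero fun x => symIp (symProd (w x) (φ x)) (symD ψ x) -
        ip (oneForm fun i => - symDiv i (w x) (φ x) (fun j => G j x) (fun j => H j x)) (ψ x) := by
      refine hz.congr (Eventually.of_forall fun x => ?_)
      have hd : ∀ i j, pderiv i (fun x => ψ x {j}) x = pderiv i ψ x {j} := fun i j =>
        (pderiv_apply hψ.differentiable.differentiableAt i {j}).symm
      simp only [hd, symIp, symD, symProd, ip_expand, oneForm_table, symDiv, Fin.sum_univ_three,
        Fin.isValue, Fin.reduceEq, and_true, and_false, if_true, if_false]
      ring
    have i3 : Integrable fun x => symIp (symProd (w x) (φ x)) (symD ψ x) :=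
      (i2.1.add i1).congr (Eventually.of_forall fun x => by simp)
    have := i2.2
    rw [integral_sub i3 i1] at this
    exact (sub_eq_zero.1 this).symm

end potential

/-! ### Logarithms and roots of the coefficients -/

/-- A `C¹` coefficient with positive real part. -/
structure PosCoeff (γ : E3 → ℂ) : Prop where
  contDiff : ContDiff ℝ 1 γ
  re_pos : ∀ x, 0 < (γ x).re

namespace PosCoeff
variable {γ μ : E3 → ℂ}

/-- Positive real part keeps the coefficient off the branch cut, so the principal logarithm is
smooth along it. -/
lemma mem_slitPlane (h : PosCoeff γ) (x : E3) : γ x ∈ Complex.slitPlane := Or.inl (h.re_pos x)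

lemma ne_zero (h : PosCoeff γ) (x : E3) : γ x ≠ 0 := Complex.slitPlane_ne_zero (h.mem_slitPlane x)

lemma contDiff_halfLog (h : PosCoeff γ) : ContDiff ℝ 1 (halfLog γ) := by
  refine ContDiff.div_const (contDiff_iff_contDiffAt.2 fun x => ?_) 2
  exact ((Complex.contDiffAt_log (h.mem_slitPlane x)).restrict_scalars ℝ).comp x
    h.contDiff.contDiffAt

lemma exp_halfLog_sq (h : PosCoeff γ) (x : E3) :
    Complex.exp (halfLog γ x) * Complex.exp (halfLog γ x) = γ x := by
  rw [← Complex.exp_add, halfLog, add_halves, Complex.exp_log (h.ne_zero x)]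

lemma rootProd_eq (h : PosCoeff γ) (h' : PosCoeff μ) (x : E3) :
    rootProd γ μ x = Complex.exp (halfLog γ x) * Complex.exp (halfLog μ x) := by
  rw [rootProd, Complex.cpow_def_of_ne_zero (h.ne_zero x),
    Complex.cpow_def_of_ne_zero (h'.ne_zero x), halfLog, halfLog]
  congr 2 <;> ring

lemma contDiff_exp (h : PosCoeff γ) (c : ℂ) :
    ContDiff ℝ 1 (fun x => Complex.exp (c * halfLog γ x)) :=
  (contDiff_const.mul h.contDiff_halfLog).cexp

lemma pderiv_exp (h : PosCoeff γ) (c : ℂ) (j : Fin 3) (x : E3) :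
    pderiv j (fun x => Complex.exp (c * halfLog γ x)) x =
      c * Complex.exp (c * halfLog γ x) * pderiv j (halfLog γ) x := by
  have h1 := ((h.contDiff_halfLog.differentiable (by simp)) x).hasFDerivAt
  have h2 := (h1.const_mul c).cexp.fderiv
  unfold pderiv
  rw [h2]
  simp
  ring

lemma contDiff_rootProd (h : PosCoeff γ) (h' : PosCoeff μ) : ContDiff ℝ 1 (rootProd γ μ) := by
  rw [show rootProd γ μ = _ from funext (h.rootProd_eq h')]
  exact h.contDiff_halfLog.cexp.mul h'.contDiff_halfLog.cexp

/-- The root product is e^{a+b}. This relation makes the wave number terms in `ip_wavenumber` a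
divergence. -/
lemma pderiv_rootProd (h : PosCoeff γ) (h' : PosCoeff μ) (j : Fin 3) (x : E3) :
    pderiv j (rootProd γ μ) x =
      rootProd γ μ x * (pderiv j (halfLog γ) x + pderiv j (halfLog μ) x) := by
  have e1 := h.pderiv_exp 1 j x
  have e2 := h'.pderiv_exp 1 j x
  simp only [one_mul] at e1 e2
  rw [show rootProd γ μ = _ from funext (h.rootProd_eq h'),
    pderiv_mul (h.contDiff_halfLog.cexp.differentiable (by simp) x)
      (h'.contDiff_halfLog.cexp.differentiable (by simp) x), e1, e2]
  ring

lemma rootProd_sq (h : PosCoeff γ) (h' : PosCoeff μ) (x : E3) :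
    rootProd γ μ x ^ 2 = γ x * μ x := by
  rw [h.rootProd_eq h', ← h.exp_halfLog_sq x, ← h'.exp_halfLog_sq x]
  ring

end PosCoeff

/-- The zeroth-order coefficient `iω γ^{1/2} μ^{1/2}`. -/
def waveNum (ω : ℝ) (γ μ : E3 → ℂ) (x : E3) : ℂ := Complex.I * ω * rootProd γ μ x

section
variable {γ μ : E3 → ℂ} (h : PosCoeff γ) (h' : PosCoeff μ) (ω : ℝ)

lemma contDiff_waveNum (h : PosCoeff γ) (h' : PosCoeff μ) : ContDiff ℝ 1 (waveNum ω γ μ) :=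
  contDiff_const.mul (h.contDiff_rootProd h')

lemma pderiv_waveNum (h : PosCoeff γ) (h' : PosCoeff μ) (j : Fin 3) (x : E3) :
    pderiv j (waveNum ω γ μ) x =
      waveNum ω γ μ x * (pderiv j (halfLog γ) x + pderiv j (halfLog μ) x) := by
  have := pderiv_mul (f := fun _ => Complex.I * ω)
    (differentiableAt_const _) ((h.contDiff_rootProd h').differentiable (by simp) x) j
  have hc : pderiv j (fun _ : E3 => Complex.I * (ω : ℂ)) x = 0 := by simp [pderiv]
  rw [hc, h.pderiv_rootProd h'] at this
  unfold waveNum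
  rw [this]
  ring

/-- In `energy_eq` this value splits into −ω²ε₀μ₀ of the constant-coefficient part and −ω²(γμ −
ε₀μ₀) of the potential. -/
lemma waveNum_sq (h : PosCoeff γ) (h' : PosCoeff μ) (x : E3) :
    waveNum ω γ μ x ^ 2 = - (ω : ℂ) ^ 2 * (γ x * μ x) := by
  rw [waveNum, mul_pow, mul_pow, h.rootProd_sq h', Complex.I_sq]
  ring

end

/-! ### The energy identity -/

section
variable {γ μ : E3 → ℂ} {w φ : E3 → Form} {G H : Fin 3 → E3 → Form}

/-- The operator `Pᵗ` in terms of the weak partial derivatives. -/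
def ptField (ω : ℝ) (γ μ : E3 → ℂ) (w : E3 → Form) (G : Fin 3 → E3 → Form) (x : E3) : Form :=
  ptSymb (gradV (halfLog γ) x) (gradV (halfLog μ) x) (waveNum ω γ μ x) (w x) (fun j => G j x)

/-- `weakD` and `weakCod` are chosen representatives, known only up to null sets. Elsewhere they are
given by the weak partial derivatives, and the two expressions for Pᵗ agree component by component.
-/
lemma Pt_ae (hγ : PosCoeff γ) (hμ : PosCoeff μ) (ω : ℝ) (h : FGrad w G) :
    ∀ᵐ x, Pt γ μ ω w x = ptField ω γ μ w G x := by
  have hs := h.clm sgnL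
  have e : (fun y => ∑ l ∈ Finset.range 4, ((-1 : ℂ) ^ (l + 1)) • deg l (w y)) =
      fun y => sgnL (w y) := by
    funext y
    simp [sgnL, degL_apply]
  filter_upwards [hs.weakD_ae, hs.weakCod_ae] with x h1 h2
  unfold Pt
  simp only [e, h1, h2, dScalar_eq (hγ.contDiff_halfLog.differentiable (by simp) x),
    dScalar_eq (hμ.contDiff_halfLog.differentiable (by simp) x), wedge_oneForm, vee_oneForm]
  unfold ptField waveNum
  apply form_ext <;> simp [ptSymb, dSymb, codSymb, Fin.sum_univ_three, sigma_table, aOp_table,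
    bOp_table, wedge_table_zero, wedge_table_one, wedge_table_two, deg_table, cont_table_zero,
    cont_table_one, cont_table_two] <;> ring

lemma l2Loc_ptField (hγ : PosCoeff γ) (hμ : PosCoeff μ) (ω : ℝ) (h : FGrad w G) :
    L2Loc (ptField ω γ μ w G) := by
  have t := fun j => (((h.memGrad j).clm (sigma j)).add ((h.mem.clm (aOp j)).smul_continuous
    (continuous_pderiv hγ.contDiff_halfLog j))).add ((h.mem.clm (bOp j)).smul_continuous
    (continuous_pderiv hμ.contDiff_halfLog j))
  have := (((t 0).add (t 1)).add (t 2)).add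
    (h.mem.smul_continuous (contDiff_waveNum ω hγ hμ).continuous)
  unfold ptField
  simp only [ptSymb, Fin.sum_univ_three]
  exact this

lemma l2c_ptField (hγ : PosCoeff γ) (hμ : PosCoeff μ) (ω : ℝ) (h : FGradC w G) :
    L2c (ptField ω γ μ w G) := by
  have t := fun j => (((h.memGrad j).clm (sigma j)).add ((h.mem.clm (aOp j)).smul_continuous
    (continuous_pderiv hγ.contDiff_halfLog j))).add ((h.mem.clm (bOp j)).smul_continuous
    (continuous_pderiv hμ.contDiff_halfLog j))
  have := (((t 0).add (t 1)).add (t 2)).add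
    (h.mem.smul_continuous (contDiff_waveNum ω hγ hμ).continuous)
  unfold ptField
  simp only [ptSymb, Fin.sum_univ_three]
  exact this

/-- The terms of `⟨Q w, φ⟩` in terms of the weak partial derivatives. -/
lemma Qform_eq (hγ : PosCoeff γ) (hμ : PosCoeff μ) (μ₀ ε₀ ω : ℝ) (h : FGrad w G)
    (h' : FGrad φ H) : Qform μ₀ ε₀ γ μ ω w φ =
      (∫ x, qWave (gradV (halfLog γ) x) (gradV (halfLog μ) x) (waveNum ω γ μ x) (w x) (φ x))
      - (∫ x, (ω : ℂ) ^ 2 * (γ x * μ x - ε₀ * μ₀) * ip (w x) (φ x))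
      + (∫ x, qQuad (gradV (halfLog γ) x) (gradV (halfLog μ) x) (w x) (φ x))
      + (∫ x, qGrad (gradV (halfLog γ) x) (gradV (halfLog μ) x) (w x) (φ x)
          (fun j => G j x) (fun j => H j x))
      + (∫ x, qSymOne (gradV (halfLog μ) x) (w x) (φ x) (fun j => G j x) (fun j => H j x))
      + (∫ x, qSymTwo (gradV (halfLog γ) x) (w x) (φ x) (fun j => G j x) (fun j => H j x)) := by
  have da : dScalar (halfLog γ) = fun x => oneForm (gradV (halfLog γ) x) := funext fun x =>
    dScalar_eq (hγ.contDiff_halfLog.differentiable (by simp) x)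
  have db : dScalar (halfLog μ) = fun x => oneForm (gradV (halfLog μ) x) := funext fun x =>
    dScalar_eq (hμ.contDiff_halfLog.differentiable (by simp) x)
  -- This turns the factor 2iω d(γ^{1/2}μ^{1/2}) of Q into 2k(∇a + ∇b).
  have dk : dScalar (rootProd γ μ) = fun x => rootProd γ μ x •
      oneForm (gradV (halfLog γ) x + gradV (halfLog μ) x) := by
    funext x
    rw [dScalar_eq ((hγ.contDiff_rootProd hμ).differentiable (by simp) x)]
    simp only [oneForm, gradV, hγ.pderiv_rootProd hμ, Pi.add_apply, Finset.smul_sum, smul_smul]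
  unfold Qform
  simp only [da, db, dk]
  -- The integral with γμ − ε₀μ₀ and the quadratic one match definitionally. The wave number,
  -- gradient and two D* integrals remain, in this order.
  congr 1
  congr 1
  congr 1
  congr 1
  congr 1
  · refine integral_congr_ae (Eventually.of_forall fun x => ?_)
    have hv : ∀ (c : ℂ) (α : Fin 3 → ℂ), c • oneForm α = oneForm (c • α) := fun c α => by
      simp [oneForm, Finset.smul_sum, smul_smul]
    have e1 : ∀ (c : ℂ) (α : Fin 3 → ℂ) (u : Form),
        vee (c • oneForm α) u = c • vee (oneForm α) u := fun c α u => by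
      rw [hv, vee_oneForm, vee_oneForm, Finset.smul_sum]
      simp only [Pi.smul_apply, smul_eq_mul, smul_smul]
    have e2 : ∀ (c : ℂ) (α : Fin 3 → ℂ) (u : Form),
        wedge (c • oneForm α) u = c • wedge (oneForm α) u := fun c α u => by
      rw [hv, wedge_oneForm, wedge_oneForm, Finset.smul_sum]
      simp only [Pi.smul_apply, smul_eq_mul, smul_smul]
    simp only [e1, e2, qWave, waveNum, ip_add_left, ip_smul_left]
    ring
  · refine integral_congr_ae ?_
    have k1 := ((h.clm (-degL 0 + degL 2)).ip (h'.clm (degL 0 + degL 2))).weakD_ae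
    have k2 := ((h.clm (degL 1 - degL 3)).ip (h'.clm (degL 1 + degL 3))).weakD_ae
    filter_upwards [k1, k2] with x h1 h2
    refine (congrArg₂ (· + ·) (congrArg (ip _) h1) (congrArg (ip _) h2)).trans ?_
    rw [ip_oneForm, ip_oneForm]
    rfl
  · refine integral_congr_ae ?_
    filter_upwards [symAdj_ae (isWeakSymAdj_symProd (h.clm (degL 1)) (h'.clm (degL 1)))]
      with x hx
    refine (congrArg (ip _) hx).trans ?_
    rw [ip_oneForm]
    simp only [mul_neg, Finset.sum_neg_distrib]
    rfl
  · refine integral_congr_ae ?_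
    filter_upwards [symAdj_ae (isWeakSymAdj_symProd (h.clm (starDegL 2)) (h'.clm (starDegL 2)))]
      with x hx
    refine (congrArg (ip _) hx).trans ?_
    rw [ip_oneForm]
    simp only [mul_neg, Finset.sum_neg_distrib]
    rfl

lemma integrable_coeff_mul {c f g : E3 → ℂ} (hc : Continuous c) (hf : L2Loc f) (hg : L2c g) :
    Integrable (fun x => c x * (f x * g x)) := by
  simpa [mul_assoc] using (hf.smul_continuous hc).mul_l2c hg

lemma integrable_coeff_ip {c : E3 → ℂ} (hc : Continuous c) {u v : E3 → Form} (hu : L2Loc u)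
    (hv : L2c v) : Integrable (fun x => c x * ip (u x) (v x)) := by
  simpa [ip_smul_left] using integrable_ip (hu.smul_continuous hc) hv

lemma integrable_symDiv {c : E3 → ℂ} (hc : Continuous c) (h : FGrad w G) (h' : FGradC φ H)
    (i : Fin 3) : Integrable (fun x => c x * symDiv i (w x) (φ x) (fun j => G j x)
      (fun j => H j x)) := by
  simp only [symDiv, Finset.mul_sum, mul_add]
  refine integrable_finsetSum _ fun j _ => ?_
  exact (((integrable_coeff_mul hc ((h _).memGrad _) (h' _).mem).add
    (integrable_coeff_mul hc (h _).mem ((h' _).memGrad _))).add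
    (integrable_coeff_mul hc ((h _).memGrad _) (h' _).mem)).add
    (integrable_coeff_mul hc (h _).mem ((h' _).memGrad _))

/-- Every term is a continuous coefficient times a locally square-integrable factor times a
square-integrable factor vanishing outside a ball. Separate integrability is needed because Q is a
sum of integrals, whereas the energy identity concerns one integrand. -/
lemma integrable_potential (hγ : PosCoeff γ) (hμ : PosCoeff μ) (ω : ℝ) (h : FGrad w G)
    (h' : FGradC φ H) :
    Integrable (fun x => qWave (gradV (halfLog γ) x) (gradV (halfLog μ) x) (waveNum ω γ μ x)
      (w x) (φ x)) ∧
    Integrable (fun x => qQuad (gradV (halfLog γ) x) (gradV (halfLog μ) x) (w x) (φ x)) ∧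
    Integrable (fun x => qGrad (gradV (halfLog γ) x) (gradV (halfLog μ) x) (w x) (φ x)
          (fun j => G j x) (fun j => H j x)) ∧
    Integrable (fun x => qSymOne (gradV (halfLog μ) x) (w x) (φ x) (fun j => G j x)
      (fun j => H j x)) ∧
    Integrable (fun x => qSymTwo (gradV (halfLog γ) x) (w x) (φ x) (fun j => G j x)
      (fun j => H j x)) := by
  have ca := continuous_pderiv hγ.contDiff_halfLog
  have cb := continuous_pderiv hμ.contDiff_halfLog
  refine ⟨?_, ?_, ?_, ?_, ?_⟩
  · let C : Fin 3 → Form →L[ℂ] Form := fun j =>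
      (contL j).comp ((degL 1 - degL 2 + degL 3).comp (degL 1 + degL 3))
        + (wedgeL j).comp (degL 0 + degL 2)
    have t := fun j => (h.mem.clm (C j)).smul_continuous ((ca j).add (cb j))
    have := integrable_coeff_ip ((continuous_const (y := (2 : ℂ))).mul
      (contDiff_waveNum ω hγ hμ).continuous) (((t 0).add (t 1)).add (t 2)) h'.mem
    refine this.congr (Eventually.of_forall fun x => ?_)
    simp only [qWave]
    congr 2
    simp only [vee_oneForm, wedge_oneForm, Fin.sum_univ_three, C]
    apply form_ext <;> simp [gradV, wedgeL_apply, contL_apply, degL_apply, wedge_table_zero,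
      wedge_table_one, wedge_table_two, deg_table, cont_table_zero, cont_table_one,
      cont_table_two]
  · simp only [qQuad, ip_oneForm]
    refine (integrable_coeff_ip ?_ (h.mem.clm (degL 0 + degL 2))
      (h'.mem.clm (degL 0 + degL 2))).add (integrable_coeff_ip ?_
      (h.mem.clm (degL 1 + degL 3)) (h'.mem.clm (degL 1 + degL 3)))
    · exact continuous_finsetSum _ fun j _ => (ca j).mul (ca j)
    · exact continuous_finsetSum _ fun j _ => (cb j).mul (cb j)
  · refine (integrable_finsetSum _ fun j _ => ?_).add (integrable_finsetSum _ fun j _ => ?_)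
    · simp only [mul_add]
      exact (integrable_coeff_ip (ca j) ((h.memGrad j).clm (-degL 0 + degL 2))
        (h'.mem.clm (degL 0 + degL 2))).add (integrable_coeff_ip (ca j)
        (h.mem.clm (-degL 0 + degL 2)) ((h'.memGrad j).clm (degL 0 + degL 2)))
    · simp only [mul_add]
      exact (integrable_coeff_ip (cb j) ((h.memGrad j).clm (degL 1 - degL 3))
        (h'.mem.clm (degL 1 + degL 3))).add (integrable_coeff_ip (cb j)
        (h.mem.clm (degL 1 - degL 3)) ((h'.memGrad j).clm (degL 1 + degL 3)))
  · exact (integrable_finsetSum _ fun i _ => integrable_symDiv (cb i) (h.clm (degL 1))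
      (h'.clm (degL 1)) i).neg
  · exact (integrable_finsetSum _ fun i _ => integrable_symDiv (ca i) (h.clm (starDegL 2))
      (h'.clm (starDegL 2)) i).neg

lemma integrable_principal (h : FGrad w G) (h' : FGradC φ H) (c : ℂ) :
    Integrable fun x => ip (codSymb fun j => G j x) (codSymb fun j => H j x)
        + ip (dSymb fun j => G j x) (dSymb fun j => H j x) - c * ip (w x) (φ x) := by
  have a := fun j => (h.memGrad j).clm (contL j)
  have b := fun j => (h.memGrad j).clm (wedgeL j)
  have a' := fun j => (h'.memGrad j).clm (contL j)
  have b' := fun j => (h'.memGrad j).clm (wedgeL j)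
  have i1 := integrable_ip (((a 0).add (a 1)).add (a 2)) (((a' 0).add (a' 1)).add (a' 2))
  have i2 := integrable_ip (((b 0).add (b 1)).add (b 2)) (((b' 0).add (b' 1)).add (b' 2))
  refine ((i1.add i2).sub ((integrable_ip h.mem h'.mem).const_mul c)).congr
    (Eventually.of_forall fun x => ?_)
  have e : ∀ u v : Form, ip (-u) (-v) = ip u v := fun u v => by simp [ip]
  simp only [codSymb, dSymb, Fin.sum_univ_three, e]
  rfl

lemma integral_split {P E f₀ f₁ f₂ f₃ f₄ f₅ : E3 → ℂ} (hP : Integrable P) (hE : Integrable E)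
    (h₀ : Integrable f₀) (h₁ : Integrable f₁) (h₂ : Integrable f₂) (h₃ : Integrable f₃)
    (h₄ : Integrable f₄) (h₅ : Integrable f₅)
    (h : IntZero fun x => P x - (E x + (f₀ x - f₁ x + f₂ x + f₃ x + f₄ x + f₅ x))) :
    (∫ x, E x) + ((∫ x, f₀ x) - (∫ x, f₁ x) + (∫ x, f₂ x) + (∫ x, f₃ x) + (∫ x, f₄ x)
      + ∫ x, f₅ x) = ∫ x, P x := by
  have j1 : Integrable fun x => f₀ x - f₁ x := h₀.sub h₁
  have j2 : Integrable fun x => f₀ x - f₁ x + f₂ x := j1.add h₂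
  have j3 : Integrable fun x => f₀ x - f₁ x + f₂ x + f₃ x := j2.add h₃
  have j4 : Integrable fun x => f₀ x - f₁ x + f₂ x + f₃ x + f₄ x := j3.add h₄
  have j5 : Integrable fun x => f₀ x - f₁ x + f₂ x + f₃ x + f₄ x + f₅ x := j4.add h₅
  have j6 : Integrable fun x => E x + (f₀ x - f₁ x + f₂ x + f₃ x + f₄ x + f₅ x) := hE.add j5
  have := h.2
  rw [integral_sub hP j6, integral_add hE j5, integral_add j4 h₅, integral_add j3 h₄,
    integral_add j2 h₃, integral_add j1 h₂, integral_sub h₀ h₁] at this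
  exact (sub_eq_zero.1 this).symm

/-- The Schrödinger form associated with `Q` is `∫ ⟨Pᵗ w, Pᵗ φ⟩`. -/
theorem energy_eq (hγ : PosCoeff γ) (hμ : PosCoeff μ) (μ₀ ε₀ ω : ℝ) (h : FGrad w G)
    (h' : FGradC φ H) :
    (∫ x, (ip (codSymb fun j => G j x) (codSymb fun j => H j x)
        + ip (dSymb fun j => G j x) (dSymb fun j => H j x)
        - (ω : ℂ) ^ 2 * ε₀ * μ₀ * ip (w x) (φ x))) + Qform μ₀ ε₀ γ μ ω w φ =
      ∫ x, ip (ptField ω γ μ w G x) (ptField ω γ μ φ H x) := by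
  have hz := intZero_energy hγ.contDiff_halfLog hμ.contDiff_halfLog (contDiff_waveNum ω hγ hμ)
    (fun j x => pderiv_waveNum ω hγ hμ j x) h h'
  obtain ⟨i1, i2, i3, i4, i5⟩ := integrable_potential hγ hμ ω h h'
  have i6 : Integrable fun x => (ω : ℂ) ^ 2 * (γ x * μ x - ε₀ * μ₀) * ip (w x) (φ x) :=
    integrable_coeff_ip (continuous_const.mul ((hγ.contDiff.continuous.mul
      hμ.contDiff.continuous).sub continuous_const)) h.mem h'.mem
  have i0 := integrable_principal h h' ((ω : ℂ) ^ 2 * ε₀ * μ₀)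
  have iP : Integrable fun x => ip (ptField ω γ μ w G x) (ptField ω γ μ φ H x) :=
    integrable_ip (l2Loc_ptField hγ hμ ω h) (l2c_ptField hγ hμ ω h')
  rw [Qform_eq hγ hμ μ₀ ε₀ ω h h'.fgrad]
  refine integral_split iP i0 i1 i6 i2 i3 i4 i5 (hz.congr (Eventually.of_forall fun x => ?_))
  simp only [ptField, waveNum_sq ω hγ hμ]
  ring

end

/-! ### Algebra relating Pᵗ to the Maxwell system -/

section symbols
variable (α β : Fin 3 → ℂ) (k c : ℂ) (v ψ : Form) (P : Fin 3 → Form)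

lemma dSymb_apply (S : Finset (Fin 3)) : dSymb P S =
    wedge (dx 0) (P 0) S + wedge (dx 1) (P 1) S + wedge (dx 2) (P 2) S := by
  simp [dSymb, Fin.sum_univ_three]

lemma codSymb_apply (S : Finset (Fin 3)) : codSymb P S =
    -(cont 0 (P 0) S + cont 1 (P 1) S + cont 2 (P 2) S) := by
  simp [codSymb, Fin.sum_univ_three]

lemma ptSymb_apply (S : Finset (Fin 3)) : ptSymb α β k v P S =
    (sigma 0 (P 0) S + α 0 * aOp 0 v S + β 0 * bOp 0 v S)
    + (sigma 1 (P 1) S + α 1 * aOp 1 v S + β 1 * bOp 1 v S)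
    + (sigma 2 (P 2) S + α 2 * aOp 2 v S + β 2 * bOp 2 v S) + k * v S := by
  simp [ptSymb, Fin.sum_univ_three]

lemma deg_one_codSymb : deg 1 (codSymb P) = codSymb fun j => deg 2 (P j) := by
  apply form_ext <;> simp [deg_table, codSymb_apply, cont_table_zero, cont_table_one,
    cont_table_two]

lemma deg_two_dSymb : deg 2 (dSymb P) = dSymb fun j => deg 1 (P j) := by
  apply form_ext <;> simp [deg_table, dSymb_apply, wedge_table_zero, wedge_table_one,
    wedge_table_two]

/-- For c = e^{−a} the factor −c αⱼ is ∂ⱼc, and it cancels the α-term in degree 1. In degree 3 it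
does not cancel, and v³ = 0 discards that part. No β-term acts on two-forms. -/
lemma ip_ptSymb_two (h0 : v ∅ = 0) (h3 : v {0, 1, 2} = 0) :
    ip v (ptSymb α β k (c • deg 2 ψ) (fun j => c • deg 2 (P j) + (-c * α j) • deg 2 ψ)) =
      k * c * ip (deg 2 v) ψ - ip (c • deg 1 v) (codSymb P) := by
  simp [ip_expand, h0, h3, ptSymb_apply, codSymb_apply, sigma_table, aOp_table, bOp_table,
    wedge_table_zero, wedge_table_one, wedge_table_two, deg_table, cont_table_zero,
    cont_table_one, cont_table_two, sgnL_apply]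
  ring

/-- As for two-forms with c = e^{−b}: the β-terms cancel in degree 2, and v⁰ = 0 discards degree 0,
where they do not. -/
lemma ip_ptSymb_one (h0 : v ∅ = 0) (h3 : v {0, 1, 2} = 0) :
    ip v (ptSymb α β k (c • deg 1 ψ) (fun j => c • deg 1 (P j) + (-c * β j) • deg 1 ψ)) =
      k * c * ip (deg 1 v) ψ + ip (c • deg 2 v) (dSymb P) := by
  simp [ip_expand, h0, h3, ptSymb_apply, dSymb_apply, sigma_table, aOp_table, bOp_table,
    wedge_table_zero, wedge_table_one, wedge_table_two, deg_table, cont_table_zero,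
    cont_table_one, cont_table_two, sgnL_apply]
  ring

/-- Here A = γ^{1/2}, B = μ^{1/2} and A', B' are their inverses. The parts of ψ of degrees 2 and 1
test the equations for du₁ and δu₂. Its parts of degrees 0 and 3 test the divergence conditions
δ(γu₁) = 0 and d(μu₂) = 0. -/
lemma ip_ptSymb_maxwell {A A' B B' : ℂ} (hA : A * A' = 1) (hB : B * B' = 1) (u₁ u₂ : Form)
    (h₁ : deg 1 u₁ = u₁) (h₂ : deg 2 u₂ = u₂) :
    ip (A • u₁ + B • u₂) (ptSymb α β (k * (A * B)) ψ P) =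
      (ip ((k * (B * B)) • u₂) (A • deg 2 ψ)
        - ip u₁ (codSymb fun j => A • deg 2 (P j) + (A * α j) • deg 2 ψ))
      - (ip ((-(k * (A * A))) • u₁) (B • deg 1 ψ)
        - ip u₂ (dSymb fun j => B • deg 1 (P j) + (B * β j) • deg 1 ψ))
      - ip ((A * A) • u₁) (dSymb fun j => A' • deg 0 (P j) + (-A' * α j) • deg 0 ψ)
      + ip ((B * B) • u₂) (codSymb fun j => B' • deg 3 (P j) + (-B' * β j) • deg 3 ψ) := by
  rw [← h₁, ← h₂]
  simp [ip_expand, ptSymb_apply, dSymb_apply, codSymb_apply, sigma_table, aOp_table, bOp_table,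
    wedge_table_zero, wedge_table_one, wedge_table_two, deg_table, cont_table_zero,
    cont_table_one, cont_table_two, sgnL_apply]
  -- Only the terms of degrees 0 and 3 in ψ need the inverses, through A²A' = A and B²B' = B.
  linear_combination (A * (u₁ {0} * (P 0 ∅ - α 0 * ψ ∅) + u₁ {1} * (P 1 ∅ - α 1 * ψ ∅)
      + u₁ {2} * (P 2 ∅ - α 2 * ψ ∅))) * hA
    - (B * (-u₂ {1, 2} * (P 0 {0, 1, 2} - β 0 * ψ {0, 1, 2})
      + u₂ {0, 2} * (P 1 {0, 1, 2} - β 1 * ψ {0, 1, 2})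
      - u₂ {0, 1} * (P 2 {0, 1, 2} - β 2 * ψ {0, 1, 2}))) * hB

end symbols

/-! ### Weak exterior derivatives against H¹ tests -/

section tests
variable {ψ : E3 → Form}

lemma IsTest.codiff_eq_symb {U : Set E3} (h : IsTest 1 U ψ) (x : E3) :
    codiff ψ x = codSymb fun j => pderiv j ψ x :=
  codiff_eq h.differentiable.differentiableAt

lemma extD_eq_symb (x : E3) : extD ψ x = dSymb fun j => pderiv j ψ x := rfl

lemma pderiv_sum_clm (L : Fin 3 → Form →L[ℂ] Form) {f : Fin 3 → E3 → Form}
    (hf : ∀ j, Differentiable ℝ (f j)) (k : Fin 3) (x : E3) :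
    pderiv k (fun x => ∑ j, L j (f j x)) x = ∑ j, L j (pderiv k (f j) x) := by
  have h := HasFDerivAt.fun_sum (u := Finset.univ) fun j _ =>
    ((L j).restrictScalars ℝ).hasFDerivAt.comp x (hf j x).hasFDerivAt
  have := congrArg (fun T : E3 →L[ℝ] Form => T (EuclideanSpace.single k 1)) h.fderiv
  refine this.trans ?_
  simp [pderiv]

lemma extD_extD (h : ContDiff ℝ ((⊤ : ℕ∞) : WithTop ℕ∞) ψ) (x : E3) :
    extD (extD ψ) x = 0 := by
  have e : extD ψ = fun x => ∑ j, wedgeL j (pderiv j ψ x) := rfl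
  have hd : ∀ j, Differentiable ℝ (pderiv j ψ) := fun j =>
    (contDiff_pderiv h j).differentiable (by simp)
  have hp : ∀ k, pderiv k (fun x => ∑ j, wedgeL j (pderiv j ψ x)) x =
      ∑ j, wedgeL j (pderiv k (pderiv j ψ) x) := fun k => pderiv_sum_clm wedgeL hd k x
  rw [extD_eq_symb]
  simp only [e, hp]
  simp only [Fin.sum_univ_three]
  apply form_ext <;> simp [dSymb_apply, wedgeL_apply, wedge_table_zero, wedge_table_one,
    wedge_table_two, pderiv_pderiv h 1 0 x, pderiv_pderiv h 2 0 x, pderiv_pderiv h 2 1 x]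
  ring

lemma codiff_codiff (h : ContDiff ℝ ((⊤ : ℕ∞) : WithTop ℕ∞) ψ) (x : E3) :
    codiff (codiff ψ) x = 0 := by
  have e : codiff ψ = fun x => ∑ j, (-contL j) (pderiv j ψ x) := by
    funext x
    rw [codiff_eq (h.differentiable (by simp) x)]
    simp [Finset.sum_neg_distrib, contL_apply]
  have hd : ∀ j, Differentiable ℝ (pderiv j ψ) := fun j =>
    (contDiff_pderiv h j).differentiable (by simp)
  have hdc : DifferentiableAt ℝ (codiff ψ) x := by
    rw [e]
    exact DifferentiableAt.fun_sum fun j _ =>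
      ((-contL j).restrictScalars ℝ).differentiableAt.comp x (hd j x)
  have hp : ∀ k, pderiv k (fun x => ∑ j, (-contL j) (pderiv j ψ x)) x =
      ∑ j, (-contL j) (pderiv k (pderiv j ψ) x) :=
    fun k => pderiv_sum_clm (fun j => -contL j) hd k x
  rw [codiff_eq hdc]
  simp only [e, hp]
  simp only [Fin.sum_univ_three, pderiv_pderiv h 1 0 x,
    pderiv_pderiv h 2 0 x, pderiv_pderiv h 2 1 x]
  apply form_ext <;> simp [contL_apply, cont_table_zero, cont_table_one,
    cont_table_two]
  ring

lemma IsTest.extD_test (h : IsTest ((⊤ : ℕ∞) : WithTop ℕ∞) Set.univ ψ) :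
    IsTest 1 Set.univ (extD ψ) := by
  refine ⟨?_, h.of_top.extD_prop.2.1, Set.subset_univ _⟩
  exact ContDiff.sum fun j _ => ((wedgeL j).restrictScalars ℝ).contDiff.comp
    ((contDiff_pderiv h.1 j).of_le (by simp))

lemma IsTest.codiff_test (h : IsTest ((⊤ : ℕ∞) : WithTop ℕ∞) Set.univ ψ) :
    IsTest 1 Set.univ (codiff ψ) := by
  refine ⟨?_, h.of_top.codiff_prop.2.1, Set.subset_univ _⟩
  rw [show codiff ψ = fun x => -∑ j, contL j (pderiv j ψ x) from
    funext fun x => h.of_top.codiff_eq_symb x]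
  exact (ContDiff.sum fun j _ => ((contL j).restrictScalars ℝ).contDiff.comp
    ((contDiff_pderiv h.1 j).of_le (by simp))).neg

end tests

section extend
variable {u g ψ : E3 → Form} {P : Fin 3 → E3 → Form}

lemma ip_neg_right (a b : Form) : ip a (-b) = -ip a b := by simp [ip]

lemma ip_neg_left (a b : Form) : ip (-a) b = -ip a b := by simp [ip]

lemma ip_codSymb (a : Form) (Q : Fin 3 → Form) :
    ip a (codSymb Q) = -∑ j, ip (transp (contL j) a) (Q j) := by
  simp only [codSymb, ip_neg_right, ip_sum_right, ip_transp, contL_apply]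

lemma ip_dSymb (a : Form) (Q : Fin 3 → Form) :
    ip a (dSymb Q) = ∑ j, ip (transp (wedgeL j) a) (Q j) := by
  simp only [dSymb, ip_sum_right, ip_transp, wedgeL_apply]

/-- Needed because the Maxwell equations will be tested with γ^{1/2}φ² and μ^{1/2}φ¹, where φ is
only of class H¹. -/
lemma IsWeakD.extend (h : IsWeakD Set.univ u g) (hu : L2Loc u) (hg : L2Loc g)
    (hψ : FGradC ψ P) :
    IntZero fun x => ip (g x) (ψ x) - ip (u x) (codSymb fun j => P j x) := by
  simp only [ip_codSymb, sub_neg_eq_add]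
  refine form_identity_extend hg (fun j => hu.clm (transp (contL j))) (fun φ hφ => ?_) hψ
  have e := h.integral_eq φ hφ.of_top
  have i1 := integrable_ip hg hφ.of_top.fgradC.mem
  have i2 := integrable_ip_cpt isOpen_univ h.locInt hφ.of_top.codiff_prop.1
    hφ.of_top.codiff_prop.2.1 hφ.of_top.codiff_prop.2.2
  simp only [Measure.restrict_univ, integrableOn_univ] at e i2
  rw [← sub_eq_zero, ← integral_sub i1 i2] at e
  simpa only [hφ.of_top.codiff_eq_symb, ip_codSymb, sub_neg_eq_add] using e

lemma IsWeakCod.extend (h : IsWeakCod Set.univ u g) (hu : L2Loc u) (hg : L2Loc g)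
    (hψ : FGradC ψ P) :
    IntZero fun x => ip (g x) (ψ x) - ip (u x) (dSymb fun j => P j x) := by
  have key : ∀ (x : E3) (Q : Fin 3 → Form), - ip (u x) (dSymb Q) =
      ∑ j, ip (-transp (wedgeL j) (u x)) (Q j) := by
    intro x Q
    simp only [ip_dSymb, ip_neg_left, Finset.sum_neg_distrib]
  simp only [sub_eq_add_neg, key]
  refine form_identity_extend hg (fun j => (hu.clm (transp (wedgeL j))).neg) (fun φ hφ => ?_) hψ
  have e := h.integral_eq φ hφ.of_top
  have i1 := integrable_ip hg hφ.of_top.fgradC.mem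
  have i2 := integrable_ip_cpt isOpen_univ h.locInt hφ.of_top.extD_prop.1
    hφ.of_top.extD_prop.2.1 hφ.of_top.extD_prop.2.2
  simp only [Measure.restrict_univ, integrableOn_univ] at e i2
  rw [← sub_eq_zero, ← integral_sub i1 i2] at e
  simpa only [extD_eq_symb, sub_eq_add_neg, key] using e

/-- `d` of a weak exterior derivative vanishes. -/
lemma IsWeakD.closed (h : IsWeakD Set.univ u g) (hg : L2Loc g) (hψ : FGradC ψ P) :
    IntZero fun x => ip (g x) (codSymb fun j => P j x) := by
  have hz := form_identity_extend (F := fun _ => 0) (fun r => MemLp.zero)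
    (fun j => hg.clm (transp (contL j))) (fun φ hφ => ?_) hψ
  · refine (hz.const_mul (-1)).congr (Eventually.of_forall fun x => ?_)
    rw [ip_codSymb]
    simp [ip]
  -- For smooth φ the form δφ is an admissible C¹ test, and δδφ = 0 removes the term with u.
  · have e := h.integral_eq _ hφ.codiff_test
    simp only [codiff_codiff hφ.1, hφ.of_top.codiff_eq_symb, Measure.restrict_univ,
      ip_codSymb, integral_neg] at e
    simpa [ip] using e

/-- `δ` of a weak formal adjoint derivative vanishes. -/
lemma IsWeakCod.closed (h : IsWeakCod Set.univ u g) (hg : L2Loc g) (hψ : FGradC ψ P) :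
    IntZero fun x => ip (g x) (dSymb fun j => P j x) := by
  have hz := form_identity_extend (F := fun _ => 0) (fun r => MemLp.zero)
    (fun j => hg.clm (transp (wedgeL j))) (fun φ hφ => ?_) hψ
  · refine hz.congr (Eventually.of_forall fun x => ?_)
    rw [ip_dSymb]
    simp [ip]
  -- The test is dφ, and ddφ = 0.
  · have e := h.integral_eq _ hφ.extD_test
    simp only [extD_extD hφ.1, extD_eq_symb, Measure.restrict_univ, ip_dSymb] at e
    simpa [ip] using e

end extend

/-! ### Maxwell solutions and solutions of P v = 0 -/

/-- A weak solution `u₁ + u₂` in `ℝ³` of the Maxwell system `du₁ = iωμ u₂`, `δu₂ = -iωγ u₁`. -/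
structure WeakMaxwell (ω : ℝ) (γ μ : E3 → ℂ) (u₁ u₂ : E3 → Form) : Prop where
  mem₁ : L2Loc u₁
  mem₂ : L2Loc u₂
  hom₁ : IsHom 1 u₁
  hom₂ : IsHom 2 u₂
  weakD : IsWeakD Set.univ u₁ (fun x => (Complex.I * ω * μ x) • u₂ x)
  weakCod : IsWeakCod Set.univ u₂ (fun x => (-(Complex.I * ω * γ x)) • u₁ x)

section maxwell
variable {γ μ : E3 → ℂ}

lemma PosCoeff.exp_mul_exp_neg (x : E3) :
    Complex.exp (halfLog γ x) * Complex.exp (-1 * halfLog γ x) = 1 := by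
  rw [← Complex.exp_add]
  simp

/-- A solution of `P v = 0` without parts of degree `0` and `3` yields a solution of the Maxwell
system. -/
theorem weakMaxwell_of_pt (hγ : PosCoeff γ) (hμ : PosCoeff μ) (ω : ℝ) {v : E3 → Form}
    (hv : L2Loc v) (h0 : ∀ᵐ x, v x ∅ = 0 ∧ v x {0, 1, 2} = 0)
    (hP : ∀ φ H, FGradC φ H → IntZero fun x => ip (v x) (ptField ω γ μ φ H x)) :
    WeakMaxwell ω γ μ (fun x => Complex.exp (-1 * halfLog γ x) • deg 1 (v x))
      (fun x => Complex.exp (-1 * halfLog μ x) • deg 2 (v x)) := by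
  have m1 : L2Loc fun x => Complex.exp (-1 * halfLog γ x) • deg 1 (v x) :=
    (hv.clm (degL 1)).smul_continuous (hγ.contDiff_exp (-1)).continuous
  have m2 : L2Loc fun x => Complex.exp (-1 * halfLog μ x) • deg 2 (v x) :=
    (hv.clm (degL 2)).smul_continuous (hμ.contDiff_exp (-1)).continuous
  have m2' : L2Loc fun x => (Complex.I * ω * μ x) • Complex.exp (-1 * halfLog μ x) •
      deg 2 (v x) := m2.smul_continuous ((continuous_const (y := Complex.I * ω)).mul
    hμ.contDiff.continuous)
  have m1' : L2Loc fun x => (-(Complex.I * ω * γ x)) • Complex.exp (-1 * halfLog γ x) •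
      deg 1 (v x) := m1.smul_continuous ((continuous_const (y := Complex.I * ω)).mul
    hγ.contDiff.continuous).neg
  have homd : ∀ (c : E3 → ℂ) l, IsHom l fun x => c x • deg l (v x) := fun c l x S hS => by
    simp [deg, hS]
  refine ⟨m1, m2, homd _ 1, homd _ 2, ⟨m1.locallyIntegrable.locallyIntegrableOn _,
    m2'.locallyIntegrable.locallyIntegrableOn _, fun ψ hψ => ?_⟩,
    ⟨m2.locallyIntegrable.locallyIntegrableOn _, m1'.locallyIntegrable.locallyIntegrableOn _,
    fun ψ hψ => ?_⟩⟩
  -- The test γ^{-1/2}ψ² gives the equation for du₁, because kγ^{-1/2} = iωμ^{1/2} = iωμ · μ^{-1/2}.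
  · have hz := hP _ _ ((hψ.fgradC.clm (degL 2)).smul (hγ.contDiff_exp (-1)))
    have i1 := integrable_ip m2' hψ.fgradC.mem
    have i2 := integrable_ip m1 (l2c_of_continuous hψ.codiff_prop.1 hψ.codiff_prop.2.1)
    rw [Measure.restrict_univ, ← sub_eq_zero, ← integral_sub i1 i2]
    refine (hz.congr ?_).2
    filter_upwards [h0] with x hx
    have e := ip_ptSymb_two (gradV (halfLog γ) x) (gradV (halfLog μ) x) (waveNum ω γ μ x)
      (Complex.exp (-1 * halfLog γ x)) (v x) (ψ x) (fun j => pderiv j ψ x) hx.1 hx.2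
    simp only [ptField, hγ.pderiv_exp, degL_apply] at e ⊢
    simp only [gradV, neg_mul, one_mul, hψ.codiff_eq_symb] at e ⊢
    refine e.trans ?_
    congr 1
    simp only [ip_smul_left, ← mul_assoc]
    congr 1
    have e1 := hμ.exp_halfLog_sq x
    have e2 := PosCoeff.exp_mul_exp_neg (γ := μ) x
    have e3 := PosCoeff.exp_mul_exp_neg (γ := γ) x
    simp only [neg_mul, one_mul] at e2 e3
    rw [waveNum, hγ.rootProd_eq hμ, ← e1]
    linear_combination (Complex.I * ω * Complex.exp (halfLog μ x)) * (e3 - e2)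
  -- The test μ^{-1/2}ψ¹ gives the equation for δu₂ with the opposite sign.
  · have hz := hP _ _ ((hψ.fgradC.clm (degL 1)).smul (hμ.contDiff_exp (-1)))
    have i1 := integrable_ip m1' hψ.fgradC.mem
    have i2 := integrable_ip m2 (l2c_of_continuous hψ.extD_prop.1 hψ.extD_prop.2.1)
    rw [Measure.restrict_univ, ← sub_eq_zero, ← integral_sub i1 i2]
    refine ((hz.const_mul (-1)).congr ?_).2
    filter_upwards [h0] with x hx
    have e := ip_ptSymb_one (gradV (halfLog γ) x) (gradV (halfLog μ) x) (waveNum ω γ μ x)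
      (Complex.exp (-1 * halfLog μ x)) (v x) (ψ x) (fun j => pderiv j ψ x) hx.1 hx.2
    simp only [ptField, hμ.pderiv_exp, degL_apply] at e ⊢
    simp only [gradV, neg_mul, one_mul, extD_eq_symb] at e ⊢
    rw [e]
    simp only [ip_smul_left]
    have e1 := hγ.exp_halfLog_sq x
    have e2 := PosCoeff.exp_mul_exp_neg (γ := γ) x
    have e3 := PosCoeff.exp_mul_exp_neg (γ := μ) x
    simp only [neg_mul, one_mul] at e2 e3
    rw [waveNum, hγ.rootProd_eq hμ, ← e1]
    linear_combination (Complex.I * ω * Complex.exp (halfLog γ x) * ip (deg 1 (v x)) (ψ x))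
      * (e2 - e3)

/-- A weak solution of the Maxwell system yields a solution of `P v = 0`. -/
theorem WeakMaxwell.intZero_pt (hγ : PosCoeff γ) (hμ : PosCoeff μ) {ω : ℝ} (hω : ω ≠ 0)
    {u₁ u₂ : E3 → Form} (h : WeakMaxwell ω γ μ u₁ u₂) {φ : E3 → Form} {H : Fin 3 → E3 → Form}
    (hφ : FGradC φ H) :
    IntZero fun x => ip (Complex.exp (halfLog γ x) • u₁ x + Complex.exp (halfLog μ x) • u₂ x)
      (ptField ω γ μ φ H x) := by
  have m2 : L2Loc fun x => (Complex.I * ω * μ x) • u₂ x := h.mem₂.smul_continuous ((continuous_const (y := Complex.I * ω)).mul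
    hμ.contDiff.continuous)
  have m1 : L2Loc fun x => (-(Complex.I * ω * γ x)) • u₁ x := h.mem₁.smul_continuous ((continuous_const (y := Complex.I * ω)).mul
    hγ.contDiff.continuous).neg
  have z2 := h.weakD.extend h.mem₁ m2 ((hφ.clm (degL 2)).smul (hγ.contDiff_exp 1))
  have z1 := h.weakCod.extend h.mem₂ m1 ((hφ.clm (degL 1)).smul (hμ.contDiff_exp 1))
  -- δδ = 0 and dd = 0 yield the divergence conditions with an extra factor ∓iω. Dividing by it is
  -- where ω ≠ 0 enters.
  have z0 := h.weakCod.closed m1 ((hφ.clm (degL 0)).smul (hγ.contDiff_exp (-1)))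
  have z3 := h.weakD.closed m2 ((hφ.clm (degL 3)).smul (hμ.contDiff_exp (-1)))
  have hc : (ω : ℂ) ≠ 0 := by exact_mod_cast hω
  refine (((z2.sub z1).add (z0.const_mul (Complex.I * ω)⁻¹)).add
    (z3.const_mul (Complex.I * ω)⁻¹)).congr (Eventually.of_forall fun x => ?_)
  have e := ip_ptSymb_maxwell (gradV (halfLog γ) x) (gradV (halfLog μ) x) (Complex.I * ω) (φ x)
    (fun j => H j x) (PosCoeff.exp_mul_exp_neg (γ := γ) x) (PosCoeff.exp_mul_exp_neg (γ := μ) x)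
    (u₁ x) (u₂ x) (h.hom₁.deg_eq x) (h.hom₂.deg_eq x)
  simp only [ptField, waveNum, hγ.rootProd_eq hμ]
  rw [e]
  simp only [hγ.pderiv_exp, hμ.pderiv_exp, degL_apply]
  simp only [hγ.exp_halfLog_sq, hμ.exp_halfLog_sq,
    one_mul, neg_mul, ip_smul_left, gradV]
  field_simp
  ring

end maxwell

/-! ### Restriction to Ω, traces and gluing -/

section restrict
variable {U : Set E3} {u v ψ : E3 → Form}

lemma IsTest.mono {n : WithTop ℕ∞} {V : Set E3} (h : IsTest n U ψ) (hUV : U ⊆ V) :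
    IsTest n V ψ := ⟨h.1, h.2, h.3.trans hUV⟩

lemma IsWeakD.restrict (h : IsWeakD Set.univ u v) (U : Set E3) : IsWeakD U u v := by
  refine ⟨h.locInt.mono_set (Set.subset_univ _), h.locInt'.mono_set (Set.subset_univ _),
    fun ψ hψ => ?_⟩
  have e := h.integral_eq ψ (hψ.mono (Set.subset_univ _))
  rw [Measure.restrict_univ] at e
  rw [setIntegral_eq_integral_of_forall_compl_eq_zero fun x hx => ?_,
    setIntegral_eq_integral_of_forall_compl_eq_zero fun x hx => ?_, e]
  · rw [image_eq_zero_of_notMem_tsupport fun h' => hx (hψ.codiff_prop.2.2 h')]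
    simp [ip]
  · rw [image_eq_zero_of_notMem_tsupport fun h' => hx (hψ.3 h')]
    simp [ip]

lemma IsWeakCod.restrict (h : IsWeakCod Set.univ u v) (U : Set E3) : IsWeakCod U u v := by
  refine ⟨h.locInt.mono_set (Set.subset_univ _), h.locInt'.mono_set (Set.subset_univ _),
    fun ψ hψ => ?_⟩
  have e := h.integral_eq ψ (hψ.mono (Set.subset_univ _))
  rw [Measure.restrict_univ] at e
  rw [setIntegral_eq_integral_of_forall_compl_eq_zero fun x hx => ?_,
    setIntegral_eq_integral_of_forall_compl_eq_zero fun x hx => ?_, e]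
  · rw [image_eq_zero_of_notMem_tsupport fun h' => hx (hψ.extD_prop.2.2 h')]
    simp [ip]
  · rw [image_eq_zero_of_notMem_tsupport fun h' => hx (hψ.3 h')]
    simp [ip]

lemma MemL2.restrict (h : MemL2 Set.univ u) (U : Set E3) : MemL2 U u :=
  MemLp.mono_measure (Measure.restrict_mono (Set.subset_univ U) le_rfl) h

lemma MemH1.restrict (h : MemH1 Set.univ u) (U : Set E3) : MemH1 U u :=
  ⟨h.1.restrict U, fun S => by
    obtain ⟨g, hg, hg'⟩ := h.2 S
    exact ⟨g, hg.restrict U, hg'.restrict U⟩⟩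

lemma L2Loc.memL2 (h : L2Loc u) (hU : Bornology.IsBounded U) : MemL2 U u := by
  obtain ⟨r, hr⟩ := hU.subset_ball (0 : E3)
  exact (h r).mono_measure (Measure.restrict_mono hr le_rfl)

lemma ip_codSymb_of_deg_one {a : Form} (h : deg 1 a = a) (P : Fin 3 → Form) :
    ip a (codSymb fun j => deg 2 (P j)) = ip a (codSymb P) := by
  rw [← deg_one_codSymb, ← ip_deg_left, h]

lemma ip_dSymb_of_deg_two {a : Form} (h : deg 2 a = a) (P : Fin 3 → Form) :
    ip a (dSymb fun j => deg 1 (P j)) = ip a (dSymb P) := by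
  rw [← deg_two_dSymb, ← ip_deg_left, h]

lemma IsTest.codiff_deg_two (h : IsTest 1 U ψ) (x : E3) :
    codiff (fun x => deg 2 (ψ x)) x = codSymb fun j => deg 2 (pderiv j ψ x) := by
  refine ((h.clm (degL 2)).codiff_eq_symb x).trans ?_
  congr 1
  funext j
  exact pderiv_clm (degL 2) (h.differentiable x) j

lemma extD_deg_one (h : IsTest 1 U ψ) (x : E3) :
    extD (fun x => deg 1 (ψ x)) x = dSymb fun j => deg 1 (pderiv j ψ x) := by
  rw [extD_eq_symb]
  congr 1
  funext j
  exact pderiv_clm (degL 1) (h.differentiable x) j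

/-- The weak exterior derivative of a one-form is a two-form. -/
lemma IsWeakD.deg_two_ae (hU : IsOpen U) (hu : IsHom 1 u) (h : IsWeakD U u v) (hv : MemL2 U v) :
    ∀ᵐ x ∂volume.restrict U, deg 2 (v x) = v x := by
  have h2 : MemL2 U fun x => deg 2 (v x) := (degL 2).comp_memLp' hv
  refine IsWeakD.ae_eq hU (u := u) ⟨h.locInt, h2.locInt, fun ψ hψ => ?_⟩ h
  have e := h.integral_eq _ (hψ.clm (degL 2))
  simp only [degL_apply, hψ.codiff_deg_two, ip_codSymb_of_deg_one (hu.deg_eq _)] at e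
  simp only [ip_deg_left, e, hψ.codiff_eq_symb]

/-- The weak formal adjoint derivative of a two-form is a one-form. -/
lemma IsWeakCod.deg_one_ae (hU : IsOpen U) (hu : IsHom 2 u) (h : IsWeakCod U u v)
    (hv : MemL2 U v) : ∀ᵐ x ∂volume.restrict U, deg 1 (v x) = v x := by
  have h2 : MemL2 U fun x => deg 1 (v x) := (degL 1).comp_memLp' hv
  refine IsWeakCod.ae_eq hU (u := u) ⟨h.locInt, h2.locInt, fun ψ hψ => ?_⟩ h
  have e := h.integral_eq _ (hψ.clm (degL 1))
  simp only [degL_apply, extD_deg_one hψ, ip_dSymb_of_deg_two (hu.deg_eq _)] at e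
  simp only [ip_deg_left, e, extD_eq_symb]

end restrict

section traces
variable {Ω : TopologicalSpace.Opens E3} {u u₁ u₂ g ψ : E3 → Form}

/-- The equation of Cauchy data splits into the two Maxwell equations. -/
lemma maxwell_split (h₁ : MemHd Ω 1 u₁) (h₂ : MemHcod Ω 2 u₂) {a b s : E3 → ℂ}
    (h : ∀ᵐ x ∂(volume.restrict (Ω : Set E3)),
      weakCod Ω u₂ x + a x • u₁ x - weakD Ω u₁ x + b x • u₂ x = s x • u₁ x) :
    (∀ᵐ x ∂(volume.restrict (Ω : Set E3)), weakD Ω u₁ x = b x • u₂ x) ∧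
    ∀ᵐ x ∂(volume.restrict (Ω : Set E3)), weakCod Ω u₂ x = (s x - a x) • u₁ x := by
  have d2 := (h₁.spec Ω.isOpen).1.deg_two_ae Ω.isOpen h₁.1 (h₁.spec Ω.isOpen).2
  have d1 := (h₂.spec Ω.isOpen).1.deg_one_ae Ω.isOpen h₂.1 (h₂.spec Ω.isOpen).2
  rw [← eventually_and]
  filter_upwards [h, d2, d1] with x hx e2 e1
  have hS : ∀ S, weakD Ω u₁ x S = b x * u₂ x S ∧ weakCod Ω u₂ x S = (s x - a x) * u₁ x S := by
    intro S
    have c := congrFun hx S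
    have c2 := congrFun e2 S
    have c1 := congrFun e1 S
    simp only [deg, Pi.add_apply, Pi.sub_apply, Pi.smul_apply, smul_eq_mul] at c c1 c2
    -- du₁ and u₂ have only components of degree 2, δu₂ and u₁ only of degree 1. In each component
    -- at most one of the two equations is therefore non-trivial.
    by_cases k1 : S.card = 1
    · have z := h₂.1 x S (by omega)
      rw [if_neg (by omega)] at c2
      rw [z, ← c2] at c ⊢
      exact ⟨by simp, by linear_combination c⟩
    · have z := h₁.1 x S k1
      rw [if_neg k1] at c1
      rw [z, ← c1] at c ⊢
      exact ⟨by linear_combination -c, by simp⟩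
  exact ⟨funext fun S => (hS S).1, funext fun S => (hS S).2⟩

lemma memH1_deg (hψ : IsTest 1 Set.univ ψ) (l : ℕ) : (fun x => deg l (ψ x)) ∈ H1 Ω l :=
  ⟨isHom_deg l ψ, ((hψ.clm (degL l)).memH1 isOpen_univ).1.restrict Ω⟩

/-- The trace `d tr u` tested against a smooth form. -/
lemma dTrace_test (h : MemHd Ω 1 u)
    (hg : ∀ᵐ x ∂(volume.restrict (Ω : Set E3)), weakD Ω u x = g x) (hψ : IsTest 1 Set.univ ψ)
    (hg2 : IsHom 2 g) :
    dTrace Ω h (Submodule.Quotient.mk ⟨_, memH1_deg hψ 2⟩) =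
      (∫ x in (Ω : Set E3), ip (g x) (ψ x)) - ∫ x in (Ω : Set E3), ip (u x) (codiff ψ x) := by
  rw [dTrace_mk]
  have hc := ((hψ.clm (degL 2)).memH1 isOpen_univ).2.2.restrict (Ω : Set E3)
  congr 1
  · refine integral_congr_ae ?_
    filter_upwards [hg] with x hx
    rw [hx, ← ip_deg_left, hg2.deg_eq]
  · refine integral_congr_ae ?_
    filter_upwards [(weakCod_spec ⟨_, hc⟩).ae_eq Ω.isOpen hc] with x hx
    simp only [degL_apply] at hx
    rw [hx, hψ.codiff_deg_two, ip_codSymb_of_deg_one (h.1.deg_eq x), hψ.codiff_eq_symb]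

/-- The trace `δ tr u` tested against a smooth form. -/
lemma codTrace_test (h : MemHcod Ω 2 u)
    (hg : ∀ᵐ x ∂(volume.restrict (Ω : Set E3)), weakCod Ω u x = g x) (hψ : IsTest 1 Set.univ ψ)
    (hg1 : IsHom 1 g) :
    codTrace Ω h (Submodule.Quotient.mk ⟨_, memH1_deg hψ 1⟩) =
      (∫ x in (Ω : Set E3), ip (g x) (ψ x)) - ∫ x in (Ω : Set E3), ip (u x) (extD ψ x) := by
  rw [codTrace_mk]
  have hc := ((hψ.clm (degL 1)).memH1 isOpen_univ).2.1.restrict (Ω : Set E3)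
  rw [show ((-1 : ℂ) ^ (1 + 1)) = 1 by norm_num, one_mul]
  congr 1
  · refine integral_congr_ae ?_
    filter_upwards [hg] with x hx
    rw [hx, ← ip_deg_left, hg1.deg_eq]
  · refine integral_congr_ae ?_
    filter_upwards [(weakD_spec ⟨_, hc⟩).ae_eq Ω.isOpen hc] with x hx
    simp only [degL_apply] at hx
    rw [hx, extD_deg_one hψ, ip_dSymb_of_deg_two (h.1.deg_eq x), extD_eq_symb]

/-- The form equal to `u'` in `Ω` and to `u` elsewhere. -/
def glue (Ω : TopologicalSpace.Opens E3) (u u' : E3 → Form) (x : E3) : Form :=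
  u x + (Ω : Set E3).indicator (fun x => u' x - u x) x

lemma glue_of_mem {u' : E3 → Form} {x : E3} (hx : x ∈ Ω) : glue Ω u u' x = u' x := by
  have : x ∈ (Ω : Set E3) := hx
  simp [glue, this]

lemma glue_of_notMem {u' : E3 → Form} {x : E3} (hx : x ∉ Ω) : glue Ω u u' x = u x := by
  have : x ∉ (Ω : Set E3) := hx
  simp [glue, this]

lemma isHom_glue {l : ℕ} {u' : E3 → Form} (h : IsHom l u) (h' : IsHom l u') :
    IsHom l (glue Ω u u') := by
  intro x S hS
  by_cases hx : x ∈ Ω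
  · rw [glue_of_mem hx, h' x S hS]
  · rw [glue_of_notMem hx, h x S hS]

lemma l2Loc_glue (hΩ : Bornology.IsBounded (Ω : Set E3)) {u' : E3 → Form} (h : L2Loc u)
    (h' : MemL2 Ω u') : L2Loc (glue Ω u u') := by
  refine h.add fun r => MemLp.restrict _ ?_
  exact (memLp_indicator_iff_restrict Ω.isOpen.measurableSet).2 (h'.sub (h.memL2 hΩ))

/-- An integral identity for `u` carries over to the glued form if the difference of the
contributions of `Ω` vanishes. -/
lemma integral_glue {f f' k : E3 → ℂ} (hf : IntZero f)
    (h' : IntegrableOn f' Ω) (hk : ∀ x ∈ Ω, k x = f' x) (hk' : ∀ x ∉ Ω, k x = f x)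
    (h : ∫ x in (Ω : Set E3), f' x = ∫ x in (Ω : Set E3), f x) : ∫ x, k x = 0 := by
  have e : k = fun x => f x + (Ω : Set E3).indicator (fun x => f' x - f x) x := by
    funext x
    by_cases hx : x ∈ Ω
    · rw [Set.indicator_of_mem (show x ∈ (Ω : Set E3) from hx), hk x hx]
      ring
    · rw [Set.indicator_of_notMem (show x ∉ (Ω : Set E3) from hx), hk' x hx, add_zero]
  have hm := Ω.isOpen.measurableSet
  have i : IntegrableOn (fun x => f' x - f x) (Ω : Set E3) := h'.sub hf.1.integrableOn
  rw [e, integral_add hf.1 (i.integrable_indicator hm), hf.2, integral_indicator hm,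
    integral_sub h' hf.1.integrableOn, h, sub_self, add_zero]

/-- Solutions of the Maxwell systems in `ℝ³` and in `Ω` with the same traces can be glued. -/
theorem weakMaxwell_glue {ω : ℝ} {γ γ' μ μ' : E3 → ℂ} {u₁' u₂' : E3 → Form}
    (hu : WeakMaxwell ω γ μ u₁ u₂) (hΩ : Bornology.IsBounded (Ω : Set E3))
    (hγ : Continuous γ) (hμ : Continuous μ) (hγ' : Continuous γ') (hμ' : Continuous μ')
    (eγ : ∀ x ∉ Ω, γ x = γ' x) (eμ : ∀ x ∉ Ω, μ x = μ' x)
    (h₁ : MemHd Ω 1 u₁) (h₂ : MemHcod Ω 2 u₂) (h₁' : MemHd Ω 1 u₁') (h₂' : MemHcod Ω 2 u₂')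
    (e₁ : ∀ᵐ x ∂(volume.restrict (Ω : Set E3)), weakD Ω u₁' x = (Complex.I * ω * μ' x) • u₂' x)
    (e₂ : ∀ᵐ x ∂(volume.restrict (Ω : Set E3)),
      weakCod Ω u₂' x = (-(Complex.I * ω * γ' x)) • u₁' x)
    (t₁ : dTrace Ω h₁' = dTrace Ω h₁) (t₂ : codTrace Ω h₂' = codTrace Ω h₂) :
    WeakMaxwell ω γ' μ' (glue Ω u₁ u₁') (glue Ω u₂ u₂') := by
  have cc : ∀ {c : E3 → ℂ}, Continuous c → Continuous fun x => Complex.I * ω * c x :=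
    fun hc => continuous_const.mul hc
  have m₁ := l2Loc_glue hΩ hu.mem₁ h₁'.2.1
  have m₂ := l2Loc_glue hΩ hu.mem₂ h₂'.2.1
  have M₁ : L2Loc fun x => (-(Complex.I * ω * γ' x)) • glue Ω u₁ u₁' x :=
    m₁.smul_continuous (cc hγ').neg
  have M₂ : L2Loc fun x => (Complex.I * ω * μ' x) • glue Ω u₂ u₂' x :=
    m₂.smul_continuous (cc hμ')
  have N₁ : L2Loc fun x => (-(Complex.I * ω * γ x)) • u₁ x := hu.mem₁.smul_continuous (cc hγ).neg
  have N₂ : L2Loc fun x => (Complex.I * ω * μ x) • u₂ x := hu.mem₂.smul_continuous (cc hμ)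
  have homs : ∀ {l : ℕ} {v : E3 → Form} (c : E3 → ℂ), IsHom l v → IsHom l fun x => c x • v x :=
    fun c hv x S hS => by simp [hv x S hS]
  refine ⟨m₁, m₂, isHom_glue hu.hom₁ h₁'.1, isHom_glue hu.hom₂ h₂'.1,
    ⟨m₁.locallyIntegrable.locallyIntegrableOn _, M₂.locallyIntegrable.locallyIntegrableOn _,
      fun ψ hψ => ?_⟩,
    ⟨m₂.locallyIntegrable.locallyIntegrableOn _, M₁.locallyIntegrable.locallyIntegrableOn _,
      fun ψ hψ => ?_⟩⟩
  · have lψ := hψ.fgradC.mem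
    have lc := l2c_of_continuous hψ.codiff_prop.1 hψ.codiff_prop.2.1
    have z := hu.weakD.extend hu.mem₁ N₂ hψ.fgradC
    simp only [← hψ.codiff_eq_symb] at z
    rw [Measure.restrict_univ, ← sub_eq_zero,
      ← integral_sub (integrable_ip M₂ lψ) (integrable_ip m₁ lc)]
    have k1 : IntegrableOn (fun x => ip ((Complex.I * ω * μ' x) • u₂' x) (ψ x)) Ω :=
      MemL2.integrable_ip ((memLp_congr_ae e₁).1 (h₁'.spec Ω.isOpen).2)
        (lψ.l2Loc.memL2 hΩ)
    have k2 : IntegrableOn (fun x => ip (u₁' x) (codiff ψ x)) Ω :=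
      h₁'.2.1.integrable_ip (lc.l2Loc.memL2 hΩ)
    have n1 : IntegrableOn (fun x => ip ((Complex.I * ω * μ x) • u₂ x) (ψ x)) Ω :=
      (integrable_ip N₂ lψ).integrableOn
    have n2 : IntegrableOn (fun x => ip (u₁ x) (codiff ψ x)) Ω :=
      (integrable_ip hu.mem₁ lc).integrableOn
    -- Outside Ω the integrand is that of the given global solution. Inside, each of the two
    -- contributions is a trace d tr applied to the class of ψ² on Ω, and the traces agree.
    refine integral_glue z (k1.sub k2) (fun x hx => ?_) (fun x hx => ?_) ?_
    · simp only [glue_of_mem hx, Pi.sub_apply]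
    · simp only [glue_of_notMem hx, eμ x hx]
    · simp only [Pi.sub_apply]
      rw [integral_sub k1 k2, integral_sub n1 n2,
        ← dTrace_test h₁' e₁ hψ (homs _ h₂'.1), t₁]
      refine dTrace_test h₁ ?_ hψ (homs _ hu.hom₂)
      exact (h₁.spec Ω.isOpen).1.ae_eq Ω.isOpen (hu.weakD.restrict Ω)
  · have lψ := hψ.fgradC.mem
    have lc := l2c_of_continuous hψ.extD_prop.1 hψ.extD_prop.2.1
    have z := hu.weakCod.extend hu.mem₂ N₁ hψ.fgradC
    simp only [← extD_eq_symb] at z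
    rw [Measure.restrict_univ, ← sub_eq_zero,
      ← integral_sub (integrable_ip M₁ lψ) (integrable_ip m₂ lc)]
    have k1 : IntegrableOn (fun x => ip ((-(Complex.I * ω * γ' x)) • u₁' x) (ψ x)) Ω :=
      MemL2.integrable_ip ((memLp_congr_ae e₂).1 (h₂'.spec Ω.isOpen).2)
        (lψ.l2Loc.memL2 hΩ)
    have k2 : IntegrableOn (fun x => ip (u₂' x) (extD ψ x)) Ω :=
      h₂'.2.1.integrable_ip (lc.l2Loc.memL2 hΩ)
    have n1 : IntegrableOn (fun x => ip ((-(Complex.I * ω * γ x)) • u₁ x) (ψ x)) Ω :=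
      (integrable_ip N₁ lψ).integrableOn
    have n2 : IntegrableOn (fun x => ip (u₂ x) (extD ψ x)) Ω :=
      (integrable_ip hu.mem₂ lc).integrableOn
    -- The same argument with δ tr and the class of ψ¹; its sign (−1)² is 1.
    refine integral_glue z (k1.sub k2) (fun x hx => ?_) (fun x hx => ?_) ?_
    · simp only [glue_of_mem hx, Pi.sub_apply]
    · simp only [glue_of_notMem hx, eγ x hx]
    · simp only [Pi.sub_apply]
      rw [integral_sub k1 k2, integral_sub n1 n2,
        ← codTrace_test h₂' e₂ hψ (homs _ h₁'.1), t₂]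
      refine codTrace_test h₂ ?_ hψ (homs _ hu.hom₁)
      exact (h₂.spec Ω.isOpen).1.ae_eq Ω.isOpen (hu.weakCod.restrict Ω)

lemma WeakMaxwell.memHd {ω : ℝ} {γ μ : E3 → ℂ} (hu : WeakMaxwell ω γ μ u₁ u₂)
    (hμ : Continuous μ) (hΩ : Bornology.IsBounded (Ω : Set E3)) : MemHd Ω 1 u₁ :=
  ⟨hu.hom₁, hu.mem₁.memL2 hΩ, _, hu.weakD.restrict Ω,
    (hu.mem₂.smul_continuous (continuous_const.mul hμ)).memL2 hΩ⟩

lemma WeakMaxwell.memHcod {ω : ℝ} {γ μ : E3 → ℂ} (hu : WeakMaxwell ω γ μ u₁ u₂)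
    (hγ : Continuous γ) (hΩ : Bornology.IsBounded (Ω : Set E3)) : MemHcod Ω 2 u₂ :=
  ⟨hu.hom₂, hu.mem₂.memL2 hΩ, _, hu.weakCod.restrict Ω,
    (hu.mem₁.smul_continuous (continuous_const.mul hγ).neg).memL2 hΩ⟩

/-- If the Cauchy data sets agree, a solution in `ℝ³` of the first Maxwell system can be changed
inside `Ω` to a solution of the second one. -/
theorem WeakMaxwell.exists_glue {ω : ℝ} (hω : ω ≠ 0) {μ ε σ μ' ε' σ' : E3 → ℝ}
    (hu : WeakMaxwell ω (permittivity ω ε σ) (fun x => (μ x : ℂ)) u₁ u₂)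
    (hΩ : Bornology.IsBounded (Ω : Set E3))
    (hγ : Continuous (permittivity ω ε σ)) (hμ : Continuous fun x => (μ x : ℂ))
    (hγ' : Continuous (permittivity ω ε' σ')) (hμ' : Continuous fun x => (μ' x : ℂ))
    (eγ : ∀ x ∉ Ω, permittivity ω ε σ x = permittivity ω ε' σ' x)
    (eμ : ∀ x ∉ Ω, (μ x : ℂ) = μ' x)
    (hC : CauchyData Ω μ ε σ ω ⊆ CauchyData Ω μ' ε' σ' ω) :
    ∃ v₁ v₂, WeakMaxwell ω (permittivity ω ε' σ') (fun x => (μ' x : ℂ)) v₁ v₂ ∧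
      (∀ x ∉ Ω, v₁ x = u₁ x) ∧ ∀ x ∉ Ω, v₂ x = u₂ x := by
  have hωc : (ω : ℂ) ≠ 0 := by exact_mod_cast hω
  -- With γ = ε + iσ/ω, the current term σ is absorbed: σ − iωε = −iωγ.
  have perm : ∀ (e s : E3 → ℝ) x,
      (s x : ℂ) - Complex.I * ω * e x = -(Complex.I * ω * permittivity ω e s x) := by
    intro e s x
    unfold permittivity
    field_simp
    linear_combination (s x : ℂ) * Complex.I_sq
  have h₁ := hu.memHd hμ hΩ
  have h₂ := hu.memHcod hγ hΩ
  have a₁ := (h₁.spec Ω.isOpen).1.ae_eq Ω.isOpen (hu.weakD.restrict Ω)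
  have a₂ := (h₂.spec Ω.isOpen).1.ae_eq Ω.isOpen (hu.weakCod.restrict Ω)
  have hmem : (codTrace Ω h₂, dTrace Ω h₁) ∈ CauchyData Ω μ ε σ ω := by
    refine ⟨u₁, u₂, h₁, h₂, ?_, rfl, rfl⟩
    filter_upwards [a₁, a₂] with x c₁ c₂
    rw [c₁, c₂, ← perm]
    module
  obtain ⟨u₁', u₂', h₁', h₂', he, t₂, t₁⟩ := hC hmem
  obtain ⟨e₁, e₂⟩ := maxwell_split h₁' h₂' he
  simp only [perm] at e₂
  exact ⟨_, _, weakMaxwell_glue hu hΩ hγ hμ hγ' hμ' eγ eμ h₁ h₂ h₁' h₂' e₁ e₂ t₁ t₂,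
    fun x hx => glue_of_notMem hx, fun x hx => glue_of_notMem hx⟩

end traces

/-! ### Coefficients outside the ball, locality and cutoff -/

section coefficients
variable {γ μ : E3 → ℂ}

lemma eq_of_notMem_tsupport_sub {c : ℂ} {x : E3} (h : x ∉ tsupport fun y => γ y - c) : γ x = c :=
  sub_eq_zero.1 (image_eq_zero_of_notMem_tsupport (f := fun y => γ y - c) h)

/-- Off the topological support γ is constant in a whole neighbourhood of x, so derivatives vanish
as well. -/
lemma gradV_halfLog_eq_zero {c : ℂ} {x : E3} (h : x ∉ tsupport fun y => γ y - c) :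
    gradV (halfLog γ) x = 0 := by
  have e : halfLog γ =ᶠ[𝓝 x] fun _ => Complex.log c / 2 := by
    filter_upwards [notMem_tsupport_iff_eventuallyEq.1 h] with y hy
    rw [halfLog, sub_eq_zero.1 hy]
  funext j
  simp [gradV, pderiv, e.fderiv_eq]

variable {R μ₀ ε₀ ω : ℝ} {μ ε σ : E3 → ℝ}

lemma Admissible.posCoeff_permittivity (h : Admissible R μ₀ ε₀ ω μ ε σ) (hε₀ : 0 < ε₀) :
    PosCoeff (permittivity ω ε σ) := by
  have c : ∀ {f : E3 → ℝ}, ContDiff ℝ 1 f → ContDiff ℝ 1 fun x => (f x : ℂ) := fun hf =>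
    Complex.ofRealCLM.contDiff.comp hf
  refine ⟨(c h.contDiff_eps).add ((contDiff_const.mul (c h.contDiff_sigma)).div_const _),
    fun x => ?_⟩
  have : (permittivity ω ε σ x).re = ε x := by
    simp [permittivity, Complex.div_ofReal_re]
  rw [this]
  exact hε₀.trans_le (h.le_eps x)

lemma Admissible.posCoeff_mu (h : Admissible R μ₀ ε₀ ω μ ε σ) (hμ₀ : 0 < μ₀) :
    PosCoeff fun x => (μ x : ℂ) :=
  ⟨Complex.ofRealCLM.contDiff.comp h.contDiff_mu, fun x => by
    simpa using hμ₀.trans_le (h.le_mu x)⟩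

lemma Admissible.notMem_gamma (h : Admissible R μ₀ ε₀ ω μ ε σ) {x : E3} (hx : R ≤ ‖x‖) :
    x ∉ tsupport fun y => permittivity ω ε σ y - ε₀ := fun h' => by
  have := h.supp_gamma h'
  simp at this
  linarith

lemma Admissible.notMem_mu (h : Admissible R μ₀ ε₀ ω μ ε σ) {x : E3} (hx : R ≤ ‖x‖) :
    x ∉ tsupport fun y => (μ y : ℂ) - μ₀ := fun h' => by
  have := h.supp_mu (tsupport_comp_subset (g := fun t : ℝ => (t : ℂ)) Complex.ofReal_zero
    (fun y => μ y - μ₀) (by simpa only [Function.comp_def, Complex.ofReal_sub] using h'))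
  simp at this
  linarith

end coefficients

section locality
variable {γ μ : E3 → ℂ} {w φ φ' : E3 → Form} {G H H' : Fin 3 → E3 → Form}

lemma oneForm_zero : oneForm 0 = 0 := by simp [oneForm]

/-- The potential only sees its second argument where the coefficients vary. -/
lemma Qform_congr_right (hγ : PosCoeff γ) (hμ : PosCoeff μ) {μ₀ ε₀ : ℝ} (ω : ℝ) (h : FGrad w G)
    (h₁ : FGrad φ H) (h₂ : FGrad φ' H')
    (hloc : ∀ x, (φ x = φ' x ∧ ∀ j, H j x = H' j x) ∨
      (gradV (halfLog γ) x = 0 ∧ gradV (halfLog μ) x = 0 ∧ γ x * μ x = ε₀ * μ₀)) :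
    Qform μ₀ ε₀ γ μ ω w φ = Qform μ₀ ε₀ γ μ ω w φ' := by
  rw [Qform_eq hγ hμ μ₀ ε₀ ω h h₁, Qform_eq hγ hμ μ₀ ε₀ ω h h₂]
  congr 1
  · congr 1
    · congr 1
      · congr 1
        · congr 1
          · refine integral_congr_ae (Eventually.of_forall fun x => ?_)
            rcases hloc x with ⟨e, -⟩ | ⟨ea, eb, -⟩
            · simp only [e]
            · simp [ea, eb, qWave, wedge_oneForm, vee_oneForm, ip]
          · refine integral_congr_ae (Eventually.of_forall fun x => ?_)
            rcases hloc x with ⟨e, -⟩ | ⟨-, -, e⟩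
            · simp only [e]
            · simp [e]
        · refine integral_congr_ae (Eventually.of_forall fun x => ?_)
          rcases hloc x with ⟨e, -⟩ | ⟨ea, eb, -⟩
          · simp only [e]
          · simp [ea, eb, qQuad, oneForm_zero, ip]
      · refine integral_congr_ae (Eventually.of_forall fun x => ?_)
        rcases hloc x with ⟨e, e'⟩ | ⟨ea, eb, -⟩
        · simp only [e, e']
        · simp [ea, eb, qGrad]
    · refine integral_congr_ae (Eventually.of_forall fun x => ?_)
      rcases hloc x with ⟨e, e'⟩ | ⟨-, eb, -⟩
      · simp only [e, e']
      · simp [eb, qSymOne]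
  · refine integral_congr_ae (Eventually.of_forall fun x => ?_)
    rcases hloc x with ⟨e, e'⟩ | ⟨ea, -, -⟩
    · simp only [e, e']
    · simp [ea, qSymTwo]

/-- Zeroth-order terms commute with multiplication by a function. With c = χ and d = ∇χ this is the
product rule for Pᵗ(χv). -/
lemma ptSymb_cutoff (α β : Fin 3 → ℂ) (k c : ℂ) (d : Fin 3 → ℂ) (v : Form) (P : Fin 3 → Form) :
    ptSymb α β k (c • v) (fun j => c • P j + d j • v) =
      c • ptSymb α β k v P + ∑ j, d j • sigma j v := by
  funext S
  simp [ptSymb_apply, Fin.sum_univ_three]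
  ring

/-- A smooth cutoff function. -/
lemma exists_cutoff {r : ℝ} (hr : 0 < r) : ∃ χ : E3 → ℂ, ContDiff ℝ 1 χ ∧ HasCompactSupport χ ∧
    ∀ x, ‖x‖ < r → χ x = 1 ∧ ∀ j, pderiv j χ x = 0 := by
  let f : ContDiffBump (0 : E3) := ⟨r, r + 1, hr, by linarith⟩
  refine ⟨fun x => (f x : ℂ), Complex.ofRealCLM.contDiff.comp f.contDiff,
    f.hasCompactSupport.comp_left (g := fun t : ℝ => (t : ℂ)) Complex.ofReal_zero, fun x hx => ?_⟩
  have one : ∀ y, ‖y‖ < r → f y = 1 := fun y hy =>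
    f.one_of_mem_closedBall (by simpa [f] using hy.le)
  have e : (fun x => (f x : ℂ)) =ᶠ[𝓝 x] fun _ => 1 := by
    filter_upwards [continuous_norm.continuousAt.eventually_lt continuousAt_const hx] with y hy
    rw [one y hy, Complex.ofReal_one]
  exact ⟨by simp [one x hx], fun j => by simp [pderiv, e.fderiv_eq]⟩

end locality

section schroedinger
variable {γ μ : E3 → ℂ} {w : E3 → Form} {G : Fin 3 → E3 → Form}

/-- For a weak solution `w` of the Schrödinger equation, `v = Pᵗ w` solves `P v = 0` weakly. -/
theorem intZero_of_schroedinger (hγ : PosCoeff γ) (hμ : PosCoeff μ) (μ₀ ε₀ ω : ℝ) (h : FGrad w G)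
    (hw : ∀ φ : E3 → Form, IsTest ((⊤ : ℕ∞) : WithTop ℕ∞) Set.univ φ →
      (∫ x, (ip (weakCod Set.univ w x) (codiff φ x) + ip (weakD Set.univ w x) (extD φ x)
        - (ω : ℂ) ^ 2 * ε₀ * μ₀ * ip (w x) (φ x))) + Qform μ₀ ε₀ γ μ ω w φ = 0)
    {φ : E3 → Form} {H : Fin 3 → E3 → Form} (hφ : FGradC φ H) :
    IntZero fun x => ip (ptField ω γ μ w G x) (ptField ω γ μ φ H x) := by
  -- For smooth tests the claim is the equation for w read through the energy identity. The
  -- extension to H¹ tests is needed because χv₂ is only of class H¹.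
  refine ptSymb_identity_extend (fun j => continuous_pderiv hγ.contDiff_halfLog j)
    (fun j => continuous_pderiv hμ.contDiff_halfLog j) (contDiff_waveNum ω hγ hμ).continuous
    (l2Loc_ptField hγ hμ ω h) (fun ψ hψ => ?_) hφ
  have e := energy_eq hγ hμ μ₀ ε₀ ω h hψ.of_top.fgradC
  have e' := hw ψ hψ
  refine e.symm.trans (Eq.trans ?_ e')
  congr 1
  refine integral_congr_ae ?_
  filter_upwards [h.weakD_ae, h.weakCod_ae] with x h1 h2
  rw [h1, h2, hψ.of_top.codiff_eq_symb, extD_eq_symb]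

end schroedinger

end GradedForms

end

/-! ### Conclusion -/

theorem proposition3p1
    (Ω : TopologicalSpace.Opens E3) (hΩ : (Ω : Set E3).Nonempty)
    (hΩb : Bornology.IsBounded (Ω : Set E3)) (hΩL : HasLipschitzBoundary (Ω : Set E3))
    (R : ℝ) (hR : closure (Ω : Set E3) ⊆ Metric.ball 0 R)
    (μ₀ ε₀ ω : ℝ) (hμ₀ : 0 < μ₀) (hε₀ : 0 < ε₀) (hω : 0 < ω)
    (μ₁ ε₁ σ₁ μ₂ ε₂ σ₂ : E3 → ℝ)
    (h₁ : Admissible R μ₀ ε₀ ω μ₁ ε₁ σ₁) (h₂ : Admissible R μ₀ ε₀ ω μ₂ ε₂ σ₂)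
    (γ₁ γ₂ m₁ m₂ : E3 → ℂ)
    (hγ₁ : γ₁ = permittivity ω ε₁ σ₁) (hγ₂ : γ₂ = permittivity ω ε₂ σ₂)
    (hm₁ : m₁ = fun x => (μ₁ x : ℂ)) (hm₂ : m₂ = fun x => (μ₂ x : ℂ))
    (hγ : ∀ x, x ∉ Ω → γ₁ x = γ₂ x) (hμ : ∀ x, x ∉ Ω → μ₁ x = μ₂ x)
    (w₁ : E3 → Form) (hw₁ : MemH1Loc w₁)
    (hw₁_eq : ∀ φ : E3 → Form, IsTest ((⊤ : ℕ∞) : WithTop ℕ∞) Set.univ φ →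
      (∫ x, (ip (weakCod Set.univ w₁ x) (codiff φ x) + ip (weakD Set.univ w₁ x) (extD φ x)
        - (ω : ℂ) ^ 2 * ε₀ * μ₀ * ip (w₁ x) (φ x))) + Qform μ₀ ε₀ γ₁ m₁ ω w₁ φ = 0)
    (hv₁ : ∀ᵐ x, deg 0 (Pt γ₁ m₁ ω w₁ x) + deg 3 (Pt γ₁ m₁ ω w₁ x) = 0)
    (v₂ : E3 → Form) (hv₂ : MemH1Loc v₂) (hv₂_eq : ∀ᵐ x, Pt γ₂ m₂ ω v₂ x = 0)
    (hC : CauchyData Ω μ₁ ε₁ σ₁ ω = CauchyData Ω μ₂ ε₂ σ₂ ω) :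
    Qform μ₀ ε₀ γ₂ m₂ ω w₁ v₂ - Qform μ₀ ε₀ γ₁ m₁ ω w₁ v₂ = 0 := by
  obtain ⟨x₀, hx₀⟩ := hΩ
  have hR0 : 0 < R := (norm_nonneg x₀).trans_lt (by simpa using hR (subset_closure hx₀))
  have hout : ∀ x : E3, R ≤ ‖x‖ → x ∉ Ω := fun x hx hxΩ => by
    have := hR (subset_closure hxΩ)
    simp at this
    linarith
  have pγ₁ : PosCoeff γ₁ := hγ₁ ▸ h₁.posCoeff_permittivity hε₀
  have pγ₂ : PosCoeff γ₂ := hγ₂ ▸ h₂.posCoeff_permittivity hε₀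
  have pm₁ : PosCoeff m₁ := hm₁ ▸ h₁.posCoeff_mu hμ₀
  have pm₂ : PosCoeff m₂ := hm₂ ▸ h₂.posCoeff_mu hμ₀
  have nγ₁ : ∀ x, R ≤ ‖x‖ → x ∉ tsupport fun y => γ₁ y - ε₀ := fun x hx =>
    hγ₁ ▸ h₁.notMem_gamma hx
  have nγ₂ : ∀ x, R ≤ ‖x‖ → x ∉ tsupport fun y => γ₂ y - ε₀ := fun x hx =>
    hγ₂ ▸ h₂.notMem_gamma hx
  have nm₁ : ∀ x, R ≤ ‖x‖ → x ∉ tsupport fun y => m₁ y - μ₀ := fun x hx =>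
    hm₁ ▸ h₁.notMem_mu hx
  have nm₂ : ∀ x, R ≤ ‖x‖ → x ∉ tsupport fun y => m₂ y - μ₀ := fun x hx =>
    hm₂ ▸ h₂.notMem_mu hx
  have hm : ∀ x, x ∉ Ω → m₁ x = m₂ x := fun x hx => by simp only [hm₁, hm₂, hμ x hx]
  obtain ⟨G, hG⟩ := hw₁.exists_fgrad
  obtain ⟨K, hK⟩ := hv₂.exists_fgrad
  have hz := fun φ H => intZero_of_schroedinger (φ := φ) (H := H) pγ₁ pm₁ μ₀ ε₀ ω hG hw₁_eq
  have h0 : ∀ᵐ x, ptField ω γ₁ m₁ w₁ G x ∅ = 0 ∧ ptField ω γ₁ m₁ w₁ G x {0, 1, 2} = 0 := by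
    filter_upwards [hv₁, Pt_ae pγ₁ pm₁ ω hG] with x e1 e2
    rw [e2] at e1
    exact ⟨by simpa [deg_table] using congrFun e1 ∅,
      by simpa [deg_table] using congrFun e1 {0, 1, 2}⟩
  have hmax := weakMaxwell_of_pt pγ₁ pm₁ ω (l2Loc_ptField pγ₁ pm₁ ω hG) h0 hz
  -- This is the only use of the Cauchy data, and only through C₁ ⊆ C₂.
  obtain ⟨u₁, u₂, hu, eu₁, eu₂⟩ : ∃ u₁ u₂, WeakMaxwell ω γ₂ m₂ u₁ u₂ ∧
      (∀ x ∉ Ω, u₁ x = Complex.exp (-1 * halfLog γ₁ x) • deg 1 (ptField ω γ₁ m₁ w₁ G x)) ∧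
      ∀ x ∉ Ω, u₂ x = Complex.exp (-1 * halfLog m₁ x) • deg 2 (ptField ω γ₁ m₁ w₁ G x) := by
    subst hγ₁ hγ₂ hm₁ hm₂
    exact hmax.exists_glue hω.ne' hΩb pγ₁.contDiff.continuous pm₁.contDiff.continuous
      pγ₂.contDiff.continuous pm₂.contDiff.continuous hγ hm hC.subset
  -- χ is 1 on a ball containing B, so the coefficients are constant wherever χ differs from 1 or
  -- has a non-zero derivative.
  obtain ⟨χ, χc, χs, χ1⟩ := exists_cutoff (r := R + 1) (by linarith)
  have hΦ := hK.smul_test χc χs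
  have loc : ∀ x, (v₂ x = χ x • v₂ x ∧ ∀ j, K j x = χ x • K j x + pderiv j χ x • v₂ x) ∨
      R ≤ ‖x‖ := by
    intro x
    rcases lt_or_ge ‖x‖ (R + 1) with hx | hx
    · exact Or.inl ⟨by simp [χ1 x hx], fun j => by simp [χ1 x hx]⟩
    · exact Or.inr (by linarith)
  have q₁ := Qform_congr_right (μ₀ := μ₀) (ε₀ := ε₀) pγ₁ pm₁ ω hG hK hΦ.fgrad fun x =>
    (loc x).imp_right fun hx => ⟨gradV_halfLog_eq_zero (nγ₁ x hx),
      gradV_halfLog_eq_zero (nm₁ x hx), by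
      rw [eq_of_notMem_tsupport_sub (nγ₁ x hx), eq_of_notMem_tsupport_sub (nm₁ x hx)]⟩
  have q₂ := Qform_congr_right (μ₀ := μ₀) (ε₀ := ε₀) pγ₂ pm₂ ω hG hK hΦ.fgrad fun x =>
    (loc x).imp_right fun hx => ⟨gradV_halfLog_eq_zero (nγ₂ x hx),
      gradV_halfLog_eq_zero (nm₂ x hx), by
      rw [eq_of_notMem_tsupport_sub (nγ₂ x hx), eq_of_notMem_tsupport_sub (nm₂ x hx)]⟩
  have en₁ := energy_eq pγ₁ pm₁ μ₀ ε₀ ω hG hΦ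
  have en₂ := energy_eq pγ₂ pm₂ μ₀ ε₀ ω hG hΦ
  rw [(hz _ _ hΦ).2] at en₁
  -- The glued solution may be replaced by P₂ᵗw₁ because the two agree almost everywhere that
  -- P₂ᵗ(χv₂) is non-zero.
  have hlast := ((hu.intZero_pt pγ₂ pm₂ hω.ne' hΦ).congr
    (g := fun x => ip (ptField ω γ₂ m₂ w₁ G x) (ptField ω γ₂ m₂ (fun x => χ x • v₂ x)
      (fun j x => χ x • K j x + pderiv j χ x • v₂ x) x)) ?_).2
  · rw [hlast] at en₂
    rw [q₁, q₂]
    linear_combination en₂ - en₁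
  filter_upwards [hv₂_eq, Pt_ae pγ₂ pm₂ ω hK, h0] with x e1 e2 e3
  rw [e1] at e2
  -- The term χ P₂ᵗv₂ vanishes, which leaves only derivatives of χ.
  have cut : ptField ω γ₂ m₂ (fun x => χ x • v₂ x)
      (fun j x => χ x • K j x + pderiv j χ x • v₂ x) x = ∑ j, pderiv j χ x • sigma j (v₂ x) := by
    refine (ptSymb_cutoff _ _ _ _ (fun j => pderiv j χ x) _ (fun j => K j x)).trans ?_
    change _ • ptField ω γ₂ m₂ v₂ K x + _ = _
    rw [← e2, smul_zero, zero_add]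
  rw [cut]
  rcases lt_or_ge ‖x‖ (R + 1) with hx | hx
  · simp [χ1 x hx, ip]
  · have hx' : R ≤ ‖x‖ := by linarith
    have hxΩ := hout x hx'
    -- Outside B both pairs of coefficients have vanishing logarithmic gradients and equal values,
    -- so the two operators coincide there.
    have same : ptField ω γ₂ m₂ w₁ G x = ptField ω γ₁ m₁ w₁ G x := by
      unfold ptField waveNum rootProd
      rw [gradV_halfLog_eq_zero (nγ₁ x hx'), gradV_halfLog_eq_zero (nγ₂ x hx'),
        gradV_halfLog_eq_zero (nm₁ x hx'), gradV_halfLog_eq_zero (nm₂ x hx'), hγ x hxΩ, hm x hxΩ]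
    have hlγ : halfLog γ₂ x = halfLog γ₁ x := by rw [halfLog, halfLog, hγ x hxΩ]
    have hlm : halfLog m₂ x = halfLog m₁ x := by rw [halfLog, halfLog, hm x hxΩ]
    congr 1
    -- The exponential factors cancel and leave v₁¹ + v₁², which is all of v₁ since its parts of
    -- degrees 0 and 3 vanish.
    rw [same, eu₁ x hxΩ, eu₂ x hxΩ, hlγ, hlm, smul_smul, smul_smul, PosCoeff.exp_mul_exp_neg,
      PosCoeff.exp_mul_exp_neg, one_smul, one_smul]
    apply form_ext <;> simp [deg_table, e3.1, e3.2]
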